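/- Let $\alpha$ be the simple root of $A_1$, $(\alpha,\alpha)=2$, let $\Lambda_R=\mathbb Z\alpha$, and let $\ell=2p=4$. Put $\Lambda^\ominus=\frac1{\sqrt2}\Lambda_R=\mathbb Z\gamma$ with $\gamma=\alpha/\sqrt2$, and $\Lambda^\oplus=\sqrt2\,\Lambda_R^\vee=2\Lambda^\ominus$. Let $\mathcal V_{\Lambda^\ominus}$ be the commutative algebra spanned over $\mathbb C$ by the elements $u\,e^{\phi_\beta}$, $\beta\in\Lambda^\ominus$, $u$ a differential polynomial in $\partial\phi_\gamma$, with the derivation $\partial e^{\phi_\beta}=\partial\phi_\beta\,e^{\phi_\beta}$ and the Hopf structure in which the $\partial^{1+k}\phi_\gamma$ are primitive and the $e^{\phi_\beta}$ are grouplike. It carries the vertex operators $$Y(a)b=\sum_{k\ge0}\langle a^{(2)},b^{(2)}\rangle\, b^{(1)}\,\tfrac{z^k}{k!}\partial^k a^{(1)},$$ where $\langle\,,\rangle$ is the Hopf pairing with values in $\mathbb C[z,z^{-1}]$ such that $\langle e^{\phi_\beta},e^{\phi_{\beta'}}\rangle=z^{(\beta,\beta')}$, $\langle\partial\phi_\gamma,e^{\phi_\beta}\rangle=(\gamma,\beta)z^{-1}$,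 $\langle e^{\phi_\beta},\partial\phi_\gamma\rangle=-(\beta,\gamma)z^{-1}$, $\langle\partial\phi_\gamma,\partial\phi_\gamma\rangle=(\gamma,\gamma)z^{-2}$, with $\langle\partial a,b\rangle=\frac{d}{dz}\langle a,b\rangle$ and $\langle a,\partial b\rangle=-\frac{d}{dz}\langle a,b\rangle$. The parity of $u\,e^{\phi_\beta}$ is $(\beta,\beta)$ mod $2$. Let $\mathcal V_{\Lambda^\oplus}\subset\mathcal V_{\Lambda^\ominus}$ be the span of the $u\,e^{\phi_\beta}$ with $\beta\in\Lambda^\oplus$. The short screening operator $\mathfrak Z_{-\alpha/\sqrt2}$ is the coefficient of $z^{-1}$ in $Y(e^{\phi_{-\alpha/\sqrt2}})$, and $\mathcal W_{A_1,\ell=4}=\ker(\mathfrak Z_{-\alpha/\sqrt2})\cap\mathcal V_{\Lambda^\oplus}$. Let $\mathcal V_{\mathcal{SF}_1}$ be the vertex superalgebra of one pair of symplectic fermions: the vacuum module of the Lie superalgebra with odd generators $\psi_n,\psi^*_n$ ($n\in\mathbb Z$), $[\psi_n,\psi^*_m]_+=n\,\delta_{n+m,0}$ and $[\psi_n,\psi_m]_+=[\psi^*_n,\psi^*_m]_+=0$,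 with fields generated by $\psi(z)=\sum_n\psi_nz^{-n-1}$ and $\psi^*(z)=\sum_n\psi^*_nz^{-n-1}$ through normally ordered products; write $\psi=\psi_{-1}1$, $\psi^*=\psi^*_{-1}1$. Let $\mathcal V_{\mathcal{SF}_1^{even}}$ be its even part. Then: 1. $\Lambda^\ominus$ is an odd integral lattice, with $(m\gamma,n\gamma)=mn$ for $m,n\in\mathbb Z$. 2. $\mathcal V_{\Lambda^\ominus}$ and $\mathcal V_{\mathcal{SF}_1}$ are vertex superalgebras, and $\ker\mathfrak Z_{-\alpha/\sqrt2}\subset\mathcal V_{\Lambda^\ominus}$ is a vertex sub-superalgebra. There is an isomorphism of vertex superalgebras $$F:\ \mathcal V_{\mathcal{SF}_1}\;\xrightarrow{\ \sim\ }\;\ker_{\mathcal V_{\Lambda^\ominus}}\mathfrak Z_{-\alpha/\sqrt2},\qquad \psi\mapsto e^{\phi_{-\alpha/\sqrt2}},\quad \psi^*\mapsto\partial e^{\phi_{\alpha/\sqrt2}}.$$ 3. $\mathcal W_{A_1,\ell=4}$ and $\mathcal V_{\mathcal{SF}_1^{even}}$ are vertex algebras, as subspaces of $\mathcal V_{\Lambda^\ominus}$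 and $\mathcal V_{\mathcal{SF}_1}$ closed under all products, and $F$ restricts to an isomorphism of vertex algebras $\mathcal V_{\mathcal{SF}_1^{even}}\cong\mathcal W_{A_1,\ell=4}$. -/

import Mathlib

open scoped TensorProduct

noncomputable section

/-! ## Vertex superalgebras -/

/-- A complex vector space with a parity grading, a vacuum vector and a state-field
correspondence `a ↦ Y(a, z) = ∑ a_(n) z^(-n-1)`; no axioms are imposed here. -/
structure VertexOps (V : Type*) [AddCommGroup V] [Module ℂ V] where
  parity : ZMod 2 → Submodule ℂ V
  vac : V
  Y : V →ₗ[ℂ] VertexOperator ℂ V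

namespace VertexOps

variable {V V' : Type*} [AddCommGroup V] [Module ℂ V] [AddCommGroup V'] [Module ℂ V']

/-- The mode `a_(n)`, that is, the coefficient of `z^(-n-1)` in `Y(a, z)`. -/
def mode (A : VertexOps V) (a : V) (n : ℤ) : Module.End ℂ V :=
  VertexOperator.ncoeff (A.Y a) n

/-- The translation operator `a ↦ a_(-2) 1`. -/
def translation (A : VertexOps V) (a : V) : V := A.mode a (-2) A.vac

/-- The axioms of a vertex superalgebra. In `locality`, the identity says that
`(z - w)^N` annihilates the supercommutator of `Y(a, z)` and `Y(b, w)`, coefficient by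
coefficient. -/
structure IsVertexSuperalgebra (A : VertexOps V) : Prop where
  parity_isCompl : IsCompl (A.parity 0) (A.parity 1)
  vac_even : A.vac ∈ A.parity 0
  mode_parity : ∀ (i j : ZMod 2) (a b : V) (n : ℤ),
    a ∈ A.parity i → b ∈ A.parity j → A.mode a n b ∈ A.parity (i + j)
  vacuum : ∀ (n : ℤ) (b : V), A.mode A.vac n b = if n = -1 then b else 0
  creation : ∀ a : V, A.mode a (-1) A.vac = a
  regular : ∀ (a : V) (n : ℤ), 0 ≤ n → A.mode a n A.vac = 0
  translation_covariance : ∀ (a b : V) (n : ℤ),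
    A.translation (A.mode a n b) - A.mode a n (A.translation b) = -(n : ℂ) • A.mode a (n - 1) b
  locality : ∀ (i j : ZMod 2) (a b : V), a ∈ A.parity i → b ∈ A.parity j →
    ∃ N : ℕ, ∀ (m n : ℤ) (c : V),
      ∑ k ∈ Finset.range (N + 1), ((-1 : ℂ) ^ k * (N.choose k : ℂ)) •
        (A.mode a (m + N - k) (A.mode b (n + k) c) -
          (-1 : ℂ) ^ (i.val * j.val) • A.mode b (n + k) (A.mode a (m + N - k) c)) = 0

/-- A vertex algebra is a vertex superalgebra without odd part. -/
structure IsVertexAlgebra (A : VertexOps V) : Prop extends A.IsVertexSuperalgebra where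
  no_odd : A.parity 1 = ⊥

/-- Vertex sub-superalgebras: graded subspaces that contain the vacuum and are closed under all
products `a_(n) b`. -/
structure IsSubalgebra (A : VertexOps V) (U : Submodule ℂ V) : Prop where
  vac_mem : A.vac ∈ U
  mode_mem : ∀ (a b : V) (n : ℤ), a ∈ U → b ∈ U → A.mode a n b ∈ U
  graded : U = (U ⊓ A.parity 0) ⊔ (U ⊓ A.parity 1)

/-- The structure induced on a vertex sub-superalgebra. -/
def restrict (A : VertexOps V) (U : Submodule ℂ V) (hU : A.IsSubalgebra U) : VertexOps U where
  parity i := (A.parity i).comap U.subtype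
  vac := ⟨A.vac, hU.vac_mem⟩
  Y :=
    { toFun a := VertexOperator.of_coeff
        (fun k => (HVertexOperator.coeff (A.Y a) k).restrict (p := U) (q := U) (fun b hb => by
          rw [VertexOperator.coeff_eq_ncoeff]
          exact hU.mode_mem a b _ a.2 hb))
        (fun b => by
          obtain ⟨N, hN⟩ : ∃ N : ℤ, ∀ k < N, HVertexOperator.coeff (A.Y a) k b = 0 :=
            ⟨_, fun k hk => VertexOperator.coeff_eq_zero_of_lt_order _ k (b : V) hk⟩
          refine ⟨N, fun k hk => ?_⟩
          by_contra hlt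
          exact hk (Subtype.ext (hN k (not_le.mp hlt))))
      map_add' a a' := by
        ext b : 1
        apply (HahnModule.of ℂ).symm.injective
        ext k
        simp [VertexOperator.of_coeff_apply_coeff]
      map_smul' c a := by
        ext b : 1
        apply (HahnModule.of ℂ).symm.injective
        ext k
        simp [VertexOperator.of_coeff_apply_coeff]
        rfl }

theorem restrict_mode (A : VertexOps V) (U : Submodule ℂ V) (hU : A.IsSubalgebra U)
    (a b : U) (n : ℤ) : ((A.restrict U hU).mode a n b : V) = A.mode a n b := by
  simp [restrict, mode]

/-- Isomorphisms of vertex superalgebras: even linear isomorphisms that preserve the vacuum and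
all products `a_(n) b`. -/
structure Iso (A : VertexOps V) (B : VertexOps V') extends V ≃ₗ[ℂ] V' where
  map_parity : ∀ (i : ZMod 2) (a : V), a ∈ A.parity i ↔ toFun a ∈ B.parity i
  map_vac : toFun A.vac = B.vac
  map_mode : ∀ (a b : V) (n : ℤ), toFun (A.mode a n b) = B.mode (toFun a) n (toFun b)

end VertexOps

/-- A linear map into Laurent series, as a vertex operator. -/
def toVertexOperator {V : Type*} [AddCommGroup V] [Module ℂ V] :
    (V →ₗ[ℂ] LaurentSeries V) →ₗ[ℂ] VertexOperator ℂ V where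
  toFun f :=
    { toFun b := HahnModule.of ℂ (f b)
      map_add' _ _ := by simp
      map_smul' _ _ := by simp; rfl }
  map_add' _ _ := rfl
  map_smul' _ _ := rfl

/-! ## Lattices for the root system `A₁` -/

/-- A full lattice in a Euclidean space is odd integral if all inner products are integers and some
vector has odd square length. -/
structure IsOddIntegralLattice {E : Type*} [NormedAddCommGroup E] [InnerProductSpace ℝ E]
    (L : Submodule ℤ E) : Prop where
  discrete : DiscreteTopology L
  spanning : Submodule.span ℝ (L : Set E) = ⊤
  integral : ∀ x ∈ L, ∀ y ∈ L, ∃ k : ℤ, inner ℝ x y = (k : ℝ)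
  odd : ∃ x ∈ L, ∃ k : ℤ, Odd k ∧ inner ℝ x x = (k : ℝ)

namespace A1Datum

/-- The simple root `α` of `A₁` in the Euclidean line, with `(α, α) = 2`. -/
def root : ℝ := √2

/-- The coroot `2 α / (α, α)`. -/
def coroot : ℝ := (2 / inner ℝ root root) • root

/-- The short screening lattice `Λ_R / √p` for `ℓ = 2p`. -/
def shortLattice (p : ℕ) : Submodule ℤ ℝ :=
  (Submodule.span ℤ {root}).map (LinearMap.mulLeft ℤ (√(p : ℝ))⁻¹)

/-- The short screening momentum `-α / √p`. -/
def shortMomentum (p : ℕ) : ℝ := -(root / √(p : ℝ))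

/-- The long screening lattice `√p Λ_R^∨`. -/
def longLattice (p : ℕ) : Submodule ℤ ℝ :=
  (Submodule.span ℤ {coroot}).map (LinearMap.mulLeft ℤ (√(p : ℝ)))

/-- The vector `mγ` of the short screening lattice for `ℓ = 4`, with `γ = α/√2`. -/
def latticeVector (m : ℤ) : ℝ := m • (root / √2)

end A1Datum

/-! ## The lattice vertex superalgebra of the short screening lattice

The short screening lattice for `ℓ = 4` is `ℤγ` with `γ = α/√2` and `(mγ, nγ) = mn`; its vectors
`mγ` are given by the integers `m`. -/

/-- The algebra of differential polynomials: the variable `X k` is `∂^(1+k) φ_γ`. -/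
abbrev HeisenbergPoly : Type := MvPolynomial ℕ ℂ

/-- The space of the lattice vertex superalgebra: `single m u` is the element `u e^(φ_(mγ))`. -/
abbrev LatticeSpace : Type := AddMonoidAlgebra HeisenbergPoly ℤ

namespace LatticeVA

open MvPolynomial

/-- The element `∂^(1+k) φ_γ`. -/
def boson (k : ℕ) : LatticeSpace := AddMonoidAlgebra.single 0 (X k)

/-- The element `e^(φ_(mγ))`. -/
def expo (m : ℤ) : LatticeSpace := AddMonoidAlgebra.single m 1

/-- The derivation `∂`: `∂ (∂^(1+k) φ_γ) = ∂^(2+k) φ_γ` and `∂ e^(φ_(mγ)) = m ∂φ_γ e^(φ_(mγ))`. -/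
def partialD : LatticeSpace →ₗ[ℂ] LatticeSpace :=
  Finsupp.lsum ℂ (fun m : ℤ =>
    (AddMonoidAlgebra.lsingle (R := ℂ) m) ∘ₗ
      ((mkDerivation ℂ (fun k : ℕ => (X (k + 1) : HeisenbergPoly))).toLinearMap +
        (m : ℂ) • LinearMap.mulLeft ℂ (X 0 : HeisenbergPoly))) ∘ₗ
    (AddMonoidAlgebra.coeffLinearEquiv ℂ).toLinearMap

/-- The coproduct: an algebra map for which `∂^(1+k) φ_γ` is primitive and `e^(φ_(mγ))` is
grouplike. -/
def comul : LatticeSpace →ₐ[ℂ] LatticeSpace ⊗[ℂ] LatticeSpace :=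
  AddMonoidAlgebra.liftNCAlgHom
    (aeval (fun k => boson k ⊗ₜ[ℂ] 1 + 1 ⊗ₜ[ℂ] boson k))
    { toFun := fun m => expo m.toAdd ⊗ₜ[ℂ] expo m.toAdd
      map_one' := by rfl
      map_mul' := fun m n => by
        rw [Algebra.TensorProduct.tmul_mul_tmul, expo, expo, expo,
          AddMonoidAlgebra.single_mul_single, one_mul, toAdd_mul] }
    (fun _ _ => mul_comm (G := LatticeSpace ⊗[ℂ] LatticeSpace) _ _)

/-- The ring `ℂ[z, z⁻¹]` of values of the Hopf pairing. -/
abbrev PairingRing : Type := LaurentPolynomial ℂ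


open LaurentPolynomial (T) in
/-- `⟨∂^(1+k) φ_γ, ∂^(1+l) φ_γ⟩ = (d/dz)^k (-d/dz)^l z^(-2)`. -/
def pairBosonBoson (k l : ℕ) : PairingRing :=
  ((-1 : ℂ) ^ k * ((k + l + 1).factorial : ℂ)) • T (-2 - k - l)

open LaurentPolynomial (T) in
/-- `⟨∂^(1+k) φ_γ, e^(φ_(nγ))⟩ = (d/dz)^k (n z^(-1))`. -/
def pairBosonExpo (k : ℕ) (n : ℤ) : PairingRing :=
  ((n : ℂ) * (-1 : ℂ) ^ k * (k.factorial : ℂ)) • T (-1 - k)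

open LaurentPolynomial (T) in
/-- `⟨e^(φ_(mγ)), ∂^(1+l) φ_γ⟩ = (-d/dz)^l (-m z^(-1))`. -/
def pairExpoBoson (m : ℤ) (l : ℕ) : PairingRing :=
  (-(m : ℂ) * (l.factorial : ℂ)) • T (-1 - l)

/-- The operator `b ↦ ∑ ⟨∂^(1+k) φ_γ, b'⟩ b''` (Sweedler notation for the coproduct of `b`) on
elements `b = v e^(φ_(nγ))`, written as an operator on the polynomial `v`: since `∂^(1+k) φ_γ` is
primitive, it is a derivation on the polynomials plus the scalar `⟨∂^(1+k) φ_γ, e^(φ_(nγ))⟩`. -/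
def contraction (n : ℤ) (k : ℕ) : Module.End PairingRing (MvPolynomial ℕ PairingRing) :=
  (mkDerivation PairingRing
    (fun l : ℕ => (C (pairBosonBoson k l) : MvPolynomial ℕ PairingRing))).toLinearMap +
  algebraMap PairingRing _ (pairBosonExpo k n)

theorem contraction_commute (n : ℤ) (k k' : ℕ) (p : MvPolynomial ℕ PairingRing) :
    contraction n k (contraction n k' p) = contraction n k' (contraction n k p) := by
  have key : ∀ f g : ℕ → PairingRing,
      mkDerivation PairingRing (fun l => (C (f l) : MvPolynomial ℕ PairingRing))
        (mkDerivation PairingRing (fun l => (C (g l) : MvPolynomial ℕ PairingRing)) p) =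
      mkDerivation PairingRing (fun l => (C (g l) : MvPolynomial ℕ PairingRing))
        (mkDerivation PairingRing (fun l => (C (f l) : MvPolynomial ℕ PairingRing)) p) := by
    intro f g
    have : ⁅mkDerivation PairingRing (fun l => (C (f l) : MvPolynomial ℕ PairingRing)),
        mkDerivation PairingRing (fun l => (C (g l) : MvPolynomial ℕ PairingRing))⁆ = 0 := by
      apply MvPolynomial.derivation_ext
      intro i
      simp [Derivation.commutator_apply]
    have h := DFunLike.congr_fun this p
    rw [Derivation.commutator_apply] at h
    exact sub_eq_zero.mp h
  simp only [contraction, LinearMap.add_apply, Module.algebraMap_end_apply, map_add,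
    Derivation.coeFn_coe, map_smul, smul_add, key (pairBosonBoson k)]
  rw [smul_comm (pairBosonExpo k n)]
  abel

open scoped IsMulCommutative in
theorem exists_contractionHom (n : ℤ) :
    ∃ φ : HeisenbergPoly →ₐ[ℂ] Module.End PairingRing (MvPolynomial ℕ PairingRing),
      ∀ k, φ (X k) = contraction n k := by
  have hcomm : IsMulCommutative (Algebra.adjoin ℂ (Set.range (contraction n))) :=
    Algebra.isMulCommutative_adjoin ℂ (by
      rintro _ ⟨k, rfl⟩ _ ⟨k', rfl⟩
      exact LinearMap.ext (contraction_commute n k k'))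
  refine ⟨(Algebra.adjoin ℂ (Set.range (contraction n))).val.comp
    (aeval (fun k => ⟨contraction n k, Algebra.subset_adjoin ⟨k, rfl⟩⟩)), fun k => ?_⟩
  simp

/-- The algebra map that sends `∂^(1+k) φ_γ` to the operator `contraction n k`. -/
def contractionHom (n : ℤ) :
    HeisenbergPoly →ₐ[ℂ] Module.End PairingRing (MvPolynomial ℕ PairingRing) :=
  (exists_contractionHom n).choose

theorem contractionHom_X (n : ℤ) (k : ℕ) : contractionHom n (X k) = contraction n k :=
  (exists_contractionHom n).choose_spec k

/-- The pairing of `u e^(φ_(mγ))` and `v e^(φ_(nγ))`: by multiplicativity in the first argument,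
the factors of `u` act on `v e^(φ_(nγ))` by contraction; the result is then paired with the grouplike
`e^(φ_(mγ))`, which is multiplicative in the second argument, and `⟨e^(φ_(mγ)), e^(φ_(nγ))⟩` is
`z^(mn)`. -/
def pairingAux (m n : ℤ) : HeisenbergPoly →ₗ[ℂ] HeisenbergPoly →ₗ[ℂ] PairingRing :=
  LinearMap.mk₂ ℂ
    (fun u v => LaurentPolynomial.T (m * n) *
      eval (pairExpoBoson m) (contractionHom n u (map (algebraMap ℂ PairingRing) v)))
    (fun _ _ _ => by simp [mul_add])
    (fun c u v => by
      rw [map_smul, LinearMap.smul_apply]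
      rw [← algebraMap_smul PairingRing c, MvPolynomial.smul_eval, ← mul_assoc,
        mul_comm _ (algebraMap ℂ PairingRing c), mul_assoc, Algebra.smul_def])
    (fun _ _ _ => by simp [mul_add])
    (fun c u v => by
      rw [MvPolynomial.smul_eq_C_mul, map_mul, MvPolynomial.map_C, ← MvPolynomial.smul_eq_C_mul,
        map_smul, MvPolynomial.smul_eval, ← mul_assoc,
        mul_comm _ (algebraMap ℂ PairingRing c), mul_assoc, Algebra.smul_def])

/-- The Hopf pairing `⟨ , ⟩` on the lattice space, with values in `ℂ[z, z⁻¹]`. -/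
def pairing : LatticeSpace →ₗ[ℂ] LatticeSpace →ₗ[ℂ] PairingRing :=
  (Finsupp.lsum ℂ (fun m : ℤ => ((Finsupp.lsum ℂ (fun n : ℤ => (pairingAux m n).flip)) ∘ₗ
    (AddMonoidAlgebra.coeffLinearEquiv ℂ).toLinearMap).flip)) ∘ₗ
  (AddMonoidAlgebra.coeffLinearEquiv ℂ).toLinearMap

theorem pairing_single (m n : ℤ) (u v : HeisenbergPoly) :
    pairing (AddMonoidAlgebra.single m u) (AddMonoidAlgebra.single n v) =
      LaurentPolynomial.T (m * n) *
        eval (pairExpoBoson m) (contractionHom n u (map (algebraMap ℂ PairingRing) v)) := by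
  simp only [pairing, LinearMap.comp_apply, LinearEquiv.coe_coe,
    AddMonoidAlgebra.coeffLinearEquiv_apply, AddMonoidAlgebra.coeff_single, Finsupp.lsum_single,
    LinearMap.flip_apply, pairingAux, LinearMap.mk₂_apply]

/-- The series `e^(z∂) a = ∑ z^k / k! ∂^k a`. -/
def taylor : LatticeSpace →ₗ[ℂ] LaurentSeries LatticeSpace where
  toFun a := HahnSeries.ofPowerSeries ℤ LatticeSpace
    (PowerSeries.mk fun k => ((k.factorial : ℂ)⁻¹) • (partialD ^ k) a)
  map_add' a b := by
    rw [← map_add]; congr 1; ext k; simp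
  map_smul' c a := by
    have h : (PowerSeries.mk fun k => ((k.factorial : ℂ)⁻¹) • (partialD ^ k) (c • a)) =
        c • (PowerSeries.mk fun k => ((k.factorial : ℂ)⁻¹) • (partialD ^ k) a) := by
      ext k : 1
      simp only [PowerSeries.coeff_mk, map_smul]
      rw [smul_comm, PowerSeries.coeff_smul, PowerSeries.coeff_mk]
    rw [h]
    exact map_smul (HahnSeries.ofPowerSeriesAlg (A := LatticeSpace) ℤ ℂ) c _

/-- Constant Laurent series. -/
def constant : LatticeSpace →ₗ[ℂ] LaurentSeries LatticeSpace := HahnSeries.single.linearMap 0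

/-- The inclusion of scalar Laurent polynomials into Laurent series. -/
def scalarSeries : PairingRing →ₗ[ℂ] LaurentSeries LatticeSpace :=
  Finsupp.lsum ℂ (fun p : ℤ =>
    (HahnSeries.single.linearMap p : LatticeSpace →ₗ[ℂ] LaurentSeries LatticeSpace) ∘ₗ
      Algebra.linearMap ℂ LatticeSpace) ∘ₗ
  (AddMonoidAlgebra.coeffLinearEquiv ℂ).toLinearMap

/-- The map `(a' ⊗ b') ⊗ (a'' ⊗ b'') ↦ ⟨a'', b''⟩ b' e^(z∂) a'`. -/
def fieldCore : (LatticeSpace ⊗[ℂ] LatticeSpace) ⊗[ℂ] (LatticeSpace ⊗[ℂ] LatticeSpace) →ₗ[ℂ]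
    LaurentSeries LatticeSpace :=
  LinearMap.mul' ℂ (LaurentSeries LatticeSpace) ∘ₗ
  TensorProduct.map
    (LinearMap.mul' ℂ (LaurentSeries LatticeSpace) ∘ₗ TensorProduct.map taylor constant)
    (scalarSeries ∘ₗ TensorProduct.lift pairing)

/-- The vertex operator `Y(a) b = ∑ ⟨a'', b''⟩ b' e^(z∂) a'`, where `∑ a' ⊗ a''` and `∑ b' ⊗ b''` are
the coproducts of `a` and `b`. -/
def field : LatticeSpace →ₗ[ℂ] LatticeSpace →ₗ[ℂ] LaurentSeries LatticeSpace :=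
  ((TensorProduct.mk ℂ (LatticeSpace ⊗[ℂ] LatticeSpace) (LatticeSpace ⊗[ℂ] LatticeSpace)).compl₁₂
    comul.toLinearMap comul.toLinearMap).compr₂
  (fieldCore ∘ₗ
    (TensorProduct.tensorTensorTensorComm ℂ LatticeSpace LatticeSpace LatticeSpace
      LatticeSpace).toLinearMap)

/-- The lattice vertex superalgebra of `ℤγ`, `(γ, γ) = 1`; the parity of `u e^(φ_(mγ))` is the
parity of `(mγ, mγ) = m²`. -/
def vertexOps : VertexOps LatticeSpace where
  parity i := AddMonoidAlgebra.supported ℂ HeisenbergPoly {m : ℤ | ((m * m : ℤ) : ZMod 2) = i}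
  vac := expo 0
  Y := toVertexOperator ∘ₗ field

/-- The screening operator `resY(e^(φ_(mγ)))`, the coefficient of `z^(-1)` in the vertex operator
of `e^(φ_(mγ))`. -/
def screening (m : ℤ) : Module.End ℂ LatticeSpace :=
  HVertexOperator.coeff (vertexOps.Y (expo m)) (-1)

/-- The kernel of the short screening operator for the momentum `-α/√2 = -γ`. -/
def screeningKernel : Submodule ℂ LatticeSpace := LinearMap.ker (screening (-1))

/-- The subspace spanned by all `u e^(φ_β)` with `β` in the long screening lattice: the lattice
vertex algebra of that sublattice. -/
def longSpace : Submodule ℂ LatticeSpace :=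
  AddMonoidAlgebra.supported ℂ HeisenbergPoly
    {m : ℤ | A1Datum.latticeVector m ∈ A1Datum.longLattice 2}

/-- The kernel of the short screening operator in the lattice vertex algebra of the long screening
lattice. -/
def screeningKernelLong : Submodule ℂ LatticeSpace := longSpace ⊓ screeningKernel

end LatticeVA

/-! ## The vertex superalgebra of one pair of symplectic fermions

The affine Lie superalgebra of the purely odd symplectic plane has odd generators `ψ_n`, `ψ*_n` with
`[ψ_n, ψ*_m]_+ = n δ_(n+m,0)`. Its vacuum module, on which all `ψ_n`, `ψ*_n` with `n ≥ 0` annihilate the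
vacuum, is the exterior algebra on the creation modes `ψ_n`, `ψ*_n` with `n < 0`. -/

/-- The span of the creation modes: the basis vector at `Sum.inl k` is `ψ_(-k-1)`, the basis vector at
`Sum.inr k` is `ψ*_(-k-1)`. -/
abbrev FermionModes : Type := (ℕ ⊕ ℕ) →₀ ℂ

/-- The vacuum module. -/
abbrev FermionSpace : Type := ExteriorAlgebra ℂ FermionModes

namespace SymplecticFermions

open CliffordAlgebra

/-- The creation mode with index `i`, as an element of the exterior algebra. -/
def creator (i : ℕ ⊕ ℕ) : FermionSpace := ExteriorAlgebra.ι ℂ (Finsupp.single i 1)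

/-- The odd derivative with respect to the creation mode with index `i`. -/
def annihilator (i : ℕ ⊕ ℕ) : Module.End ℂ FermionSpace :=
  contractLeft (Q := (0 : QuadraticForm ℂ FermionModes)) (Finsupp.lapply i)

/-- The operator `ψ_n`. -/
def psi : ℤ → Module.End ℂ FermionSpace
  | Int.negSucc k => LinearMap.mulLeft ℂ (creator (Sum.inl k))
  | Int.ofNat n => (n : ℂ) • annihilator (Sum.inr (n - 1))

/-- The operator `ψ*_n`. -/
def psiStar : ℤ → Module.End ℂ FermionSpace
  | Int.negSucc k => LinearMap.mulLeft ℂ (creator (Sum.inr k))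
  | Int.ofNat n => (-n : ℂ) • annihilator (Sum.inl (n - 1))

/-- The modes of the field of a creation mode: the field of `ψ_(-k-1) 1` is the divided derivative
`(∂^k/k!) ψ(z)` of `ψ(z) = ∑ ψ_n z^(-n-1)`, and its coefficient of `z^(-n-1)` is
`(-1)^k (n choose k) ψ_(n-k)`. Likewise for `ψ*`. -/
def genMode : ℕ ⊕ ℕ → ℤ → Module.End ℂ FermionSpace
  | Sum.inl k, n => (((-1) ^ k * Ring.choose n k : ℤ) : ℂ) • psi (n - k)
  | Sum.inr k, n => (((-1) ^ k * Ring.choose n k : ℤ) : ℂ) • psiStar (n - k)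

/-- The modes of the field of a linear combination of creation modes. -/
def fieldMode (n : ℤ) : FermionModes →ₗ[ℂ] Module.End ℂ FermionSpace :=
  Finsupp.linearCombination ℂ (fun i => genMode i n)

/-- The parity involution, `1` on even and `-1` on odd elements. -/
def parityInv : FermionSpace →ₐ[ℂ] FermionSpace :=
  involute (Q := (0 : QuadraticForm ℂ FermionModes))

/-- The creation part `A(z)_+ = ∑_{n < 0} A_n z^(-n-1)` of the field `A(z)` of `w`. Its coefficients are
multiplications by elements of the exterior algebra, and are given here by these elements. -/
def creationPart (w : FermionModes) : LaurentSeries FermionSpace :=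
  HahnSeries.ofPowerSeries ℤ FermionSpace
    (PowerSeries.mk fun j => fieldMode (-1 - j) w 1)

theorem exists_dual (j : ℕ) (w : FermionModes) :
    ∃ d : Module.Dual ℂ FermionModes,
      fieldMode j w = contractLeft (Q := (0 : QuadraticForm ℂ FermionModes)) d := by
  induction w using Finsupp.induction_linear with
  | zero => exact ⟨0, by simp⟩
  | add f g hf hg =>
    obtain ⟨d, hd⟩ := hf
    obtain ⟨d', hd'⟩ := hg
    exact ⟨d + d', by rw [map_add, hd, hd', map_add]⟩
  | single i c =>
    have key : ∃ d : Module.Dual ℂ FermionModes,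
        genMode i j = contractLeft (Q := (0 : QuadraticForm ℂ FermionModes)) d := by
      rcases i with k | k
      · rcases lt_or_ge j k with h | h
        · exact ⟨0, by
            rw [genMode, Ring.choose_natCast, Nat.choose_eq_zero_of_lt h]; simp⟩
        · refine ⟨((((-1) ^ k * Ring.choose (j : ℤ) k : ℤ) : ℂ) * ((j - k : ℕ) : ℂ)) •
            Finsupp.lapply (Sum.inr (j - k - 1)), ?_⟩
          rw [genMode, ← Nat.cast_sub h]
          change _ • (((j - k : ℕ) : ℂ) • annihilator _) = _
          rw [map_smul, smul_smul]; rfl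
      · rcases lt_or_ge j k with h | h
        · exact ⟨0, by
            rw [genMode, Ring.choose_natCast, Nat.choose_eq_zero_of_lt h]; simp⟩
        · refine ⟨((((-1) ^ k * Ring.choose (j : ℤ) k : ℤ) : ℂ) * (-(j - k : ℕ) : ℂ)) •
            Finsupp.lapply (Sum.inl (j - k - 1)), ?_⟩
          rw [genMode, ← Nat.cast_sub h]
          change _ • ((-(j - k : ℕ) : ℂ) • annihilator _) = _
          rw [map_smul, smul_smul]; rfl
    obtain ⟨d, hd⟩ := key
    exact ⟨c • d, by rw [fieldMode, Finsupp.linearCombination_single, hd, map_smul]⟩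


theorem exists_creator (j : ℕ) (w : FermionModes) :
    ∃ u : FermionModes, fieldMode (-1 - j) w = LinearMap.mulLeft ℂ (ExteriorAlgebra.ι ℂ u) := by
  induction w using Finsupp.induction_linear with
  | zero => exact ⟨0, by ext; simp⟩
  | add f g hf hg =>
    obtain ⟨d, hd⟩ := hf
    obtain ⟨d', hd'⟩ := hg
    exact ⟨d + d', by ext x; simp [hd, hd', add_mul]⟩
  | single i c =>
    have h : ∀ k : ℕ, (-1 - (j : ℤ) - k) = Int.negSucc (j + k) := fun k => by
      rw [Int.negSucc_eq]; push_cast; ring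
    rcases i with k | k
    · refine ⟨(c * (((-1) ^ k * Ring.choose (-1 - j : ℤ) k : ℤ) : ℂ)) •
        Finsupp.single (Sum.inl (j + k)) 1, ?_⟩
      rw [fieldMode, Finsupp.linearCombination_single, genMode, h]
      refine LinearMap.ext fun x => ?_
      simp only [psi, LinearMap.smul_apply, LinearMap.mulLeft_apply, creator, smul_smul]
      rw [map_smul, smul_mul_assoc]
    · refine ⟨(c * (((-1) ^ k * Ring.choose (-1 - j : ℤ) k : ℤ) : ℂ)) •
        Finsupp.single (Sum.inr (j + k)) 1, ?_⟩
      rw [fieldMode, Finsupp.linearCombination_single, genMode, h]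
      refine LinearMap.ext fun x => ?_
      simp only [psiStar, LinearMap.smul_apply, LinearMap.mulLeft_apply, creator, smul_smul]
      rw [map_smul, smul_mul_assoc]

theorem genMode_ι_eq_zero (i i' : ℕ ⊕ ℕ) : ∃ M : ℕ, ∀ j : ℕ, M ≤ j →
    genMode i j (ExteriorAlgebra.ι ℂ (Finsupp.single i' 1)) = 0 := by
  refine ⟨Sum.elim id id i + Sum.elim id id i' + 2, fun j hj => ?_⟩
  rcases i with k | k <;> rcases i' with l | l <;> simp only [Sum.elim_inl, Sum.elim_inr, id] at hj
  all_goals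
    have h : (j : ℤ) - k = Int.ofNat (j - k) := by
      rw [← Nat.cast_sub (by omega)]; rfl
    rw [genMode, h]
    simp only [psi, psiStar, annihilator, LinearMap.smul_apply]
    rw [ExteriorAlgebra.ι, contractLeft_ι]
    simp [Finsupp.single_apply]
    try omega

theorem exists_bound (w : FermionModes) (b : FermionSpace) :
    ∃ M : ℕ, ∀ j : ℕ, M ≤ j → fieldMode j w b = 0 := by
  have key : ∀ w u : FermionModes, ∃ M : ℕ, ∀ j : ℕ, M ≤ j →
      fieldMode j w (ExteriorAlgebra.ι ℂ u) = 0 := by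
    intro w u
    induction w using Finsupp.induction_linear with
    | zero => exact ⟨0, by simp⟩
    | add f g hf hg =>
      obtain ⟨M, hM⟩ := hf
      obtain ⟨M', hM'⟩ := hg
      exact ⟨max M M', fun j hj => by
        simp [hM j (le_trans (le_max_left _ _) hj), hM' j (le_trans (le_max_right _ _) hj)]⟩
    | single i c =>
      induction u using Finsupp.induction_linear with
      | zero => exact ⟨0, by simp⟩
      | add f g hf hg =>
        obtain ⟨M, hM⟩ := hf
        obtain ⟨M', hM'⟩ := hg
        exact ⟨max M M', fun j hj => by
          rw [map_add, map_add, hM j (le_trans (le_max_left _ _) hj),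
            hM' j (le_trans (le_max_right _ _) hj), add_zero]⟩
      | single i' c' =>
        obtain ⟨M, hM⟩ := genMode_ι_eq_zero i i'
        refine ⟨M, fun j hj => ?_⟩
        rw [← mul_one c', ← smul_eq_mul, ← Finsupp.smul_single, map_smul, map_smul, fieldMode,
          Finsupp.linearCombination_single, LinearMap.smul_apply, hM j hj, smul_zero, smul_zero]
  induction b using CliffordAlgebra.left_induction with
  | algebraMap r =>
    refine ⟨0, fun j _ => ?_⟩
    obtain ⟨d, hd⟩ := exists_dual j w
    rw [hd, contractLeft_algebraMap]
  | add x y hx hy =>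
    obtain ⟨M, hM⟩ := hx
    obtain ⟨M', hM'⟩ := hy
    exact ⟨max M M', fun j hj => by
      rw [map_add, hM j (le_trans (le_max_left _ _) hj),
        hM' j (le_trans (le_max_right _ _) hj), add_zero]⟩
  | ι_mul x u hx =>
    obtain ⟨M, hM⟩ := hx
    obtain ⟨M', hM'⟩ := key w u
    refine ⟨max M M', fun j hj => ?_⟩
    have h1 := hM j (le_trans (le_max_left _ _) hj)
    have h2 := hM' j (le_trans (le_max_right _ _) hj)
    obtain ⟨d, hd⟩ := exists_dual j w
    rw [hd] at h1 h2 ⊢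
    rw [ExteriorAlgebra.ι, contractLeft_ι] at h2
    rw [contractLeft_ι_mul, h1, mul_zero, sub_zero, Algebra.smul_def, h2, zero_mul]


/-- Laurent series in `z` with coefficients in the vacuum module. -/
abbrev FermionSeries : Type := LaurentSeries FermionSpace

/-- The parity involution on Laurent series. -/
def parityInvSeries : FermionSeries →ₗ[ℂ] FermionSeries where
  toFun x := x.map parityInv
  map_add' x y := by ext; simp
  map_smul' c x := by ext; simp

/-- The monomial `z^p`. -/
def monomial (p : ℤ) : FermionSeries := HahnSeries.single p 1

/-- The `j`-th summand of `± B(z) A(z)_-` applied to `b`, where `A(z)_- = ∑_{j ≥ 0} A_j z^(-j-1)` is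
the annihilation part of the field `A(z)` of `w`, and the sign is the parity of `B`. -/
def annihilationTerm (w : FermionModes) (B : FermionSpace →ₗ[ℂ] FermionSeries) (j : ℕ)
    (b : FermionSpace) : FermionSeries :=
  monomial (-1 - j) * parityInvSeries (B (parityInv (fieldMode j w b)))

theorem annihilationTerm_eq_zero (w : FermionModes) (B : FermionSpace →ₗ[ℂ] FermionSeries) (j : ℕ)
    (b : FermionSpace) (h : fieldMode j w b = 0) : annihilationTerm w B j b = 0 := by
  simp [annihilationTerm, h]

theorem finite_support_annihilationTerm (w : FermionModes)
    (B : FermionSpace →ₗ[ℂ] FermionSeries) (b : FermionSpace) :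
    (Function.support fun j => annihilationTerm w B j b).Finite := by
  obtain ⟨M, hM⟩ := exists_bound w b
  refine (Finset.range M).finite_toSet.subset fun j hj => ?_
  by_contra hlt
  exact hj (annihilationTerm_eq_zero w B j b (hM j (by simpa using hlt)))

/-- The normally ordered product `:A(z) B(z): = A(z)_+ B(z) ± B(z) A(z)_-` of the field `A(z)` of `w`
with `B(z)`. -/
def normalOrderAux (w : FermionModes) (B : FermionSpace →ₗ[ℂ] FermionSeries) :
    FermionSpace →ₗ[ℂ] FermionSeries where
  toFun b := creationPart w * B b + ∑ᶠ j : ℕ, annihilationTerm w B j b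
  map_add' b b' := by
    have h : ∀ j, annihilationTerm w B j (b + b') =
        annihilationTerm w B j b + annihilationTerm w B j b' := by
      intro j; simp [annihilationTerm, mul_add]
    simp_rw [h]
    rw [finsum_add_distrib (finite_support_annihilationTerm w B b)
      (finite_support_annihilationTerm w B b'), map_add, mul_add]
    abel
  map_smul' c b := by
    have h : ∀ j, annihilationTerm w B j (c • b) = c • annihilationTerm w B j b := by
      intro j; simp [annihilationTerm]
    simp_rw [h]
    rw [← smul_finsum, map_smul, mul_smul_comm, RingHom.id_apply, smul_add]

theorem creationPart_add (w w' : FermionModes) :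
    creationPart (w + w') = creationPart w + creationPart w' := by
  rw [creationPart, creationPart, creationPart, ← map_add]
  congr 1
  ext j : 1
  simp

theorem creationPart_smul (c : ℂ) (w : FermionModes) :
    creationPart (c • w) = c • creationPart w := by
  have h : (PowerSeries.mk fun j : ℕ => fieldMode (-1 - j) (c • w) 1) =
      c • PowerSeries.mk fun j : ℕ => fieldMode (-1 - j) w 1 := by
    ext j : 1
    rw [PowerSeries.coeff_smul]
    simp
  rw [creationPart, h]
  ext n
  rw [HahnSeries.coeff_smul, creationPart]
  rcases le_or_gt 0 n with hn | hn
  · lift n to ℕ using hn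
    rw [HahnSeries.ofPowerSeries_apply_coeff, HahnSeries.ofPowerSeries_apply_coeff,
      PowerSeries.coeff_smul]
  · rw [HahnSeries.ofPowerSeries_apply, HahnSeries.ofPowerSeries_apply,
      HahnSeries.embDomain_of_notMem_range, HahnSeries.embDomain_of_notMem_range, smul_zero]
    all_goals
      rintro ⟨m, hm⟩
      simp at hm
      omega

/-- The normally ordered product, as a bilinear map. -/
def normalOrder : FermionModes →ₗ[ℂ] (FermionSpace →ₗ[ℂ] FermionSeries) →ₗ[ℂ]
    (FermionSpace →ₗ[ℂ] FermionSeries) :=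
  LinearMap.mk₂ ℂ normalOrderAux
    (fun w w' B => by
      refine LinearMap.ext fun b => ?_
      have h : ∀ j, annihilationTerm (w + w') B j b =
          annihilationTerm w B j b + annihilationTerm w' B j b := by
        intro j; simp [annihilationTerm, mul_add]
      simp only [normalOrderAux, LinearMap.coe_mk, AddHom.coe_mk, LinearMap.add_apply, h]
      rw [finsum_add_distrib (finite_support_annihilationTerm w B b)
        (finite_support_annihilationTerm w' B b), creationPart_add, add_mul]
      abel)
    (fun c w B => by
      refine LinearMap.ext fun b => ?_
      have h : ∀ j, annihilationTerm (c • w) B j b = c • annihilationTerm w B j b := by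
        intro j; simp [annihilationTerm]
      simp only [normalOrderAux, LinearMap.coe_mk, AddHom.coe_mk, LinearMap.smul_apply, h]
      rw [← smul_finsum, creationPart_smul, smul_mul_assoc, smul_add])
    (fun w B B' => by
      refine LinearMap.ext fun b => ?_
      have h : ∀ j, annihilationTerm w (B + B') j b =
          annihilationTerm w B j b + annihilationTerm w B' j b := by
        intro j; simp [annihilationTerm, mul_add]
      simp only [normalOrderAux, LinearMap.coe_mk, AddHom.coe_mk, LinearMap.add_apply, h]
      rw [finsum_add_distrib (finite_support_annihilationTerm w B b)
        (finite_support_annihilationTerm w B' b), mul_add]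
      abel)
    (fun c w B => by
      refine LinearMap.ext fun b => ?_
      have h : ∀ j, annihilationTerm w (c • B) j b = c • annihilationTerm w B j b := by
        intro j; simp [annihilationTerm]
      simp only [normalOrderAux, LinearMap.coe_mk, AddHom.coe_mk, LinearMap.smul_apply, h]
      rw [← smul_finsum, mul_smul_comm, smul_add])


theorem monomial_mul_comm (p : ℤ) (x : FermionSeries) : monomial p * x = x * monomial p := by
  ext n
  rw [monomial, HahnSeries.coeff_single_mul, HahnSeries.coeff_mul_single, one_mul, mul_one]

theorem monomial_mul_monomial (p q : ℤ) : monomial p * monomial q = monomial (p + q) := by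
  rw [monomial, monomial, HahnSeries.single_mul_single, one_mul, monomial]

theorem parityInvSeries_mul (x y : FermionSeries) :
    parityInvSeries (x * y) = parityInvSeries x * parityInvSeries y :=
  HahnSeries.map_mul (parityInv : FermionSpace →ₙ+* FermionSpace)

theorem parityInvSeries_monomial (p : ℤ) : parityInvSeries (monomial p) = monomial p := by
  ext n
  by_cases h : n = p
  · subst h; simp [parityInvSeries, monomial]
  · simp [parityInvSeries, monomial, HahnSeries.coeff_single_of_ne h]

theorem parityInv_parityInv (x : FermionSpace) : parityInv (parityInv x) = x :=
  involute_involute x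

theorem parityInvSeries_parityInvSeries (x : FermionSeries) :
    parityInvSeries (parityInvSeries x) = x := by
  ext n
  exact parityInv_parityInv _

theorem parityInv_contractLeft (d : Module.Dual ℂ FermionModes) (x : FermionSpace) :
    parityInv (contractLeft (Q := (0 : QuadraticForm ℂ FermionModes)) d x) =
      -contractLeft (Q := (0 : QuadraticForm ℂ FermionModes)) d (parityInv x) := by
  induction x using CliffordAlgebra.left_induction with
  | algebraMap r => simp [parityInv, contractLeft_algebraMap]
  | add x y hx hy => simp only [map_add, hx, hy, neg_add]
  | ι_mul x u hx =>
    have hu : parityInv (ι 0 u) = -ι 0 u := involute_ι u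
    rw [contractLeft_ι_mul, map_sub, map_smul, map_mul, map_mul, hu, hx, neg_mul, neg_mul, map_neg,
      contractLeft_ι_mul, mul_neg]
    abel

theorem parityInvSeries_creationPart (w : FermionModes) :
    parityInvSeries (creationPart w) = -creationPart w := by
  ext n
  change parityInv ((creationPart w).coeff n) = -(creationPart w).coeff n
  rcases le_or_gt 0 n with hn | hn
  · lift n to ℕ using hn
    rw [creationPart, HahnSeries.ofPowerSeries_apply_coeff, PowerSeries.coeff_mk]
    obtain ⟨u, hu⟩ := exists_creator n w
    rw [hu, LinearMap.mulLeft_apply, mul_one]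
    exact involute_ι u
  · rw [creationPart, HahnSeries.ofPowerSeries_apply, HahnSeries.embDomain_of_notMem_range, map_zero,
      neg_zero]
    rintro ⟨m, hm⟩
    simp at hm
    omega

theorem eq_zero_of_eq_neg {V : Type*} [AddCommGroup V] [Module ℂ V] {x : V} (h : x = -x) :
    x = 0 := by
  have h2 : (2 : ℂ) • x = 0 := by
    rw [two_smul]
    nth_rewrite 1 [h]
    exact neg_add_cancel x
  exact (smul_eq_zero.mp h2).resolve_left two_ne_zero

theorem creationPart_mul_self (w : FermionModes) : creationPart w * creationPart w = 0 := by
  suffices hs : (PowerSeries.mk fun j : ℕ => fieldMode (-1 - j) w 1) *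
      (PowerSeries.mk fun j : ℕ => fieldMode (-1 - j) w 1) = 0 by
    rw [creationPart, ← map_mul, hs, map_zero]
  ext n
  rw [PowerSeries.coeff_mul, map_zero]
  simp only [PowerSeries.coeff_mk]
  have h : ∀ i j : ℕ, fieldMode (-1 - i) w 1 * fieldMode (-1 - j) w 1 =
      -(fieldMode (-1 - j) w 1 * fieldMode (-1 - i) w 1) := by
    intro i j
    obtain ⟨u, hu⟩ := exists_creator i w
    obtain ⟨v, hv⟩ := exists_creator j w
    rw [hu, hv, LinearMap.mulLeft_apply, LinearMap.mulLeft_apply, mul_one, mul_one]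
    exact eq_neg_of_add_eq_zero_left (ExteriorAlgebra.ι_add_mul_swap u v)
  refine eq_zero_of_eq_neg ?_
  rw [← Finset.sum_neg_distrib]
  rw [← Finset.Nat.sum_antidiagonal_swap]
  exact Finset.sum_congr rfl fun p _ => h _ _

theorem normalOrder_normalOrder (w : FermionModes) (B : FermionSpace →ₗ[ℂ] FermionSeries) :
    normalOrder w (normalOrder w B) = (0 : QuadraticForm ℂ FermionModes) w • B := by
  rw [zero_apply, zero_smul]
  refine LinearMap.ext fun b => ?_
  have happ : ∀ (C : FermionSpace →ₗ[ℂ] FermionSeries) (x : FermionSpace),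
      normalOrder w C x = creationPart w * C x + ∑ᶠ j : ℕ, annihilationTerm w C j x :=
    fun _ _ => rfl
  obtain ⟨M, hM⟩ := exists_bound w b
  have hfin : ∀ (C : FermionSpace →ₗ[ℂ] FermionSeries) (x : FermionSpace),
      (∀ j : ℕ, M ≤ j → fieldMode j w x = 0) →
      ∑ᶠ j : ℕ, annihilationTerm w C j x = ∑ j ∈ Finset.range M, annihilationTerm w C j x := by
    intro C x hx
    refine finsum_eq_sum_of_support_subset _ fun j hj => ?_
    by_contra hlt
    exact hj (annihilationTerm_eq_zero w C j x (hx j (by simpa using hlt)))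
  have hanti : ∀ (i j : ℕ) (x : FermionSpace),
      fieldMode i w (fieldMode j w x) = -fieldMode j w (fieldMode i w x) := by
    intro i j x
    obtain ⟨d, hd⟩ := exists_dual i w
    obtain ⟨d', hd'⟩ := exists_dual j w
    rw [hd, hd', contractLeft_comm]
  have hpar : ∀ (i : ℕ) (x : FermionSpace),
      parityInv (fieldMode i w (parityInv x)) = -fieldMode i w x := by
    intro i x
    obtain ⟨d, hd⟩ := exists_dual i w
    rw [hd, parityInv_contractLeft, parityInv_parityInv]
  have hbound : ∀ (j : ℕ) (i : ℕ), M ≤ i → fieldMode i w (parityInv (fieldMode j w b)) = 0 := by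
    intro j i hi
    rw [← parityInv_parityInv (fieldMode i w _), hpar, hanti, hM i hi, map_zero, neg_zero, neg_zero,
      map_zero]
  rw [happ, happ, hfin _ _ hM, hfin _ _ hM, LinearMap.zero_apply]
  have h1 : ∀ j, annihilationTerm w (normalOrder w B) j b =
      -(creationPart w * annihilationTerm w B j b) -
        ∑ i ∈ Finset.range M,
          monomial (-1 - j) * (monomial (-1 - i) * B (fieldMode i w (fieldMode j w b))) := by
    intro j
    rw [annihilationTerm, happ, hfin _ _ (hbound j), map_add, mul_add, parityInvSeries_mul,
      parityInvSeries_creationPart, neg_mul, mul_neg, ← mul_assoc, monomial_mul_comm, mul_assoc,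
      ← annihilationTerm, map_sum, Finset.mul_sum, sub_eq_add_neg (-(creationPart w * _)), ← Finset.sum_neg_distrib]
    congr 1
    refine Finset.sum_congr rfl fun i _ => ?_
    rw [annihilationTerm, parityInvSeries_mul, parityInvSeries_monomial,
      parityInvSeries_parityInvSeries, hpar, map_neg, mul_neg, mul_neg]
  simp_rw [h1]
  rw [Finset.sum_sub_distrib, Finset.sum_neg_distrib, ← Finset.mul_sum, mul_add, ← mul_assoc,
    creationPart_mul_self, zero_mul]
  have h2 : ∑ j ∈ Finset.range M, ∑ i ∈ Finset.range M,
      monomial (-1 - j) * (monomial (-1 - i) * B (fieldMode i w (fieldMode j w b))) = 0 := by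
    refine eq_zero_of_eq_neg ?_
    rw [← Finset.sum_neg_distrib]
    conv_lhs => rw [Finset.sum_comm]
    refine Finset.sum_congr rfl fun i _ => ?_
    rw [← Finset.sum_neg_distrib]
    refine Finset.sum_congr rfl fun j _ => ?_
    rw [hanti, map_neg, mul_neg, mul_neg, ← mul_assoc, ← mul_assoc, monomial_mul_monomial,
      monomial_mul_monomial, add_comm]
  rw [h2]
  abel

/-- The state-field correspondence: the field of `w₁ ∧ ⋯ ∧ w_r` is the normally ordered product
`:A₁(z) (:A₂(z) ⋯ A_r(z):):` of the fields of the `w_i`; the field of `1` is the identity. -/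
def field : FermionSpace →ₗ[ℂ] FermionSpace →ₗ[ℂ] FermionSeries :=
  CliffordAlgebra.foldr (0 : QuadraticForm ℂ FermionModes) normalOrder normalOrder_normalOrder
    (HahnSeries.single.linearMap 0)

/-- The vertex superalgebra of one pair of symplectic fermions. -/
def vertexOps : VertexOps FermionSpace where
  parity := evenOdd (0 : QuadraticForm ℂ FermionModes)
  vac := 1
  Y := toVertexOperator ∘ₗ field

/-- The state `ψ = ψ_(-1) 1`. -/
def psiState : FermionSpace := psi (-1) 1

/-- The state `ψ* = ψ*_(-1) 1`. -/
def psiStarState : FermionSpace := psiStar (-1) 1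

/-- The even part. -/
def evenSpace : Submodule ℂ FermionSpace := vertexOps.parity 0

end SymplecticFermions

end

open scoped TensorProduct

noncomputable section

/-! The lattice is `ℤ` with form `mn`, and its vertex superalgebra is the bosonized `bc`-system: the
modes of `b = e^(φ_(-γ))` and `c = e^(φ_γ)` satisfy `[b_i, c_j]_+ = δ_(i+j,-1)` (`anticomm_expo`),
all other anticommutators vanish, and `∂φ_γ = -b_(-1) c`. Since `(∂c)_n = -n c_(n-1)`, the fields `ψ
= b` and `ψ* = ∂c` satisfy `[ψ_i, ψ*_j]_+ = i δ_(i+j,0)`. Hence the creation modes of the symplectic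
fermions act on the lattice space, and applying them to the vacuum gives the map `realization`.

It is injective because the positive modes act on the exterior algebra as nonzero multiples of the
odd derivatives, and a nonzero subspace stable under all of these contains a nonzero scalar. Its
image is found by counting modes: passing from `c` to `∂c` loses only `c_(-1)`, whose partner is the
screening operator `S = b_0`. The subspace `im + c_(-1) im` is stable under `b`, `c` and hence
`∂φ_γ`, so it is the whole space. As `S` kills `im` and `S c_(-1)` is the identity on `im`, the
kernel of `S` is exactly `im` (`range_realization`). The products agree because on both sides the
field of `w ∧ u` is a normally ordered product (`intertwines`). An element lies over the long
lattice exactly if its charges are even, that is, if it has even parity, which gives the statement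
on even parts.

The larger task is the axioms of the lattice vertex superalgebra. Locality of two exponentials rests
on `e^(φ_m)(z) e^(φ_n)(w) 1 = (z-w)^(mn) e^(z∂)e^(φ_m) e^(w∂)e^(φ_n)`, proved by uniqueness for a
differential equation in `w`. Since the field of `∂^(1+k)φ_γ a` is a normally ordered product
(`mode_boson_mul`), Dong's lemma (`IsLocal.normalProd`) extends locality to all states. Goddard's
uniqueness theorem (`eq_mode`) then shows that the kernel of a zero mode is closed under products
and that `(-1)`-products are normally ordered products. The axioms for the symplectic fermions are
pulled back along the injective realization. -/

/-! ## Formal distributions in two variables -/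

namespace FormalModes

variable {M M' : Type*} [AddCommGroup M] [Module ℂ M] [AddCommGroup M'] [Module ℂ M']

/-- Multiplication by the first variable of a formal distribution `∑ f i j z^(-i-1) w^(-j-1)`. -/
def shiftL : Module.End ℂ (ℤ → ℤ → M) where
  toFun f i j := f (i + 1) j
  map_add' _ _ := rfl
  map_smul' _ _ := rfl

/-- Multiplication by the second variable. -/
def shiftR : Module.End ℂ (ℤ → ℤ → M) where
  toFun f i j := f i (j + 1)
  map_add' _ _ := rfl
  map_smul' _ _ := rfl

/-- Multiplication by the difference of the two variables. -/
def dif : Module.End ℂ (ℤ → ℤ → M) := shiftL - shiftR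

theorem dif_apply (f : ℤ → ℤ → M) (i j : ℤ) : dif f i j = f (i + 1) j - f i (j + 1) := rfl

theorem shiftL_pow_apply (f : ℤ → ℤ → M) (n : ℕ) (i j : ℤ) :
    (shiftL ^ n) f i j = f (i + n) j := by
  induction n generalizing i with
  | zero => simp
  | succ n ih =>
    rw [pow_succ', Module.End.mul_apply]
    change (shiftL ^ n) f (i + 1) j = _
    rw [ih]; congr 1; push_cast; ring

theorem shiftR_pow_apply (f : ℤ → ℤ → M) (n : ℕ) (i j : ℤ) :
    (shiftR ^ n) f i j = f i (j + n) := by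
  induction n generalizing j with
  | zero => simp
  | succ n ih =>
    rw [pow_succ', Module.End.mul_apply]
    change (shiftR ^ n) f i (j + 1) = _
    rw [ih]; congr 1; push_cast; ring

/-- The binomial theorem for the two commuting shifts. The right-hand side is the sum in the
locality axiom, so locality says that `dif ^ N` kills the supercommutator. -/
theorem dif_pow_apply (f : ℤ → ℤ → M) (N : ℕ) (m n : ℤ) :
    (dif ^ N) f m n = ∑ k ∈ Finset.range (N + 1),
      ((-1 : ℂ) ^ k * (N.choose k : ℂ)) • f (m + N - k) (n + k) := by
  have hc : Commute (-shiftR : Module.End ℂ (ℤ → ℤ → M)) shiftL :=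
    Commute.neg_left (show (shiftR : Module.End ℂ (ℤ → ℤ → M)) * shiftL = shiftL * shiftR from
      LinearMap.ext fun _ => rfl)
  have hd : (dif : Module.End ℂ (ℤ → ℤ → M)) = -shiftR + shiftL := by
    rw [dif, sub_eq_neg_add]
  rw [hd, hc.add_pow, LinearMap.sum_apply, Finset.sum_apply, Finset.sum_apply]
  refine Finset.sum_congr rfl fun k hk => ?_
  have hk : k ≤ N := Nat.lt_succ_iff.mp (Finset.mem_range.mp hk)
  have h1 : ((-shiftR) ^ k * shiftL ^ (N - k) * (N.choose k : Module.End ℂ (ℤ → ℤ → M)) :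
      Module.End ℂ (ℤ → ℤ → M)) f =
      ((-1 : ℂ) ^ k * (N.choose k : ℂ)) • (shiftR ^ k) ((shiftL ^ (N - k)) f) := by
    rw [neg_pow (shiftR : Module.End ℂ (ℤ → ℤ → M)), ← nsmul_one, mul_smul_comm, mul_one,
      LinearMap.smul_apply, Module.End.mul_apply, Module.End.mul_apply, mul_smul,
      Nat.cast_smul_eq_nsmul, smul_comm]
    congr 1
    rcases Nat.even_or_odd k with h | h <;> simp [h.neg_one_pow]
  rw [h1]
  rw [Pi.smul_apply, Pi.smul_apply]
  rw [shiftR_pow_apply, shiftL_pow_apply, Nat.cast_sub hk]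
  congr 2; ring

theorem dif_pow_map (L : M →ₗ[ℂ] M') (f : ℤ → ℤ → M) (N : ℕ) :
    (dif ^ N) (fun i j => L (f i j)) = fun i j => L ((dif ^ N) f i j) := by
  induction N with
  | zero => rfl
  | succ N ih =>
    rw [pow_succ', Module.End.mul_apply, ih, pow_succ', Module.End.mul_apply]
    funext i j
    rw [dif_apply, dif_apply, map_sub]

theorem dif_pow_swap (f : ℤ → ℤ → M) (N : ℕ) :
    (dif ^ N) (fun i j => f j i) = fun i j => (-1 : ℂ) ^ N • (dif ^ N) f j i := by
  induction N with
  | zero => funext i j; simp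
  | succ N ih =>
    rw [pow_succ', Module.End.mul_apply, ih]
    funext i j
    rw [Module.End.mul_apply, dif_apply, dif_apply, pow_succ, mul_smul, neg_one_smul, neg_sub, ← smul_sub]

theorem dif_pow_eq_zero_of_le {f : ℤ → ℤ → M} {N N' : ℕ} (hf : (dif ^ N) f = 0) (h : N ≤ N') :
    (dif ^ N') f = 0 := by
  obtain ⟨k, rfl⟩ := Nat.exists_eq_add_of_le' h
  rw [pow_add, Module.End.mul_apply, hf, map_zero]

/-- The derivative with respect to the first variable. -/
def derivL : Module.End ℂ (ℤ → ℤ → M) where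
  toFun f i j := -(i : ℂ) • f (i - 1) j
  map_add' f g := by funext i j; exact smul_add _ _ _
  map_smul' c f := by funext i j; exact smul_comm _ _ _

/-- The Weyl relation: `z - w` and `∂_z` commute up to the identity. -/
theorem dif_derivL (f : ℤ → ℤ → M) : dif (derivL f) = derivL (dif f) - f := by
  funext i j
  change -((i + 1 : ℤ) : ℂ) • f (i + 1 - 1) j - -(i : ℂ) • f (i - 1) (j + 1) =
    -(i : ℂ) • (f (i - 1 + 1) j - f (i - 1) (j + 1)) - f i j
  rw [add_sub_cancel_right, sub_add_cancel]
  push_cast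
  module

theorem dif_pow_derivL (f : ℤ → ℤ → M) (n : ℕ) :
    (dif ^ (n + 1)) (derivL f) = derivL ((dif ^ (n + 1)) f) - ((n : ℂ) + 1) • (dif ^ n) f := by
  induction n with
  | zero => simp [dif_derivL]
  | succ n ih =>
    rw [pow_succ', Module.End.mul_apply, ih, map_sub, map_smul, dif_derivL,
      ← Module.End.mul_apply dif, ← pow_succ', ← Module.End.mul_apply dif, ← pow_succ']
    push_cast
    module

/-- A distribution killed by `z - w` and bounded in the second index vanishes. -/
theorem eq_zero_of_dif_eq_zero {f : ℤ → ℤ → M} (hf : dif f = 0) {J : ℤ}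
    (hJ : ∀ i j, J ≤ j → f i j = 0) : f = 0 := by
  have h1 : ∀ i j, f (i + 1) j = f i (j + 1) := fun i j =>
    sub_eq_zero.mp (congr_fun (congr_fun hf i) j)
  -- Since `z f = w f`, the coefficients are constant along antidiagonals; sliding along one of them
  -- reaches the region `j ≥ J`.
  have h2 : ∀ (n : ℕ) (i j : ℤ), f i j = f (i - n) (j + n) := by
    intro n
    induction n with
    | zero => simp
    | succ n ih =>
      intro i j
      rw [ih, ← sub_add_cancel (i - n) 1, h1]
      push_cast; congr 1 <;> ring
  funext i j
  rw [h2 (J - j).toNat]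
  exact hJ _ _ (by have := Int.self_le_toNat (J - j); omega)

/-- Expanded binomially, each term contains `x ^ p` or `y ^ q`. The induction peels off one factor
`x + y` at a time: `x f` is killed by one power of `x` less, `y f` by one power of `y` less. -/
theorem add_pow_apply_eq_zero {x y : Module.End ℂ M} (hc : Commute x y) {p q : ℕ} {f : M}
    (hx : (x ^ p) f = 0) (hy : (y ^ q) f = 0) : ((x + y) ^ (p + q)) f = 0 := by
  obtain ⟨n, hn⟩ : ∃ n, n = p + q := ⟨_, rfl⟩
  induction n generalizing p q f with
  | zero =>
    obtain rfl : p = 0 := by omega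
    have hf : f = 0 := by simpa using hx
    rw [hf, map_zero]
  | succ n ih =>
    rcases p with _ | p
    · have hf : f = 0 := by simpa using hx
      rw [hf, map_zero]
    rcases q with _ | q
    · have hf : f = 0 := by simpa using hy
      rw [hf, map_zero]
    have e1 : ((x + y) ^ (p + (q + 1))) (x f) = 0 := by
      refine ih ?_ ?_ (by omega)
      · rwa [pow_succ] at hx
      · rw [← Module.End.mul_apply, ← (hc.pow_right _).eq, Module.End.mul_apply, hy, map_zero]
    have e2 : ((x + y) ^ (p + 1 + q)) (y f) = 0 := by
      refine ih ?_ ?_ (by omega)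
      · rw [← Module.End.mul_apply, (hc.pow_left _).eq, Module.End.mul_apply, hx, map_zero]
      · rwa [pow_succ] at hy
    have e3 : p + 1 + (q + 1) = p + (q + 1) + 1 := by ring
    rw [e3, pow_succ, Module.End.mul_apply, LinearMap.add_apply, map_add, e1, zero_add]
    rw [show p + (q + 1) = p + 1 + q by ring, e2]

/-! ## Fields and locality -/

variable {V : Type*} [AddCommGroup V] [Module ℂ V]

/-- The truncation property of the modes of a field. -/
def IsField (a : ℤ → Module.End ℂ V) : Prop := ∀ v, ∃ N : ℤ, ∀ n, N ≤ n → a n v = 0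

/-- Mutual locality of order `N`, with sign `ε`. -/
def LocalOrder (ε : ℂ) (N : ℕ) (a b : ℤ → Module.End ℂ V) : Prop :=
  (dif ^ N) (fun i j => a i * b j - ε • (b j * a i)) = 0

/-- Mutual locality, with sign `ε`. -/
def IsLocal (ε : ℂ) (a b : ℤ → Module.End ℂ V) : Prop := ∃ N, LocalOrder ε N a b

theorem LocalOrder.mono {ε : ℂ} {N N' : ℕ} {a b : ℤ → Module.End ℂ V} (h : LocalOrder ε N a b)
    (hN : N ≤ N') : LocalOrder ε N' a b :=
  dif_pow_eq_zero_of_le h hN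

theorem localOrder_iff {ε : ℂ} {N : ℕ} {a b : ℤ → Module.End ℂ V} :
    LocalOrder ε N a b ↔ ∀ v, (dif ^ N) (fun i j => a i (b j v) - ε • b j (a i v)) = 0 := by
  have h : ∀ v, (dif ^ N) (fun i j => a i (b j v) - ε • b j (a i v)) =
      fun i j => (dif ^ N) (fun i j => a i * b j - ε • (b j * a i)) i j v := fun v =>
    dif_pow_map (LinearMap.applyₗ v) (fun i j => a i * b j - ε • (b j * a i)) N
  constructor
  · intro H v
    rw [h, H]; rfl
  · intro H
    funext i j
    refine LinearMap.ext fun v => ?_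
    have := congr_fun (congr_fun (h v) i) j
    rw [H] at this
    exact this.symm

theorem localOrder_iff_sum {ε : ℂ} {N : ℕ} {a b : ℤ → Module.End ℂ V} :
    LocalOrder ε N a b ↔ ∀ (m n : ℤ) (c : V),
      ∑ k ∈ Finset.range (N + 1), ((-1 : ℂ) ^ k * (N.choose k : ℂ)) •
        (a (m + N - k) (b (n + k) c) - ε • b (n + k) (a (m + N - k) c)) = 0 := by
  rw [localOrder_iff]
  constructor
  · intro h m n c
    rw [← dif_pow_apply (fun i j => a i (b j c) - ε • b j (a i c)), h]; rfl
  · intro h c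
    funext m n
    rw [dif_pow_apply, h]; rfl

/-- Because `ε² = 1`, exchanging the fields multiplies the `ε`-commutator by `-ε`, and exchanging
the variables changes `(z - w)^N` only by a sign. -/
theorem IsLocal.symm {ε : ℂ} (hε : ε * ε = 1) {a b : ℤ → Module.End ℂ V} (h : IsLocal ε a b) :
    IsLocal ε b a := by
  obtain ⟨N, h⟩ := h
  refine ⟨N, ?_⟩
  have e : (fun i j => b i * a j - ε • (a j * b i)) =
      (-ε) • fun i j => (fun i j => a i * b j - ε • (b j * a i)) j i := by
    funext i j
    change _ = (-ε) • (a j * b i - ε • (b i * a j))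
    rw [smul_sub, smul_smul, neg_mul, hε]
    module
  rw [LocalOrder, e, map_smul, dif_pow_swap, h]
  funext i j
  simp

/-- Differentiation costs one order: `(z-w)^(N+1) ∂_z = ∂_z (z-w)^(N+1) - (N+1)(z-w)^N`, and both
terms kill the commutator. -/
theorem IsLocal.deriv {ε : ℂ} {a b a' : ℤ → Module.End ℂ V} (h : IsLocal ε a b)
    (ha' : ∀ n, a' n = -(n : ℂ) • a (n - 1)) : IsLocal ε a' b := by
  obtain ⟨N, h⟩ := h
  refine ⟨N + 1, ?_⟩
  have e : (fun i j => a' i * b j - ε • (b j * a' i)) =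
      derivL (fun i j => a i * b j - ε • (b j * a i)) := by
    funext i j
    change _ = -(i : ℂ) • (a (i - 1) * b j - ε • (b j * a (i - 1)))
    rw [ha', smul_mul_assoc, mul_smul_comm]
    module
  have h' := dif_pow_eq_zero_of_le h (Nat.le_succ N)
  rw [LocalOrder, e, dif_pow_derivL, h, h', map_zero, smul_zero, sub_zero]

theorem IsLocal.add {ε : ℂ} {a b c : ℤ → Module.End ℂ V} (h : IsLocal ε a c)
    (h' : IsLocal ε b c) : IsLocal ε (a + b) c := by
  obtain ⟨N, h⟩ := h
  obtain ⟨N', h'⟩ := h'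
  refine ⟨max N N', ?_⟩
  have e : (fun i j => (a + b) i * c j - ε • (c j * (a + b) i)) =
      (fun i j => a i * c j - ε • (c j * a i)) + fun i j => b i * c j - ε • (c j * b i) := by
    funext i j
    simp only [Pi.add_apply, add_mul, mul_add]
    module
  rw [LocalOrder, e, map_add, h.mono (le_max_left _ _), h'.mono (le_max_right _ _), add_zero]

theorem IsLocal.smul {ε : ℂ} {a c : ℤ → Module.End ℂ V} (h : IsLocal ε a c) (r : ℂ) :
    IsLocal ε (r • a) c := by
  obtain ⟨N, h⟩ := h
  refine ⟨N, ?_⟩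
  have e : (fun i j => (r • a) i * c j - ε • (c j * (r • a) i)) =
      r • fun i j => a i * c j - ε • (c j * a i) := by
    funext i j
    simp only [Pi.smul_apply, smul_mul_assoc, mul_smul_comm]
    module
  rw [LocalOrder, e, map_smul, h, smul_zero]

/-! ## Normally ordered products -/

theorem finite_support_half {a b : ℤ → Module.End ℂ V} (hb : IsField b) (i j : ℤ) (v : V) :
    (Function.support fun l : ℕ => a (i - 1 - l) (b (j + l) v)).Finite := by
  obtain ⟨N, hN⟩ := hb v
  refine (Finset.range (N - j).toNat).finite_toSet.subset fun l hl => ?_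
  by_contra hlt
  refine hl ?_
  have : (N - j).toNat ≤ l := by simpa using hlt
  change a (i - 1 - l) (b (j + l) v) = 0
  rw [hN _ (by omega), map_zero]

/-- The coefficients of `(z - w)⁻¹ a(z) b(w)`, expanded in nonnegative powers of `w`. -/
def half (a b : ℤ → Module.End ℂ V) (hb : IsField b) (i j : ℤ) : Module.End ℂ V where
  toFun v := ∑ᶠ l : ℕ, a (i - 1 - l) (b (j + l) v)
  map_add' v v' := by
    simp_rw [map_add]
    exact finsum_add_distrib (finite_support_half hb i j v) (finite_support_half hb i j v')
  map_smul' c v := by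
    simp_rw [map_smul]
    exact (smul_finsum _ _).symm

theorem half_eq_sum {a b : ℤ → Module.End ℂ V} (hb : IsField b) (i j : ℤ) (v : V) {N : ℤ}
    (hN : ∀ n, N ≤ n → b n v = 0) {K : ℕ} (hK : N - j ≤ K) :
    half a b hb i j v = ∑ l ∈ Finset.range K, a (i - 1 - l) (b (j + l) v) := by
  refine finsum_eq_sum_of_support_subset _ fun l hl => ?_
  by_contra hlt
  refine hl ?_
  have : K ≤ l := by simpa using hlt
  change a (i - 1 - l) (b (j + l) v) = 0
  rw [hN _ (by omega), map_zero]

theorem half_bounded {a b : ℤ → Module.End ℂ V} (hb : IsField b) (v : V) :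
    ∃ J : ℤ, ∀ i j, J ≤ j → half a b hb i j v = 0 := by
  obtain ⟨N, hN⟩ := hb v
  exact ⟨N, fun i j hj => by
    rw [half_eq_sum hb i j v hN (K := 0) (by simpa using hj), Finset.sum_range_zero]⟩

/-- Multiplication by `z - w` undoes the geometric series `∑ z^(-1-l) w^l`: the two sums telescope
and only the term `l = 0` survives. -/
theorem dif_half (a b : ℤ → Module.End ℂ V) (hb : IsField b) :
    dif (half a b hb) = fun i j => a i * b j := by
  funext i j
  refine LinearMap.ext fun v => ?_
  obtain ⟨N, hN⟩ := hb v
  rw [dif_apply, LinearMap.sub_apply,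
    half_eq_sum hb (i + 1) j v hN (K := (N - j).toNat + 1) (by push_cast; omega),
    half_eq_sum hb i (j + 1) v hN (K := (N - j).toNat) (by omega), Finset.sum_range_succ',
    add_comm, ← sub_sub_eq_add_sub, ← Finset.sum_sub_distrib, Finset.sum_eq_zero]
  · simp
  · intro l _
    rw [sub_eq_zero]; push_cast
    rw [show i + 1 - 1 - ((l : ℤ) + 1) = i - 1 - l by ring,
      show j + ((l : ℤ) + 1) = j + 1 + l by ring]

/-- The coefficients of `:z^i a(z) b(z):`, with sign `ε`. -/
def normalProd (ε : ℂ) (a b : ℤ → Module.End ℂ V) (ha : IsField a) (hb : IsField b) (i j : ℤ) :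
    Module.End ℂ V :=
  half a b hb i j + ε • half b a ha j i

/-- The two halves expand `(z - w)⁻¹` in the opposite regions `|z| > |w|` and `|w| > |z|`, so
multiplying by `z - w` returns the supercommutator. If `a` and `b` are local of order `N`, the
two-variable product is therefore killed by `(z - w)^(N+1)`. -/
theorem dif_normalProd (ε : ℂ) (a b : ℤ → Module.End ℂ V) (ha : IsField a) (hb : IsField b) :
    dif (normalProd ε a b ha hb) = fun i j => a i * b j - ε • (b j * a i) := by
  have e : normalProd ε a b ha hb =
      half a b hb + ε • fun i j => half b a ha j i := rfl
  have h := dif_pow_swap (half b a ha) 1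
  simp only [pow_one] at h
  rw [e, map_add, map_smul, h, dif_half, dif_half]
  funext i j
  simp [sub_eq_add_neg]

/-! ## Dong's lemma -/

/-- Multiplication by the difference of the second and third variables. -/
def difWU : Module.End ℂ (ℤ → ℤ → ℤ → M) where
  toFun f i := dif (f i)
  map_add' f g := by funext i; exact map_add dif (f i) (g i)
  map_smul' c f := by funext i; exact map_smul dif c (f i)

/-- Multiplication by the difference of the first and third variables. -/
def difZU : Module.End ℂ (ℤ → ℤ → ℤ → M) where
  toFun f i j k := dif (fun i k => f i j k) i k
  map_add' f g := by
    funext i j k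
    exact congr_fun (congr_fun (map_add dif (fun i k => f i j k) (fun i k => g i j k)) i) k
  map_smul' c f := by
    funext i j k
    exact congr_fun (congr_fun (map_smul dif c (fun i k => f i j k)) i) k

theorem difWU_pow_apply (f : ℤ → ℤ → ℤ → M) (n : ℕ) (i : ℤ) :
    (difWU ^ n) f i = (dif ^ n) (f i) := by
  induction n with
  | zero => rfl
  | succ n ih =>
    rw [pow_succ', Module.End.mul_apply, pow_succ', Module.End.mul_apply, ← ih]; rfl

theorem difZU_pow_apply (f : ℤ → ℤ → ℤ → M) (n : ℕ) (j : ℤ) :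
    (fun i k => (difZU ^ n) f i j k) = (dif ^ n) (fun i k => f i j k) := by
  induction n with
  | zero => rfl
  | succ n ih =>
    rw [pow_succ', Module.End.mul_apply, pow_succ' dif, Module.End.mul_apply, ← ih]; rfl

theorem difZU_apply (f : ℤ → ℤ → ℤ → M) (i j k : ℤ) :
    difZU f i j k = f (i + 1) j k - f i j (k + 1) := rfl

theorem difWU_apply (f : ℤ → ℤ → ℤ → M) (i j k : ℤ) :
    difWU f i j k = f i (j + 1) k - f i j (k + 1) := rfl

theorem difZW_apply (f : ℤ → ℤ → ℤ → M) (i j k : ℤ) :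
    dif f i j k = f (i + 1) j k - f i (j + 1) k := rfl

theorem commute_dif_difZU : Commute (dif : Module.End ℂ (ℤ → ℤ → ℤ → M)) difZU := by
  refine LinearMap.ext fun f => ?_
  funext i j k
  simp only [Module.End.mul_apply, difZU_apply, difZW_apply]
  abel

theorem commute_dif_difWU : Commute (dif : Module.End ℂ (ℤ → ℤ → ℤ → M)) difWU := by
  refine LinearMap.ext fun f => ?_
  funext i j k
  simp only [Module.End.mul_apply, difWU_apply, difZW_apply]
  abel

theorem commute_difZU_difWU : Commute (difZU : Module.End ℂ (ℤ → ℤ → ℤ → M)) difWU := by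
  refine LinearMap.ext fun f => ?_
  funext i j k
  simp only [Module.End.mul_apply, difWU_apply, difZU_apply]
  abel

theorem difWU_eq :
    (difWU : Module.End ℂ (ℤ → ℤ → ℤ → M)) = difZU + -(dif : Module.End ℂ (ℤ → ℤ → ℤ → M)) := by
  refine LinearMap.ext fun f => ?_
  funext i j k
  change f i (j + 1) k - f i j (k + 1) =
    f (i + 1) j k - f i j (k + 1) + -(f (i + 1) j k - f i (j + 1) k)
  abel

/-- Distributions in three variables that are, on each vector, bounded in the second index uniformly
in the first. -/
def boundedSubmodule (V : Type*) [AddCommGroup V] [Module ℂ V] :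
    Submodule ℂ (ℤ → ℤ → ℤ → Module.End ℂ V) where
  carrier := {f | ∀ v k, ∃ J : ℤ, ∀ i j, J ≤ j → f i j k v = 0}
  zero_mem' v k := ⟨0, fun _ _ _ => rfl⟩
  add_mem' {f g} hf hg v k := by
    obtain ⟨J, hJ⟩ := hf v k
    obtain ⟨J', hJ'⟩ := hg v k
    refine ⟨max J J', fun i j hj => ?_⟩
    change f i j k v + g i j k v = 0
    rw [hJ i j (le_trans (le_max_left _ _) hj), hJ' i j (le_trans (le_max_right _ _) hj), add_zero]
  smul_mem' c f hf v k := by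
    obtain ⟨J, hJ⟩ := hf v k
    refine ⟨J, fun i j hj => ?_⟩
    change c • f i j k v = 0
    rw [hJ i j hj, smul_zero]

theorem difZU_pow_mem_bounded {f : ℤ → ℤ → ℤ → Module.End ℂ V} (hf : f ∈ boundedSubmodule V)
    (n : ℕ) : (difZU ^ n) f ∈ boundedSubmodule V := by
  induction n with
  | zero => exact hf
  | succ n ih =>
    rw [pow_succ', Module.End.mul_apply]
    intro v k
    obtain ⟨J, hJ⟩ := ih v k
    obtain ⟨J', hJ'⟩ := ih v (k + 1)
    refine ⟨max J J', fun i j hj => ?_⟩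
    rw [difZU_apply, LinearMap.sub_apply, hJ _ j (le_trans (le_max_left _ _) hj),
      hJ' i j (le_trans (le_max_right _ _) hj), sub_zero]

theorem difWU_pow_mem_bounded {f : ℤ → ℤ → ℤ → Module.End ℂ V} (hf : f ∈ boundedSubmodule V)
    (n : ℕ) : (difWU ^ n) f ∈ boundedSubmodule V := by
  induction n with
  | zero => exact hf
  | succ n ih =>
    rw [pow_succ', Module.End.mul_apply]
    intro v k
    obtain ⟨J, hJ⟩ := ih v k
    obtain ⟨J', hJ'⟩ := ih v (k + 1)
    refine ⟨max J J', fun i j hj => ?_⟩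
    rw [difWU_apply, LinearMap.sub_apply,
      hJ i (j + 1) (by have := le_trans (le_max_left _ _) hj; omega),
      hJ' i j (le_trans (le_max_right _ _) hj), sub_zero]

theorem eq_zero_of_dif_eq_zero_of_mem_bounded {f : ℤ → ℤ → ℤ → Module.End ℂ V}
    (hf : f ∈ boundedSubmodule V) (h : dif f = 0) : f = 0 := by
  funext i j k
  refine LinearMap.ext fun v => ?_
  obtain ⟨J, hJ⟩ := hf v k
  have h0 : (fun i j => f i j k v) = 0 := by
    refine eq_zero_of_dif_eq_zero ?_ hJ
    funext i j
    have := congr_fun (congr_fun (congr_fun h i) j) k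
    rw [difZW_apply] at this
    exact LinearMap.congr_fun this v
  exact congr_fun (congr_fun h0 i) j

/-- Leibniz: `[ab, c] = a [b, c] + [a, c] b` up to signs. The factor `(w-u)^N'` kills the first
summand and `(z-u)^N` the second. -/
theorem difZU_difWU_commutator {a b c : ℤ → Module.End ℂ V} {εac εbc : ℂ} {N N' : ℕ}
    (hac : LocalOrder εac N a c) (hbc : LocalOrder εbc N' b c) :
    (difZU ^ N) ((difWU ^ N') fun i j k =>
      a i * b j * c k - (εac * εbc) • (c k * (a i * b j))) = 0 := by
  have e : (fun i j k => a i * b j * c k - (εac * εbc) • (c k * (a i * b j))) =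
      (fun i j k => a i * (b j * c k - εbc • (c k * b j))) +
        fun i j k => (εbc • (a i * c k - εac • (c k * a i))) * b j := by
    funext i j k
    simp only [Pi.add_apply, mul_sub, sub_mul, smul_sub, mul_smul_comm, smul_mul_assoc, smul_smul,
      mul_assoc]
    rw [mul_comm εac]
    abel
  rw [e, map_add, map_add]
  have h1 : (difWU ^ N') (fun i j k => a i * (b j * c k - εbc • (c k * b j))) = 0 := by
    funext i
    rw [difWU_pow_apply]
    refine (dif_pow_map (LinearMap.mulLeft ℂ (a i)) (fun j k => b j * c k - εbc • (c k * b j))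
      N').trans ?_
    rw [hbc]
    funext j k
    exact map_zero _
  have h2 : (difZU ^ N) (fun i j k => (εbc • (a i * c k - εac • (c k * a i))) * b j) = 0 := by
    funext i j k
    refine (congr_fun (congr_fun (difZU_pow_apply
      (fun i j k => (εbc • (a i * c k - εac • (c k * a i))) * b j) N j) i) k).trans ?_
    refine (congr_fun (congr_fun (dif_pow_map ((LinearMap.mulRight ℂ (b j)) ∘ₗ (εbc • LinearMap.id))
      (fun i k => a i * c k - εac • (c k * a i)) N) i) k).trans ?_
    rw [hac]
    exact map_zero _
  rw [h1, map_zero, zero_add, ← Module.End.mul_apply,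
    ((commute_difZU_difWU.pow_left N).pow_right N').eq, Module.End.mul_apply, h2, map_zero]

/-- After multiplication by `z - w` this is the statement for the plain product `ab`. The factor can
be cancelled because `half` is bounded in the index of `w`, and multiplication by `z - w` is
injective on such distributions. -/
theorem difZU_difWU_half {a b c : ℤ → Module.End ℂ V} (hb : IsField b) {εac εbc : ℂ} {N N' : ℕ}
    (hac : LocalOrder εac N a c) (hbc : LocalOrder εbc N' b c) :
    (difZU ^ N) ((difWU ^ N') fun i j k =>
      half a b hb i j * c k - (εac * εbc) • (c k * half a b hb i j)) = 0 := by
  have hmem : (fun i j k => half a b hb i j * c k - (εac * εbc) • (c k * half a b hb i j)) ∈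
      boundedSubmodule V := by
    intro v k
    obtain ⟨J, hJ⟩ := half_bounded (a := a) hb (c k v)
    obtain ⟨J', hJ'⟩ := half_bounded (a := a) hb v
    refine ⟨max J J', fun i j hj => ?_⟩
    change half a b hb i j (c k v) - (εac * εbc) • c k (half a b hb i j v) = 0
    rw [hJ i j (le_trans (le_max_left _ _) hj), hJ' i j (le_trans (le_max_right _ _) hj), map_zero,
      smul_zero, sub_zero]
  refine eq_zero_of_dif_eq_zero_of_mem_bounded
    (difZU_pow_mem_bounded (difWU_pow_mem_bounded hmem _) _) ?_
  rw [← Module.End.mul_apply, ← Module.End.mul_apply,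
    mul_assoc,
    ((commute_dif_difZU.pow_right N).mul_right (commute_dif_difWU.pow_right N')).eq,
    Module.End.mul_apply, Module.End.mul_apply]
  have e : dif (fun i j k =>
      half a b hb i j * c k - (εac * εbc) • (c k * half a b hb i j)) =
      fun i j k => a i * b j * c k - (εac * εbc) • (c k * (a i * b j)) := by
    funext i j k
    have h := congr_fun (congr_fun (dif_half a b hb) i) j
    rw [dif_apply] at h
    rw [difZW_apply, ← h, sub_mul, mul_sub, smul_sub]
    abel
  rw [e]
  exact difZU_difWU_commutator hac hbc

/-- Dong's lemma for normally ordered products. -/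
theorem IsLocal.normalProd {ε εac εbc : ℂ} {a b c : ℤ → Module.End ℂ V} (ha : IsField a)
    (hb : IsField b) (hab : IsLocal ε a b) (hac : IsLocal εac a c) (hbc : IsLocal εbc b c)
    (i : ℤ) : IsLocal (εac * εbc) (normalProd ε a b ha hb i) c := by
  obtain ⟨N, hN⟩ := hab
  obtain ⟨P, hP⟩ := hac
  obtain ⟨Q, hQ⟩ := hbc
  set X : ℤ → ℤ → ℤ → Module.End ℂ V := fun i j k =>
    FormalModes.normalProd ε a b ha hb i j * c k -
      (εac * εbc) • (c k * FormalModes.normalProd ε a b ha hb i j)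
    with hX
  -- One factor `z - w` turns the product into the commutator of `a` and `b`; the other `N` kill
  -- that commutator.
  have h1 : (dif ^ (N + 1)) X = 0 := by
    have e : ∀ k, (fun i j => X i j k) = fun i j =>
        (LinearMap.mulRight ℂ (c k) - (εac * εbc) • LinearMap.mulLeft ℂ (c k))
          (FormalModes.normalProd ε a b ha hb i j) := fun k => rfl
    funext i j k
    refine (congr_fun (congr_fun (dif_pow_map (LinearMap.proj (R := ℂ) (φ := fun _ : ℤ =>
      Module.End ℂ V) k) X (N + 1)) i) j).symm.trans ?_
    change (dif ^ (N + 1)) (fun i j => X i j k) i j = 0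
    rw [e, dif_pow_map, pow_succ, Module.End.mul_apply, dif_normalProd, hN]
    exact map_zero _
  have h2 : (difZU ^ P) ((difWU ^ Q) X) = 0 := by
    have e : X = (fun i j k => half a b hb i j * c k - (εac * εbc) • (c k * half a b hb i j)) +
        ε • fun i j k => half b a ha j i * c k - (εac * εbc) • (c k * half b a ha j i) := by
      funext i j k
      simp only [hX, FormalModes.normalProd, Pi.add_apply, Pi.smul_apply, add_mul, mul_add,
        smul_mul_assoc, mul_smul_comm, smul_add]
      module
    rw [e, map_add, map_add, difZU_difWU_half hb hP hQ, zero_add, map_smul, map_smul]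
    have h3 := difZU_difWU_half ha hQ hP
    -- The second half has the roles of `z` and `w` exchanged, so `z - u` and `w - u` are exchanged
    -- as well.
    have h4 : ∀ (Y : ℤ → ℤ → ℤ → Module.End ℂ V),
        (difZU ^ P) ((difWU ^ Q) fun i j k => Y j i k) =
          fun i j k => (difWU ^ P) ((difZU ^ Q) Y) j i k := by
      intro Y
      have hz : ∀ (n : ℕ) (Y : ℤ → ℤ → ℤ → Module.End ℂ V),
          (difZU ^ n) (fun i j k => Y j i k) = fun i j k => (difWU ^ n) Y j i k := by
        intro n Y
        funext i j k
        refine (congr_fun (congr_fun (difZU_pow_apply (fun i j k => Y j i k) n j) i) k).trans ?_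
        rw [difWU_pow_apply]
      have hw : ∀ (n : ℕ) (Y : ℤ → ℤ → ℤ → Module.End ℂ V),
          (difWU ^ n) (fun i j k => Y j i k) = fun i j k => (difZU ^ n) Y j i k := by
        intro n Y
        funext i j k
        rw [difWU_pow_apply]
        exact (congr_fun (congr_fun (difZU_pow_apply Y n i) j) k).symm
      rw [hw, hz]
    rw [h4 (fun j i k => half b a ha j i * c k - (εac * εbc) • (c k * half b a ha j i)),
      ← Module.End.mul_apply, ← ((commute_difZU_difWU.pow_left Q).pow_right P).eq,
      Module.End.mul_apply, mul_comm εac, h3]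
    exact smul_zero _
  -- Since `w - u = (z - u) - (z - w)`, each term of `(w-u)^(P+N+1)` contains `(z-u)^P` or
  -- `(z-w)^(N+1)`. The variable `z` then no longer occurs in the killing factor, so its
  -- coefficients can be taken one at a time.
  have h3 : (difWU ^ (P + (N + 1) + Q)) X = 0 := by
    rw [pow_add, Module.End.mul_apply]
    nth_rewrite 1 [difWU_eq]
    have hc : Commute (difZU : Module.End ℂ (ℤ → ℤ → ℤ → Module.End ℂ V)) (-dif) :=
      Commute.neg_right (Commute.symm (commute_dif_difZU (M := Module.End ℂ V)))
    refine add_pow_apply_eq_zero hc h2 ?_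
    rw [neg_pow (dif : Module.End ℂ (ℤ → ℤ → ℤ → Module.End ℂ V)), Module.End.mul_apply,
      ← Module.End.mul_apply (dif ^ (N + 1)),
      ((commute_dif_difWU.pow_left (N + 1)).pow_right Q).eq, Module.End.mul_apply, h1, map_zero,
      map_zero]
  refine ⟨P + (N + 1) + Q, ?_⟩
  have h4 := congr_fun h3 i
  rw [difWU_pow_apply] at h4
  exact h4

/-- A field that is local with a field creating `v` and kills the vacuum kills `v`. -/
theorem apply_eq_zero_of_isLocal {ε : ℂ} {d c : ℤ → Module.End ℂ V} {vac v : V}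
    (h : IsLocal ε d c) (hd : ∀ n, d n vac = 0) (hc : ∀ n, 0 ≤ n → c n vac = 0)
    (hv : c (-1) vac = v) (m : ℤ) : d m v = 0 := by
  obtain ⟨N, hN⟩ := h
  -- With the second index starting at `-1`, all terms with `k ≥ 1` contain a nonnegative mode of
  -- `c` on the vacuum; only `d m (c (-1) vac)` is left.
  have h1 := localOrder_iff_sum.mp hN (m - N) (-1) vac
  rw [Finset.sum_range_succ', Finset.sum_eq_zero] at h1
  · simpa [hd, hv] using h1
  · intro k _
    rw [hd, map_zero, smul_zero, hc _ (by push_cast; omega), map_zero, sub_zero, smul_zero]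

end FormalModes

/-! ### Covariance and creation of states by fields. -/

namespace FormalModes

variable {V : Type*} [AddCommGroup V] [Module ℂ V]

theorem IsLocal.sub {ε : ℂ} {a b c : ℤ → Module.End ℂ V} (h : IsLocal ε a c)
    (h' : IsLocal ε b c) : IsLocal ε (a - b) c := by
  have := h.add (h'.smul (-1))
  rwa [neg_one_smul, ← sub_eq_add_neg] at this

theorem IsLocal.shift {ε : ℂ} {a c : ℤ → Module.End ℂ V} (h : IsLocal ε a c) :
    IsLocal ε (fun n => a (n + 1)) c := by
  obtain ⟨N, h⟩ := h
  refine ⟨N, ?_⟩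
  have hc : Commute (dif : Module.End ℂ (ℤ → ℤ → Module.End ℂ V)) shiftL := by
    refine LinearMap.ext fun f => rfl
  have e : (fun i j => a (i + 1) * c j - ε • (c j * a (i + 1))) =
      shiftL fun i j => a i * c j - ε • (c j * a i) := rfl
  rw [LocalOrder, e, ← Module.End.mul_apply, (hc.pow_left N).eq, Module.End.mul_apply, h, map_zero]

/-- Covariance of the modes `a` with respect to the operator `D`. -/
def IsCovariant (D : Module.End ℂ V) (a : ℤ → Module.End ℂ V) : Prop :=
  ∀ n, D * a n - a n * D = -(n : ℂ) • a (n - 1)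

/-- The commutator with `D` acts on `a(z) b(w)` as `∂_z + ∂_w`, which commutes with `z - w`. Hence
the defect `Y` of the claimed identity satisfies `(z - w) Y = 0`; it is bounded in the second index,
so it vanishes. -/
theorem half_covariant {D : Module.End ℂ V} {a b : ℤ → Module.End ℂ V} (hb : IsField b)
    (hDa : IsCovariant D a) (hDb : IsCovariant D b) (i j : ℤ) :
    D * half a b hb i j - half a b hb i j * D =
      -(i : ℂ) • half a b hb (i - 1) j - (j : ℂ) • half a b hb i (j - 1) := by
  set Y : ℤ → ℤ → Module.End ℂ V := fun i j =>
    D * half a b hb i j - half a b hb i j * D + (i : ℂ) • half a b hb (i - 1) j +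
      (j : ℂ) • half a b hb i (j - 1) with hY
  suffices h : Y = 0 by
    have h0 : Y i j = 0 := congr_fun (congr_fun h i) j
    rw [← sub_eq_zero, ← h0, hY]
    module
  have hd : ∀ i j, half a b hb (i + 1) j = half a b hb i (j + 1) + a i * b j := fun i j => by
    have := congr_fun (congr_fun (dif_half a b hb) i) j
    rw [dif_apply] at this
    rw [← this]; abel
  have hdY : dif Y = 0 := by
    funext i j
    rw [dif_apply]
    simp only [hY, hd]
    have e1 : half a b hb i j = half a b hb (i - 1) (j + 1) + a (i - 1) * b j := by
      rw [← hd, sub_add_cancel]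
    have e3 : D * (a i * b j) - (a i * b j) * D =
        -(i : ℂ) • (a (i - 1) * b j) - (j : ℂ) • (a i * b (j - 1)) := by
      have h1 := congr_arg (· * b j) (hDa i)
      have h2 := congr_arg (a i * ·) (hDb j)
      simp only [sub_mul, mul_sub, smul_mul_assoc, mul_smul_comm] at h1 h2
      rw [← mul_assoc, sub_eq_add_neg (-(i : ℂ) • _), ← neg_smul, ← h1, ← h2, mul_assoc, mul_assoc,
        mul_assoc]
      abel
    have e4 : D * (a i * b j) =
        -(i : ℂ) • (a (i - 1) * b j) - (j : ℂ) • (a i * b (j - 1)) + (a i * b j) * D := by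
      rw [← e3]; abel
    simp only [add_sub_cancel_right, mul_add, add_mul, sub_add_cancel, e4, e1]
    push_cast
    rw [Pi.zero_apply, Pi.zero_apply]
    module
  have hbd : ∀ v, ∃ J : ℤ, ∀ i j, J ≤ j → Y i j v = 0 := by
    intro v
    obtain ⟨J, hJ⟩ := half_bounded (a := a) hb v
    obtain ⟨J', hJ'⟩ := half_bounded (a := a) hb (D v)
    refine ⟨max J J' + 1, fun i j hj => ?_⟩
    have h1 := le_max_left J J'
    have h2 := le_max_right J J'
    simp only [hY, LinearMap.add_apply, LinearMap.sub_apply, LinearMap.smul_apply,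
      Module.End.mul_apply]
    rw [hJ i j (by omega), hJ' i j (by omega), hJ (i - 1) j (by omega), hJ i (j - 1) (by omega)]
    simp
  funext i j
  refine LinearMap.ext fun v => ?_
  obtain ⟨J, hJ⟩ := hbd v
  refine congr_fun (congr_fun (eq_zero_of_dif_eq_zero (f := fun i j => Y i j v) ?_ hJ) i) j
  funext i j
  exact LinearMap.congr_fun (congr_fun (congr_fun hdY i) j) v

/-- At first index `0` the terms of `half_covariant` that come from the auxiliary variable carry the
factor `0`. -/
theorem normalProd_covariant {ε : ℂ} {D : Module.End ℂ V} {a b : ℤ → Module.End ℂ V}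
    (ha : IsField a) (hb : IsField b) (hDa : IsCovariant D a) (hDb : IsCovariant D b) :
    IsCovariant D (normalProd ε a b ha hb 0) := by
  intro n
  have h1 := half_covariant hb hDa hDb 0 n
  have h2 := half_covariant ha hDb hDa n 0
  simp only [Int.cast_zero, neg_zero, zero_smul, zero_sub, sub_zero] at h1 h2
  simp only [normalProd, mul_add, add_mul, mul_smul_comm, smul_mul_assoc, smul_add]
  rw [add_sub_add_comm, h1, ← smul_sub, h2]
  module

theorem normalProd_vac {ε : ℂ} {a b : ℤ → Module.End ℂ V} (ha : IsField a) (hb : IsField b)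
    {vac : V} (hav : ∀ n, 0 ≤ n → a n vac = 0) (hbv : ∀ n, 0 ≤ n → b n vac = 0) :
    (∀ n, 0 ≤ n → normalProd ε a b ha hb 0 n vac = 0) ∧
      normalProd ε a b ha hb 0 (-1) vac = a (-1) (b (-1) vac) := by
  have h2 : ∀ n, half b a ha n 0 vac = 0 := fun n => by
    rw [half_eq_sum ha n 0 vac hav (K := 0) (by simp), Finset.sum_range_zero]
  constructor
  · intro n hn
    rw [normalProd, LinearMap.add_apply, LinearMap.smul_apply, h2,
      half_eq_sum hb 0 n vac hbv (K := 0) (by simpa using hn), Finset.sum_range_zero, smul_zero,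
      add_zero]
  · rw [normalProd, LinearMap.add_apply, LinearMap.smul_apply, h2,
      half_eq_sum hb 0 (-1) vac hbv (K := 1) (by simp), Finset.sum_range_one, smul_zero, add_zero]
    simp

/-- Covariant creative fields are determined on the vacuum by the state they create. -/
theorem apply_vac_eq {D : Module.End ℂ V} {a b : ℤ → Module.End ℂ V} (hDa : IsCovariant D a)
    (hDb : IsCovariant D b) {vac : V} (hD : D vac = 0) (hav : ∀ n, 0 ≤ n → a n vac = 0)
    (hbv : ∀ n, 0 ≤ n → b n vac = 0) (h : a (-1) vac = b (-1) vac) (n : ℤ) :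
    a n vac = b n vac := by
  rcases le_or_gt 0 n with hn | hn
  · rw [hav n hn, hbv n hn]
  obtain ⟨s, rfl⟩ : ∃ s : ℕ, n = -(s + 1) := ⟨(-n - 1).toNat, by omega⟩
  clear hn
  induction s with
  | zero => simpa using h
  | succ s ih =>
    -- As `D` kills the vacuum, covariance is a recursion that produces each negative mode on the
    -- vacuum from the one before it.
    have e : ∀ {a : ℤ → Module.End ℂ V}, IsCovariant D a →
        D (a (-((s : ℤ) + 1)) vac) = ((s : ℂ) + 1) • a (-(((s + 1 : ℕ) : ℤ) + 1)) vac := by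
      intro a hDa
      have := LinearMap.congr_fun (hDa (-((s : ℤ) + 1))) vac
      rw [LinearMap.sub_apply, Module.End.mul_apply, Module.End.mul_apply, hD, map_zero, sub_zero,
        LinearMap.smul_apply] at this
      rw [this]
      push_cast
      rw [neg_neg, neg_add' ((s : ℤ) + 1) 1]
    have h0 : ((s : ℂ) + 1) ≠ 0 := Nat.cast_add_one_ne_zero s
    have h1 := e hDa
    rw [ih, e hDb] at h1
    exact (smul_right_injective V h0 h1).symm

end FormalModes

/-! ## Consequences of the axioms of a vertex superalgebra -/

namespace VertexOps

open FormalModes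

variable {V : Type*} [AddCommGroup V] [Module ℂ V] {A : VertexOps V}

theorem isField_mode (A : VertexOps V) (a : V) : IsField (A.mode a) := fun v =>
  ⟨-(HahnSeries.order ((HahnModule.of ℂ).symm (A.Y a v))), fun n hn =>
    VertexOperator.ncoeff_eq_zero_of_lt_order _ n v (by omega)⟩

theorem mode_add (A : VertexOps V) (a b : V) : A.mode (a + b) = A.mode a + A.mode b := by
  funext n
  simp [mode]

theorem mode_smul (A : VertexOps V) (r : ℂ) (a : V) : A.mode (r • a) = r • A.mode a := by
  funext n
  simp [mode]

theorem mode_zero (A : VertexOps V) : A.mode 0 = 0 := by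
  funext n
  simp [mode]

/-- The translation operator as a linear map. -/
def translationHom (A : VertexOps V) : Module.End ℂ V where
  toFun := A.translation
  map_add' a b := by rw [translation, mode_add]; rfl
  map_smul' c a := by rw [translation, mode_smul]; rfl

/-- The sign of the exchange of two elements of given parities. -/
def sgn (i j : ZMod 2) : ℂ := (-1) ^ (i.val * j.val)

theorem sgn_mul_self (i j : ZMod 2) : sgn i j * sgn i j = 1 := by
  rw [sgn, ← pow_add, Even.neg_one_pow ⟨_, rfl⟩]

theorem sgn_add_left (i j k : ZMod 2) : sgn (i + j) k = sgn i k * sgn j k := by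
  have h : ∀ i : ZMod 2, i = 0 ∨ i = 1 := by decide
  have h2 : (1 + 1 : ZMod 2) = 0 := by decide
  rcases h i with rfl | rfl <;> rcases h j with rfl | rfl <;> rcases h k with rfl | rfl <;>
    simp [sgn, h2, ZMod.val_one]

theorem sgn_comm (i j : ZMod 2) : sgn i j = sgn j i := by
  rw [sgn, sgn, mul_comm]

namespace IsVertexSuperalgebra

theorem exists_decomp (hA : A.IsVertexSuperalgebra) (v : V) :
    ∃ v₀ ∈ A.parity 0, ∃ v₁ ∈ A.parity 1, v₀ + v₁ = v :=
  Submodule.mem_sup.mp (hA.parity_isCompl.sup_eq_top ▸ Submodule.mem_top)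

/-- Linear statements need only be checked on homogeneous elements. -/
theorem induction_parity (hA : A.IsVertexSuperalgebra) {P : V → Prop}
    (hadd : ∀ v w, P v → P w → P (v + w)) (h : ∀ i, ∀ v ∈ A.parity i, P v) (v : V) : P v := by
  obtain ⟨v₀, h₀, v₁, h₁, rfl⟩ := hA.exists_decomp v
  exact hadd _ _ (h 0 _ h₀) (h 1 _ h₁)

theorem isLocal (hA : A.IsVertexSuperalgebra) {i j : ZMod 2} {a b : V} (ha : a ∈ A.parity i)
    (hb : b ∈ A.parity j) : IsLocal (sgn i j) (A.mode a) (A.mode b) := by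
  obtain ⟨N, hN⟩ := hA.locality i j a b ha hb
  exact ⟨N, localOrder_iff_sum.mpr hN⟩

theorem isCovariant (hA : A.IsVertexSuperalgebra) (a : V) :
    IsCovariant A.translationHom (A.mode a) := fun n =>
  LinearMap.ext fun b => hA.translation_covariance a b n

theorem translation_vac (hA : A.IsVertexSuperalgebra) : A.translationHom A.vac = 0 := by
  change A.mode A.vac (-2) A.vac = 0
  rw [hA.vacuum, if_neg (by decide)]

/-- Goddard's uniqueness theorem: a field that is local with all fields is determined by its action on
the vacuum. -/
theorem eq_mode (hA : A.IsVertexSuperalgebra) {i : ZMod 2} {x : V} (hx : x ∈ A.parity i)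
    {d : ℤ → Module.End ℂ V}
    (hd : ∀ j, ∀ c ∈ A.parity j, IsLocal (sgn i j) d (A.mode c))
    (hvac : ∀ n, d n A.vac = A.mode x n A.vac) : d = A.mode x := by
  funext n
  refine LinearMap.ext fun v => ?_
  induction v using hA.induction_parity with
  | hadd v w hv hw => rw [map_add, map_add, hv, hw]
  | h j v hv =>
    rw [← sub_eq_zero, ← LinearMap.sub_apply]
    refine apply_eq_zero_of_isLocal (d := d - A.mode x) ((hd j v hv).sub (hA.isLocal hx hv))
      (fun n => ?_) (fun n hn => hA.regular v n hn) (hA.creation v) n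
    rw [Pi.sub_apply, LinearMap.sub_apply, hvac, sub_self]

/-- Covariance reduces the hypothesis of `eq_mode` on all vacuum values to the single state that is
created. This is how fields are identified in what follows. -/
theorem eq_mode_of_isCovariant (hA : A.IsVertexSuperalgebra) {i : ZMod 2} {x : V}
    (hx : x ∈ A.parity i) {d : ℤ → Module.End ℂ V}
    (hd : ∀ j, ∀ c ∈ A.parity j, IsLocal (sgn i j) d (A.mode c))
    (hcov : IsCovariant A.translationHom d) (hreg : ∀ n, 0 ≤ n → d n A.vac = 0)
    (hcr : d (-1) A.vac = x) : d = A.mode x :=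
  hA.eq_mode hx hd (apply_vac_eq hcov (hA.isCovariant x) hA.translation_vac hreg (hA.regular x)
    (by rw [hcr, hA.creation]))

theorem translation_mem (hA : A.IsVertexSuperalgebra) {i : ZMod 2} {a : V} (ha : a ∈ A.parity i) :
    A.translation a ∈ A.parity i := by
  have := hA.mode_parity i 0 a A.vac (-2) ha hA.vac_even
  rwa [add_zero] at this

/-- The modes on the right are those of the derivative of the field of `a`. They are local and
covariant and create `a_(-2) 1`, so Goddard's theorem applies. -/
theorem mode_translation (hA : A.IsVertexSuperalgebra) (a : V) (n : ℤ) :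
    A.mode (A.translation a) n = -(n : ℂ) • A.mode a (n - 1) := by
  induction a using hA.induction_parity with
  | hadd v w hv hw =>
    have e : A.translation (v + w) = A.translation v + A.translation w :=
      map_add A.translationHom v w
    rw [e, mode_add, mode_add, Pi.add_apply, Pi.add_apply, hv, hw, smul_add]
  | h i a ha =>
    have h := hA.eq_mode (d := fun n => -(n : ℂ) • A.mode a (n - 1)) (hA.translation_mem ha)
      (fun j c hc => (hA.isLocal ha hc).deriv fun _ => rfl) (fun n => ?_)
    · exact (congr_fun h n).symm
    · refine apply_vac_eq (D := A.translationHom) (a := fun n => -(n : ℂ) • A.mode a (n - 1))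
        (b := A.mode (A.translation a)) (fun n => ?_) (hA.isCovariant _)
        hA.translation_vac (fun n hn => ?_) (hA.regular _) ?_ n
      · have := hA.isCovariant a (n - 1)
        rw [mul_smul_comm, smul_mul_assoc, ← smul_sub, this]
      · rcases hn.eq_or_lt with rfl | hn
        · simp
        · change -(n : ℂ) • A.mode a (n - 1) A.vac = 0
          rw [hA.regular a (n - 1) (by omega), smul_zero]
      · rw [hA.creation]
        change -((-1 : ℤ) : ℂ) • A.mode a (-2) A.vac = A.mode a (-2) A.vac
        simp

/-- The `(-1)`-product is the normally ordered product. -/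
theorem mode_normalProd (hA : A.IsVertexSuperalgebra) {i j : ZMod 2} {a b : V}
    (ha : a ∈ A.parity i) (hb : b ∈ A.parity j) :
    A.mode (A.mode a (-1) b) =
      normalProd (sgn i j) (A.mode a) (A.mode b) (A.isField_mode a) (A.isField_mode b) 0 := by
  have hv := normalProd_vac (ε := sgn i j) (A.isField_mode a) (A.isField_mode b) (hA.regular a)
    (hA.regular b)
  refine (hA.eq_mode_of_isCovariant (hA.mode_parity i j a b (-1) ha hb) (fun k c hc => ?_)
    (normalProd_covariant _ _ (hA.isCovariant a) (hA.isCovariant b)) hv.1 ?_).symm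
  · rw [sgn_add_left]
    exact IsLocal.normalProd _ _ (hA.isLocal ha hb) (hA.isLocal ha hc) (hA.isLocal hb hc) 0
  · rw [hv.2, hA.creation]

/-- The zero mode is a superderivation of all products. -/
theorem mode_mode_zero (hA : A.IsVertexSuperalgebra) {i j : ZMod 2} {a b : V}
    (ha : a ∈ A.parity i) (hb : b ∈ A.parity j) (n : ℤ) :
    A.mode (A.mode a 0 b) n = A.mode a 0 * A.mode b n - sgn i j • (A.mode b n * A.mode a 0) := by
  have h := hA.eq_mode_of_isCovariant
    (d := fun n => A.mode a 0 * A.mode b n - sgn i j • (A.mode b n * A.mode a 0))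
    (hA.mode_parity i j a b 0 ha hb) (fun k c hc => ?_) (fun n => ?_) (fun n hn => ?_) ?_
  · exact (congr_fun h n).symm
  -- The commutator with `a_0` is the coefficient at first index `0` of `(z - w)` times the
  -- two-variable product, hence a difference of two fields to which Dong's lemma applies.
  · have e : (fun n => A.mode a 0 * A.mode b n - sgn i j • (A.mode b n * A.mode a 0)) =
        normalProd (sgn i j) (A.mode a) (A.mode b) (A.isField_mode a) (A.isField_mode b) 1 -
        fun n => normalProd (sgn i j) (A.mode a) (A.mode b) (A.isField_mode a) (A.isField_mode b) 0
          (n + 1) := by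
      exact (congr_fun (dif_normalProd (sgn i j) (A.mode a) (A.mode b) (A.isField_mode a)
        (A.isField_mode b)) 0).symm
    have hl := IsLocal.normalProd (A.isField_mode a) (A.isField_mode b) (hA.isLocal ha hb)
      (hA.isLocal ha hc) (hA.isLocal hb hc)
    rw [e, sgn_add_left]
    exact (hl 1).sub (hl 0).shift
  -- The factor `n` in covariance is `0` here: the zero mode commutes with translation.
  · have h1 := hA.isCovariant a 0
    rw [Int.cast_zero, neg_zero, zero_smul, sub_eq_zero] at h1
    have h2 : A.translationHom * A.mode b n = A.mode b n * A.translationHom -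
        (n : ℂ) • A.mode b (n - 1) := by
      rw [eq_sub_iff_add_eq, ← sub_eq_zero, add_sub_right_comm, hA.isCovariant b n]
      module
    simp only [mul_sub, sub_mul, mul_smul_comm, smul_mul_assoc]
    rw [← mul_assoc, h1, mul_assoc, h2, ← mul_assoc _ (A.mode b n), h2, mul_assoc _ (A.mode a 0),
      ← h1, mul_sub, sub_mul]
    simp only [mul_smul_comm, smul_mul_assoc, mul_assoc]
    module
  · simp [hA.regular b n hn, hA.regular a 0 le_rfl]
  · simp [hA.creation, hA.regular a 0 le_rfl]

theorem translation_mode_vac (hA : A.IsVertexSuperalgebra) (a : V) (k : ℕ) :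
    A.translation (A.mode a (-1 - k) A.vac) = ((k : ℂ) + 1) • A.mode a (-1 - (k + 1 : ℕ)) A.vac := by
  have h := LinearMap.congr_fun (hA.isCovariant a (-1 - k)) A.vac
  rw [LinearMap.sub_apply, Module.End.mul_apply, Module.End.mul_apply, hA.translation_vac, map_zero,
    sub_zero, LinearMap.smul_apply] at h
  refine h.trans ?_
  push_cast
  rw [sub_sub (-1 : ℤ)]
  congr 1; ring

/-- The fields of the divided derivatives of a state. -/
theorem mode_mode_vac (hA : A.IsVertexSuperalgebra) (a : V) (k : ℕ) (n : ℤ) :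
    A.mode (A.mode a (-1 - k) A.vac) n =
      (((-1) ^ k * Ring.choose n k : ℤ) : ℂ) • A.mode a (n - k) := by
  induction k generalizing n with
  | zero => simp [hA.creation]
  | succ k ih =>
    have h := hA.mode_translation (A.mode a (-1 - k) A.vac) n
    rw [hA.translation_mode_vac, mode_smul, Pi.smul_apply, ih, smul_smul] at h
    have h0 : ((k : ℂ) + 1) ≠ 0 := Nat.cast_add_one_ne_zero k
    refine smul_right_injective _ h0 (h.trans ?_)
    -- The absorption identity `(k+1) (n choose k+1) = n (n-1 choose k)`, valid for all integers
    -- `n`.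
    have hc := Ring.choose_smul_choose n (n := k + 1) (k := 1) (by omega)
    rw [Nat.choose_one_right, Ring.choose_one_right, Nat.add_sub_cancel, Nat.cast_one,
      nsmul_eq_mul] at hc
    change _ = ((k : ℂ) + 1) • _
    rw [smul_smul]
    congr 1
    · have hc' := congr_arg (fun x : ℤ => (x : ℂ)) hc
      push_cast at hc' ⊢
      linear_combination (-(-1 : ℂ) ^ k) * (-hc')
    · congr 1; push_cast; ring

end IsVertexSuperalgebra

end VertexOps

namespace LatticeVA

open MvPolynomial

/-! ## Generators and derivations of the lattice space -/

theorem boson_mul_single (k : ℕ) (m : ℤ) (u : HeisenbergPoly) :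
    boson k * AddMonoidAlgebra.single m u = AddMonoidAlgebra.single m (X k * u) := by
  rw [boson, AddMonoidAlgebra.single_mul_single, zero_add]

theorem expo_mul_expo (m n : ℤ) : expo m * expo n = expo (m + n) := by
  rw [expo, expo, AddMonoidAlgebra.single_mul_single, one_mul, expo]

theorem expo_zero : expo 0 = 1 := rfl

/-- The lattice space is generated by the exponentials under multiplication by bosons. -/
theorem boson_induction {P : LatticeSpace → Prop} (hadd : ∀ a b, P a → P b → P (a + b))
    (hsmul : ∀ (c : ℂ) (a), P a → P (c • a)) (hexpo : ∀ m, P (expo m))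
    (hboson : ∀ k a, P a → P (boson k * a)) (a : LatticeSpace) : P a := by
  have hs : ∀ m u, P (AddMonoidAlgebra.single m u) := by
    intro m u
    induction u using MvPolynomial.induction_on with
    | C c =>
      have : AddMonoidAlgebra.single m (C c : HeisenbergPoly) = c • expo m := by
        rw [expo, AddMonoidAlgebra.smul_single, ← mul_one (C c), ← MvPolynomial.smul_eq_C_mul]
      rw [this]
      exact hsmul _ _ (hexpo m)
    | add p q hp hq => rw [AddMonoidAlgebra.single_add]; exact hadd _ _ hp hq
    | mul_X p k hp => rw [mul_comm, ← boson_mul_single]; exact hboson _ _ hp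
  induction a using AddMonoidAlgebra.induction_linear with
  | zero => simpa using hsmul 0 _ (hexpo 0)
  | add a b ha hb => exact hadd _ _ ha hb
  | single m u => exact hs m u

/-- Linear maps that agree on exponentials and have the same multiplicative recursion are equal. -/
theorem eq_of_boson_mul {W : Type*} [AddCommGroup W] [Module ℂ W] {f g : LatticeSpace →ₗ[ℂ] W}
    (hexpo : ∀ m, f (expo m) = g (expo m))
    (hboson : ∀ k a, f a = g a → f (boson k * a) = g (boson k * a)) : f = g := by
  refine LinearMap.ext fun a => ?_
  induction a using boson_induction with
  | hadd a b ha hb => rw [map_add, map_add, ha, hb]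
  | hsmul c a ha => rw [map_smul, map_smul, ha]
  | hexpo m => exact hexpo m
  | hboson k a ha => exact hboson k a ha

theorem partialD_single (m : ℤ) (u : HeisenbergPoly) :
    partialD (AddMonoidAlgebra.single m u) = AddMonoidAlgebra.single m
      (mkDerivation ℂ (fun k : ℕ => (X (k + 1) : HeisenbergPoly)) u + (m : ℂ) • (X 0 * u)) := by
  simp only [partialD, LinearMap.comp_apply, LinearEquiv.coe_coe,
    AddMonoidAlgebra.coeffLinearEquiv_apply, AddMonoidAlgebra.coeff_single, Finsupp.lsum_single]
  rfl

/-- The partial derivative with respect to `∂^(1+l) φ_γ`. -/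
def pd (l : ℕ) : LatticeSpace →ₗ[ℂ] LatticeSpace :=
  Finsupp.lsum ℂ (fun m : ℤ =>
    (AddMonoidAlgebra.lsingle (R := ℂ) m) ∘ₗ (pderiv l : Derivation ℂ HeisenbergPoly _).toLinearMap) ∘ₗ
    (AddMonoidAlgebra.coeffLinearEquiv ℂ).toLinearMap

/-- The charge operator, equal to `m` on multiples of `e^(φ_(mγ))`. -/
def charge : LatticeSpace →ₗ[ℂ] LatticeSpace :=
  Finsupp.lsum ℂ (fun m : ℤ => (m : ℂ) • (AddMonoidAlgebra.lsingle (R := ℂ) m)) ∘ₗ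
    (AddMonoidAlgebra.coeffLinearEquiv ℂ).toLinearMap

theorem pd_single (l : ℕ) (m : ℤ) (u : HeisenbergPoly) :
    pd l (AddMonoidAlgebra.single m u) = AddMonoidAlgebra.single m (pderiv l u) := by
  simp only [pd, LinearMap.comp_apply, LinearEquiv.coe_coe,
    AddMonoidAlgebra.coeffLinearEquiv_apply, AddMonoidAlgebra.coeff_single, Finsupp.lsum_single]
  rfl

theorem charge_single (m : ℤ) (u : HeisenbergPoly) :
    charge (AddMonoidAlgebra.single m u) = (m : ℂ) • AddMonoidAlgebra.single m u := by
  simp only [charge, LinearMap.comp_apply, LinearEquiv.coe_coe,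
    AddMonoidAlgebra.coeffLinearEquiv_apply, AddMonoidAlgebra.coeff_single, Finsupp.lsum_single]
  rfl

theorem pd_expo (l : ℕ) (m : ℤ) : pd l (expo m) = 0 := by
  rw [expo, pd_single]; simp

theorem charge_expo (m : ℤ) : charge (expo m) = (m : ℂ) • expo m := charge_single m 1

theorem partialD_expo (m : ℤ) : partialD (expo m) = (m : ℂ) • (boson 0 * expo m) := by
  rw [expo, partialD_single, boson_mul_single, AddMonoidAlgebra.smul_single]
  congr 1
  simp

theorem pd_boson_mul (l k : ℕ) (a : LatticeSpace) :
    pd l (boson k * a) = (if k = l then a else 0) + boson k * pd l a := by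
  induction a using AddMonoidAlgebra.induction_linear with
  | zero => simp
  | add a b ha hb =>
    rw [mul_add, map_add, ha, hb, map_add, mul_add]
    split_ifs <;> abel
  | single m u =>
    rw [boson_mul_single, pd_single, pd_single, boson_mul_single, Derivation.leibniz, pderiv_X,
      smul_eq_mul, smul_eq_mul, AddMonoidAlgebra.single_add, add_comm]
    congr 1
    split_ifs with h
    · subst h; simp
    · simp [h]

theorem charge_boson_mul (k : ℕ) (a : LatticeSpace) : charge (boson k * a) = boson k * charge a := by
  induction a using AddMonoidAlgebra.induction_linear with
  | zero => simp
  | add a b ha hb => rw [mul_add, map_add, ha, hb, map_add, mul_add]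
  | single m u => rw [boson_mul_single, charge_single, charge_single, mul_smul_comm, boson_mul_single]

theorem partialD_boson_mul (k : ℕ) (a : LatticeSpace) :
    partialD (boson k * a) = boson (k + 1) * a + boson k * partialD a := by
  induction a using AddMonoidAlgebra.induction_linear with
  | zero => simp
  | add a b ha hb => rw [mul_add, map_add, ha, hb, map_add, mul_add, mul_add]; abel
  | single m u =>
    rw [boson_mul_single, partialD_single, partialD_single, boson_mul_single, boson_mul_single,
      ← AddMonoidAlgebra.single_add, Derivation.leibniz, mkDerivation_X, smul_eq_mul, smul_eq_mul]
    congr 1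
    rw [mul_add, mul_smul_comm, mul_left_comm (X 0)]
    ring

theorem partialD_mul (a b : LatticeSpace) : partialD (a * b) = partialD a * b + a * partialD b := by
  induction a using boson_induction with
  | hadd a a' ha ha' => rw [add_mul, map_add, ha, ha', map_add, add_mul, add_mul]; abel
  | hsmul c a ha => rw [smul_mul_assoc, map_smul, ha, map_smul, smul_mul_assoc, smul_mul_assoc, smul_add]
  | hboson k a ha => rw [mul_assoc, partialD_boson_mul, ha, partialD_boson_mul]; ring
  | hexpo m =>
    induction b using boson_induction with
    | hadd a a' ha ha' => rw [mul_add, map_add, ha, ha', map_add, mul_add, mul_add]; abel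
    | hsmul c a ha =>
      rw [mul_smul_comm, map_smul, ha, map_smul, mul_smul_comm, mul_smul_comm, smul_add]
    | hboson k a ha => rw [mul_left_comm, partialD_boson_mul, ha, partialD_boson_mul]; ring
    | hexpo n =>
      rw [expo_mul_expo, partialD_expo, partialD_expo, partialD_expo, ← expo_mul_expo,
        smul_mul_assoc, mul_smul_comm, mul_left_comm (expo m), mul_assoc, ← add_smul]
      push_cast; rfl

theorem partialD_one : partialD (1 : LatticeSpace) = 0 := by
  rw [← expo_zero, partialD_expo]; simp

theorem partialD_boson (k : ℕ) : partialD (boson k) = boson (k + 1) := by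
  have := partialD_boson_mul k 1
  rwa [partialD_one, mul_zero, add_zero, mul_one, mul_one] at this

theorem partialD_pow_boson (k n : ℕ) : (partialD ^ n) (boson k) = boson (k + n) := by
  induction n with
  | zero => rfl
  | succ n ih => rw [pow_succ', Module.End.mul_apply, ih, partialD_boson, add_assoc]

theorem pd_eventually_zero (a : LatticeSpace) : ∃ M, ∀ l, M ≤ l → pd l a = 0 := by
  induction a using boson_induction with
  | hadd a b ha hb =>
    obtain ⟨M, hM⟩ := ha
    obtain ⟨M', hM'⟩ := hb
    exact ⟨max M M', fun l hl => by
      rw [map_add, hM l (le_trans (le_max_left _ _) hl), hM' l (le_trans (le_max_right _ _) hl),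
        add_zero]⟩
  | hsmul c a ha =>
    obtain ⟨M, hM⟩ := ha
    exact ⟨M, fun l hl => by rw [map_smul, hM l hl, smul_zero]⟩
  | hexpo m => exact ⟨0, fun l _ => pd_expo l m⟩
  | hboson k a ha =>
    obtain ⟨M, hM⟩ := ha
    refine ⟨max M (k + 1), fun l hl => ?_⟩
    have h1 := le_max_left M (k + 1)
    have h2 := le_max_right M (k + 1)
    rw [pd_boson_mul, hM l (by omega), if_neg (by omega), mul_zero, add_zero]

/-! ## The coproduct -/

theorem comul_boson (k : ℕ) : comul (boson k) = boson k ⊗ₜ[ℂ] 1 + 1 ⊗ₜ[ℂ] boson k := by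
  refine (AddMonoidAlgebra.liftNC_single _ _ (0 : ℤ) (X k : HeisenbergPoly)).trans ?_
  change aeval _ (X k) * (1 : LatticeSpace ⊗[ℂ] LatticeSpace) = _
  rw [aeval_X, mul_one]

theorem comul_expo (m : ℤ) : comul (expo m) = expo m ⊗ₜ[ℂ] expo m := by
  refine (AddMonoidAlgebra.liftNC_single _ _ m (1 : HeisenbergPoly)).trans ?_
  change aeval _ 1 * expo m ⊗ₜ[ℂ] expo m = _
  rw [map_one, one_mul]

/-- The generators are primitive, so `∂/∂X_l` is a translation-invariant derivation and may be taken
in one tensor factor of the coproduct. With the analogous statement for `charge`, contractions in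
the second tensor factor become operators on `b` itself. -/
theorem lTensor_pd_comul (l : ℕ) (b : LatticeSpace) :
    (pd l).lTensor LatticeSpace (comul b) = comul (pd l b) := by
  have key : ∀ k (s : LatticeSpace ⊗[ℂ] LatticeSpace),
      (pd l).lTensor LatticeSpace ((boson k ⊗ₜ[ℂ] 1 + 1 ⊗ₜ[ℂ] boson k) * s) =
        (if k = l then s else 0) +
          (boson k ⊗ₜ[ℂ] 1 + 1 ⊗ₜ[ℂ] boson k) * (pd l).lTensor LatticeSpace s := by
    intro k s
    induction s using TensorProduct.induction_on with
    | zero => simp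
    | add s s' h h' =>
      rw [mul_add, map_add, h, h', map_add, mul_add]
      split_ifs <;> abel
    | tmul x y =>
      rw [add_mul, Algebra.TensorProduct.tmul_mul_tmul, Algebra.TensorProduct.tmul_mul_tmul, one_mul,
        one_mul, map_add, LinearMap.lTensor_tmul, LinearMap.lTensor_tmul, LinearMap.lTensor_tmul,
        pd_boson_mul, add_mul, Algebra.TensorProduct.tmul_mul_tmul,
        Algebra.TensorProduct.tmul_mul_tmul, one_mul, one_mul, TensorProduct.tmul_add]
      split_ifs
      · abel
      · rw [TensorProduct.tmul_zero]; abel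
  induction b using boson_induction with
  | hadd a b ha hb => rw [map_add, map_add, ha, hb, map_add, map_add]
  | hsmul c a ha => rw [map_smul, map_smul, ha, map_smul, map_smul]
  | hexpo m => rw [comul_expo, LinearMap.lTensor_tmul, pd_expo, TensorProduct.tmul_zero, map_zero]
  | hboson k a ha =>
    rw [map_mul, comul_boson, key, ha, pd_boson_mul, map_add, map_mul, comul_boson]
    congr 1
    split_ifs
    · rfl
    · rw [map_zero]

theorem lTensor_charge_comul (b : LatticeSpace) :
    charge.lTensor LatticeSpace (comul b) = comul (charge b) := by
  have key : ∀ k (s : LatticeSpace ⊗[ℂ] LatticeSpace),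
      charge.lTensor LatticeSpace ((boson k ⊗ₜ[ℂ] 1 + 1 ⊗ₜ[ℂ] boson k) * s) =
          (boson k ⊗ₜ[ℂ] 1 + 1 ⊗ₜ[ℂ] boson k) * charge.lTensor LatticeSpace s := by
    intro k s
    induction s using TensorProduct.induction_on with
    | zero => simp
    | add s s' h h' => rw [mul_add, map_add, h, h', map_add, mul_add]
    | tmul x y =>
      rw [add_mul, Algebra.TensorProduct.tmul_mul_tmul, Algebra.TensorProduct.tmul_mul_tmul, one_mul,
        one_mul, map_add, LinearMap.lTensor_tmul, LinearMap.lTensor_tmul, LinearMap.lTensor_tmul,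
        charge_boson_mul, add_mul, Algebra.TensorProduct.tmul_mul_tmul,
        Algebra.TensorProduct.tmul_mul_tmul, one_mul, one_mul]
  induction b using boson_induction with
  | hadd a b ha hb => rw [map_add, map_add, ha, hb, map_add, map_add]
  | hsmul c a ha => rw [map_smul, map_smul, ha, map_smul, map_smul]
  | hexpo m =>
    rw [comul_expo, LinearMap.lTensor_tmul, charge_expo, TensorProduct.tmul_smul, map_smul,
      comul_expo]
  | hboson k a ha => rw [map_mul, comul_boson, key, ha, charge_boson_mul, map_mul, comul_boson]

/-! ## The pairing -/

/-- A derivation with prescribed values is `∑ f_l ∂_l`, a finite sum on each polynomial. Allowing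
every cutoff `K ≥ M` makes the statement additive; the same device is used in the recursions below.
-/
theorem mkDerivation_map (f : ℕ → PairingRing) (v : HeisenbergPoly) : ∃ M : ℕ, ∀ K, M ≤ K →
    mkDerivation PairingRing (fun l => (C (f l) : MvPolynomial ℕ PairingRing))
      (map (algebraMap ℂ PairingRing) v) =
    ∑ l ∈ Finset.range K, f l • map (algebraMap ℂ PairingRing) (pderiv l v) := by
  induction v using MvPolynomial.induction_on with
  | C c => exact ⟨0, fun K _ => by simp⟩
  | add p q hp hq =>
    obtain ⟨M, hM⟩ := hp
    obtain ⟨M', hM'⟩ := hq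
    refine ⟨max M M', fun K hK => ?_⟩
    rw [map_add, map_add, hM K (le_trans (le_max_left _ _) hK),
      hM' K (le_trans (le_max_right _ _) hK), ← Finset.sum_add_distrib]
    simp [smul_add]
  | mul_X p k hp =>
    obtain ⟨M, hM⟩ := hp
    refine ⟨max M (k + 1), fun K hK => ?_⟩
    have hk : k ∈ Finset.range K := Finset.mem_range.mpr (le_trans (le_max_right M (k + 1)) hK)
    rw [map_mul, map_X, Derivation.leibniz, mkDerivation_X, hM K (le_trans (le_max_left _ _) hK)]
    have h : ∀ l, f l • map (algebraMap ℂ PairingRing) (pderiv l (p * X k : HeisenbergPoly)) =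
        (if l = k then f l • map (algebraMap ℂ PairingRing) p else 0) +
          (X k : MvPolynomial ℕ PairingRing) • f l • map (algebraMap ℂ PairingRing) (pderiv l p) := by
      intro l
      rw [Derivation.leibniz, pderiv_X, map_add, smul_add]
      congr 1
      · split_ifs with h
        · subst h; simp
        · simp [Ne.symm h]
      · simp
    simp_rw [h]
    rw [Finset.sum_add_distrib, Finset.sum_ite_eq' , if_pos hk, Finset.smul_sum]
    congr 1
    rw [smul_eq_mul, mul_comm, ← smul_eq_C_mul]

open LaurentPolynomial (T) in
-- Pairing with a primitive element is a derivation: it contracts one boson of `b` at a time, or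
-- pairs with the exponential, whose momentum is read off by `charge`. The cutoff depends on `b`
-- only and not on `a`, which is needed for the coproduct of `a`.
theorem pairing_boson_mul (k : ℕ) (b : LatticeSpace) : ∃ M : ℕ, ∀ K, M ≤ K → ∀ a,
    pairing (boson k * a) b = ∑ l ∈ Finset.range K, pairBosonBoson k l * pairing a (pd l b) +
      ((-1 : ℂ) ^ k * (k.factorial : ℂ)) • T (-1 - k) * pairing a (charge b) := by
  induction b using AddMonoidAlgebra.induction_linear with
  | zero => exact ⟨0, fun K _ a => by simp⟩
  | add b b' hb hb' =>
    obtain ⟨M, hM⟩ := hb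
    obtain ⟨M', hM'⟩ := hb'
    refine ⟨max M M', fun K hK a => ?_⟩
    rw [map_add, hM K (le_trans (le_max_left _ _) hK), hM' K (le_trans (le_max_right _ _) hK)]
    simp only [map_add, mul_add, Finset.sum_add_distrib]
    abel
  | single n v =>
    obtain ⟨M, hM⟩ := mkDerivation_map (pairBosonBoson k) v
    refine ⟨M, fun K hK a => ?_⟩
    induction a using AddMonoidAlgebra.induction_linear with
    | zero => simp
    | add a a' h h' =>
      rw [mul_add, map_add, LinearMap.add_apply, h, h']
      simp only [map_add, LinearMap.add_apply, mul_add, Finset.sum_add_distrib]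
      abel
    | single m u =>
      rw [boson_mul_single, pairing_single, mul_comm (X k), map_mul, Module.End.mul_apply,
        contractionHom_X, contraction, LinearMap.add_apply, Derivation.coeFn_coe, hM K hK,
        Module.algebraMap_end_apply, map_add, map_add, mul_add, map_sum, map_sum, Finset.mul_sum,
        charge_single, (pairing _).map_smul, pairing_single, map_smul (contractionHom n u), smul_eval]
      congr 1
      · refine Finset.sum_congr rfl fun l _ => ?_
        rw [pd_single, pairing_single, map_smul (contractionHom n u), smul_eval]
        ring
      · rw [pairBosonExpo, mul_smul_comm, smul_mul_assoc, smul_mul_assoc, mul_left_comm,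
          mul_smul_comm, smul_smul]
        congr 1
        ring

theorem contractionHom_one (n : ℤ) : contractionHom n 1 = 1 := map_one _

theorem pairing_expo_expo (m n : ℤ) : pairing (expo m) (expo n) = LaurentPolynomial.T (m * n) := by
  rw [expo, expo, pairing_single, contractionHom_one]
  simp

theorem pairing_expo_boson_mul (m : ℤ) (k : ℕ) (b : LatticeSpace) :
    pairing (expo m) (boson k * b) = pairExpoBoson m k * pairing (expo m) b := by
  induction b using AddMonoidAlgebra.induction_linear with
  | zero => simp
  | add a b ha hb => rw [mul_add, map_add, ha, hb, map_add, mul_add]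
  | single n v =>
    rw [boson_mul_single, expo, pairing_single, pairing_single, contractionHom_one,
      Module.End.one_apply, Module.End.one_apply, map_mul, map_X, map_mul, eval_X]
    ring

end LatticeVA

namespace LatticeVA

open MvPolynomial

/-! ## The vertex operators -/

/-- The monomial `z^p`. -/
def zpow (p : ℤ) : LaurentSeries LatticeSpace := HahnSeries.single p 1

theorem coeff_zpow_mul (p n : ℤ) (f : LaurentSeries LatticeSpace) :
    (zpow p * f).coeff n = f.coeff (n - p) := by
  rw [zpow, HahnSeries.coeff_single_mul, one_mul]

theorem zpow_mul_zpow (p q : ℤ) : zpow p * zpow q = zpow (p + q) := by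
  rw [zpow, zpow, HahnSeries.single_mul_single, one_mul, zpow]

theorem series_mul_left_comm (f g h : LaurentSeries LatticeSpace) :
    f * (g * h) = g * (f * h) := mul_left_comm f g h

theorem series_sub_mul (f g h : LaurentSeries LatticeSpace) : (f - g) * h = f * h - g * h :=
  sub_mul f g h

theorem scalarSeries_single (p : ℤ) (c : ℂ) :
    scalarSeries (AddMonoidAlgebra.single p c) = c • zpow p := by
  simp only [scalarSeries, LinearMap.comp_apply, LinearEquiv.coe_coe,
    AddMonoidAlgebra.coeffLinearEquiv_apply, AddMonoidAlgebra.coeff_single, Finsupp.lsum_single]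
  change HahnSeries.single p (algebraMap ℂ LatticeSpace c) = c • HahnSeries.single p 1
  rw [Algebra.algebraMap_eq_smul_one]
  exact (HahnSeries.single.linearMap p : LatticeSpace →ₗ[ℂ] LaurentSeries LatticeSpace).map_smul c 1

open LaurentPolynomial (T) in
theorem scalarSeries_T (p : ℤ) : scalarSeries (T p) = zpow p := by
  rw [T, scalarSeries_single, one_smul]

open LaurentPolynomial (T) in
theorem scalarSeries_smul_T_mul (c : ℂ) (p : ℤ) (q : PairingRing) :
    scalarSeries (c • T p * q) = c • (zpow p * scalarSeries q) := by
  induction q using AddMonoidAlgebra.induction_linear with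
  | zero => simp
  | add q q' h h' => rw [mul_add, map_add, h, h', map_add, mul_add, smul_add]
  | single n r =>
    rw [T, AddMonoidAlgebra.smul_single, AddMonoidAlgebra.single_mul_single, scalarSeries_single,
      scalarSeries_single, mul_smul_comm, zpow_mul_zpow, smul_eq_mul, mul_one, mul_smul]

theorem taylor_apply (a : LatticeSpace) : taylor a = HahnSeries.ofPowerSeries ℤ LatticeSpace
    (PowerSeries.mk fun k => ((k.factorial : ℂ)⁻¹) • (partialD ^ k) a) := rfl

theorem divided_partialD_mul (a b : LatticeSpace) (n : ℕ) :
    ((n.factorial : ℂ)⁻¹) • (partialD ^ n) (a * b) = ∑ p ∈ Finset.HasAntidiagonal.antidiagonal n,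
      (((p.1.factorial : ℂ)⁻¹) • (partialD ^ p.1) a) *
        (((p.2.factorial : ℂ)⁻¹) • (partialD ^ p.2) b) := by
  have hs : ∀ (a : LatticeSpace) (n : ℕ), partialD (((n.factorial : ℂ)⁻¹) • (partialD ^ n) a) =
      ((n : ℂ) + 1) • (((n + 1).factorial : ℂ)⁻¹) • (partialD ^ (n + 1)) a := by
    intro a n
    rw [map_smul, pow_succ', Module.End.mul_apply, smul_smul]
    congr 1
    rw [Nat.factorial_succ]
    have h0 : ((n : ℂ) + 1) ≠ 0 := Nat.cast_add_one_ne_zero n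
    push_cast
    field_simp
  induction n with
  | zero => simp
  | succ n ih =>
    have h0 : ((n : ℂ) + 1) ≠ 0 := Nat.cast_add_one_ne_zero n
    refine smul_right_injective _ h0 ?_
    change ((n : ℂ) + 1) • _ = ((n : ℂ) + 1) • _
    rw [← hs, ih, map_sum, Finset.smul_sum]
    -- The factor `n + 1 = p.1 + p.2` is distributed over the two factors, where it cancels one step
    -- of each factorial.
    have e : ∀ p ∈ Finset.HasAntidiagonal.antidiagonal (n + 1),
        ((n : ℂ) + 1) • ((((p.1.factorial : ℂ)⁻¹) • (partialD ^ p.1) a) *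
          (((p.2.factorial : ℂ)⁻¹) • (partialD ^ p.2) b)) =
        (p.1 : ℂ) • ((((p.1.factorial : ℂ)⁻¹) • (partialD ^ p.1) a) *
          (((p.2.factorial : ℂ)⁻¹) • (partialD ^ p.2) b)) +
        (p.2 : ℂ) • ((((p.1.factorial : ℂ)⁻¹) • (partialD ^ p.1) a) *
          (((p.2.factorial : ℂ)⁻¹) • (partialD ^ p.2) b)) := by
      intro p hp
      rw [← add_smul]
      congr 1
      exact_mod_cast (Finset.HasAntidiagonal.mem_antidiagonal.mp hp).symm
    rw [Finset.sum_congr rfl e, Finset.sum_add_distrib, Finset.Nat.sum_antidiagonal_succ,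
      Finset.Nat.sum_antidiagonal_succ', Nat.cast_zero, zero_smul, zero_smul, zero_add, zero_add,
      ← Finset.sum_add_distrib]
    refine Finset.sum_congr rfl fun p _ => ?_
    rw [partialD_mul, hs, hs]
    push_cast
    simp only [smul_mul_assoc, mul_smul_comm]
    rw [smul_comm ((p.2.factorial : ℂ)⁻¹)]

/-- The exponential `e^(z∂)` of a derivation is multiplicative. -/
theorem taylor_mul (a b : LatticeSpace) : taylor (a * b) = taylor a * taylor b := by
  rw [taylor_apply, taylor_apply, taylor_apply, ← map_mul]
  congr 1
  ext n : 1
  rw [PowerSeries.coeff_mul]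
  simp only [PowerSeries.coeff_mk]
  exact divided_partialD_mul a b n

theorem constant_mul (a b : LatticeSpace) : constant (a * b) = constant a * constant b := by
  change HahnSeries.single 0 (a * b) = HahnSeries.single 0 a * HahnSeries.single 0 b
  rw [HahnSeries.single_mul_single, add_zero]

/-- The bilinear map that sends coproducts to the vertex operator. -/
def core : (LatticeSpace ⊗[ℂ] LatticeSpace) →ₗ[ℂ] (LatticeSpace ⊗[ℂ] LatticeSpace) →ₗ[ℂ]
    LaurentSeries LatticeSpace :=
  (TensorProduct.mk ℂ (LatticeSpace ⊗[ℂ] LatticeSpace) (LatticeSpace ⊗[ℂ] LatticeSpace)).compr₂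
  (fieldCore ∘ₗ
    (TensorProduct.tensorTensorTensorComm ℂ LatticeSpace LatticeSpace LatticeSpace
      LatticeSpace).toLinearMap)

theorem field_apply (a b : LatticeSpace) : field a b = core (comul a) (comul b) := rfl

theorem core_tmul (a a' b b' : LatticeSpace) : core (a ⊗ₜ a') (b ⊗ₜ b') =
    taylor a * constant b * scalarSeries (pairing a' b') := rfl

/-- In the coproduct a boson sits in the first leg, where it contributes the creation part `e^(z∂)
∂^(1+k)φ_γ`, or in the second leg, where the pairing contributes the annihilation part. The form
with an arbitrary tensor `t` allows induction on pure tensors. -/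
theorem core_boson_mul (k : ℕ) (s : LatticeSpace ⊗[ℂ] LatticeSpace) : ∃ M : ℕ, ∀ K, M ≤ K →
    ∀ t, core ((boson k ⊗ₜ[ℂ] 1 + 1 ⊗ₜ[ℂ] boson k) * t) s = taylor (boson k) * core t s +
      (∑ l ∈ Finset.range K, ((-1 : ℂ) ^ k * ((k + l + 1).factorial : ℂ)) •
        (zpow (-2 - k - l) * core t ((pd l).lTensor LatticeSpace s)) +
      ((-1 : ℂ) ^ k * (k.factorial : ℂ)) •
        (zpow (-1 - k) * core t (charge.lTensor LatticeSpace s))) := by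
  induction s using TensorProduct.induction_on with
  | zero => exact ⟨0, fun K _ t => by simp⟩
  | add s s' h h' =>
    obtain ⟨M, hM⟩ := h
    obtain ⟨M', hM'⟩ := h'
    refine ⟨max M M', fun K hK t => ?_⟩
    rw [map_add, hM K (le_trans (le_max_left _ _) hK), hM' K (le_trans (le_max_right _ _) hK)]
    simp only [map_add, mul_add, smul_add, Finset.sum_add_distrib]
    abel
  | tmul b b' =>
    obtain ⟨M, hM⟩ := pairing_boson_mul k b'
    refine ⟨M, fun K hK t => ?_⟩
    induction t using TensorProduct.induction_on with
    | zero => simp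
    | add t t' h h' =>
      rw [mul_add, map_add, LinearMap.add_apply, h, h']
      simp only [map_add, LinearMap.add_apply, mul_add, smul_add, Finset.sum_add_distrib]
      abel
    | tmul a a' =>
      rw [add_mul, Algebra.TensorProduct.tmul_mul_tmul, Algebra.TensorProduct.tmul_mul_tmul, one_mul,
        one_mul, map_add, LinearMap.add_apply, core_tmul, core_tmul, taylor_mul, hM K hK, map_add,
        map_sum]
      simp only [core_tmul, LinearMap.lTensor_tmul, pairBosonBoson, scalarSeries_smul_T_mul, mul_add,
        Finset.mul_sum, mul_smul_comm]
      refine congr_arg₂ (· + ·) ?_ (congr_arg₂ (· + ·) (Finset.sum_congr rfl fun l _ => ?_) ?_)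
      · rw [mul_assoc, mul_assoc, mul_assoc]
      · rw [series_mul_left_comm]
      · rw [series_mul_left_comm]

theorem field_boson_mul (k : ℕ) (b : LatticeSpace) : ∃ M : ℕ, ∀ K, M ≤ K → ∀ a,
    field (boson k * a) b = taylor (boson k) * field a b +
      (∑ l ∈ Finset.range K, ((-1 : ℂ) ^ k * ((k + l + 1).factorial : ℂ)) •
        (zpow (-2 - k - l) * field a (pd l b)) +
      ((-1 : ℂ) ^ k * (k.factorial : ℂ)) • (zpow (-1 - k) * field a (charge b))) := by
  obtain ⟨M, hM⟩ := core_boson_mul k (comul b)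
  refine ⟨M, fun K hK a => ?_⟩
  rw [field_apply, map_mul, comul_boson, hM K hK, field_apply, field_apply, lTensor_charge_comul]
  simp only [lTensor_pd_comul, ← field_apply]

/-- The map `b ↦ ∑ ⟨e^(φ_(mγ)), b''⟩ b'`. -/
def expoPairing (m : ℤ) : LatticeSpace →ₗ[ℂ] LaurentSeries LatticeSpace :=
  LinearMap.mul' ℂ (LaurentSeries LatticeSpace) ∘ₗ
    TensorProduct.map constant (scalarSeries ∘ₗ pairing (expo m)) ∘ₗ comul.toLinearMap

theorem field_expo (m : ℤ) (b : LatticeSpace) :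
    field (expo m) b = taylor (expo m) * expoPairing m b := by
  have key : ∀ s, core (expo m ⊗ₜ expo m) s = taylor (expo m) *
      (LinearMap.mul' ℂ (LaurentSeries LatticeSpace))
        (TensorProduct.map constant (scalarSeries ∘ₗ pairing (expo m)) s) := by
    intro s
    induction s using TensorProduct.induction_on with
    | zero => simp
    | add s s' h h' => rw [map_add, h, h', map_add, map_add, mul_add]
    | tmul b b' => rw [core_tmul, mul_assoc]; rfl
  rw [field_apply, comul_expo, key]
  rfl

theorem expoPairing_expo (m n : ℤ) : expoPairing m (expo n) = constant (expo n) * zpow (m * n) := by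
  change LinearMap.mul' ℂ (LaurentSeries LatticeSpace)
    (TensorProduct.map constant (scalarSeries ∘ₗ pairing (expo m)) (comul (expo n))) = _
  rw [comul_expo, TensorProduct.map_tmul, LinearMap.mul'_apply, LinearMap.comp_apply,
    pairing_expo_expo, scalarSeries_T]

/-- Pairing with a grouplike element is multiplicative, so `b ↦ ∑ ⟨e^(φ_(mγ)), b''⟩ b'` substitutes
`∂^(1+k)φ_γ - m k! z^(-1-k)` for the variable `∂^(1+k)φ_γ`. -/
theorem expoPairing_boson_mul (m : ℤ) (k : ℕ) (b : LatticeSpace) :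
    expoPairing m (boson k * b) =
      (constant (boson k) - ((m : ℂ) * (k.factorial : ℂ)) • zpow (-1 - k)) * expoPairing m b := by
  have key : ∀ s : LatticeSpace ⊗[ℂ] LatticeSpace, LinearMap.mul' ℂ (LaurentSeries LatticeSpace)
      (TensorProduct.map constant (scalarSeries ∘ₗ pairing (expo m))
        ((boson k ⊗ₜ[ℂ] 1 + 1 ⊗ₜ[ℂ] boson k) * s)) =
      (constant (boson k) - ((m : ℂ) * (k.factorial : ℂ)) • zpow (-1 - k)) *
        LinearMap.mul' ℂ (LaurentSeries LatticeSpace)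
          (TensorProduct.map constant (scalarSeries ∘ₗ pairing (expo m)) s) := by
    intro s
    induction s using TensorProduct.induction_on with
    | zero => simp
    | add s s' h h' => rw [mul_add, map_add, map_add, h, h', map_add, map_add, mul_add]
    | tmul b b' =>
      rw [add_mul, Algebra.TensorProduct.tmul_mul_tmul, Algebra.TensorProduct.tmul_mul_tmul, one_mul,
        one_mul, map_add, map_add, TensorProduct.map_tmul, TensorProduct.map_tmul,
        TensorProduct.map_tmul, LinearMap.mul'_apply, LinearMap.mul'_apply, LinearMap.mul'_apply,
        LinearMap.comp_apply, LinearMap.comp_apply, pairing_expo_boson_mul, pairExpoBoson,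
        scalarSeries_smul_T_mul, constant_mul, mul_smul_comm, series_sub_mul, smul_mul_assoc, mul_assoc,
        series_mul_left_comm (constant b)]
      module
  change LinearMap.mul' ℂ (LaurentSeries LatticeSpace)
    (TensorProduct.map constant (scalarSeries ∘ₗ pairing (expo m)) (comul (boson k * b))) = _
  rw [map_mul, comul_boson, key]
  rfl

theorem taylor_one : taylor 1 = 1 := by
  rw [taylor_apply, ← map_one (HahnSeries.ofPowerSeries ℤ LatticeSpace)]
  congr 1
  ext n : 1
  rw [PowerSeries.coeff_mk, PowerSeries.coeff_one]
  rcases n with _ | n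
  · simp
  · rw [pow_succ, Module.End.mul_apply, partialD_one, map_zero, smul_zero, if_neg (by omega)]

theorem expoPairing_zero (b : LatticeSpace) : expoPairing 0 b = constant b := by
  have h : expoPairing 0 = constant := by
    refine eq_of_boson_mul (W := LaurentSeries LatticeSpace) (fun m => ?_) fun k a ha => ?_
    · rw [expoPairing_expo, zero_mul]
      exact mul_one _
    · rw [expoPairing_boson_mul, ha, constant_mul, Int.cast_zero, zero_mul, zero_smul]
      have e : constant (boson k) - (0 : LaurentSeries LatticeSpace) = constant (boson k) := by
        ext n
        simp
      rw [e]
  rw [h]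

theorem field_one (b : LatticeSpace) : field 1 b = constant b := by
  rw [← expo_zero, field_expo, expoPairing_zero, expo_zero, taylor_one, one_mul]

theorem expoPairing_one (m : ℤ) : expoPairing m 1 = 1 := by
  rw [← expo_zero, expoPairing_expo, mul_zero, expo_zero]
  exact one_mul _

/-! ## Modes -/

theorem mode_apply (a b : LatticeSpace) (n : ℤ) : vertexOps.mode a n b = (field a b).coeff (-n - 1) :=
  rfl

/-- Negative exponents are absent from `p`, and the lower bound on the exponents of `f` excludes `l
≥ K`. -/
theorem coeff_ofPowerSeries_mul {R : Type*} [Ring R] (p : PowerSeries R) (f : LaurentSeries R)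
    (n : ℤ) (K : ℕ) (hf : ∀ i, i + K ≤ n → f.coeff i = 0) :
    (HahnSeries.ofPowerSeries ℤ R p * f).coeff n =
      ∑ l ∈ Finset.range K, PowerSeries.coeff l p * f.coeff (n - l) := by
  have h0 : ∀ i : ℤ, i < 0 → (HahnSeries.ofPowerSeries ℤ R p).coeff i = 0 := by
    intro i hi
    rw [HahnSeries.ofPowerSeries_apply, HahnSeries.embDomain_of_notMem_range]
    rintro ⟨m, hm⟩
    simp at hm
    omega
  rw [HahnSeries.coeff_mul]
  let e : ℕ ↪ ℤ × ℤ := ⟨fun l => ((l : ℤ), n - l), fun l l' h => by simpa using (Prod.ext_iff.mp h).1⟩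
  have hm : ∑ l ∈ Finset.range K, PowerSeries.coeff l p * f.coeff (n - l) =
      ∑ ij ∈ (Finset.range K).map e,
        (HahnSeries.ofPowerSeries ℤ R p).coeff ij.1 * f.coeff ij.2 := by
    rw [Finset.sum_map]
    refine Finset.sum_congr rfl fun l _ => ?_
    change _ = (HahnSeries.ofPowerSeries ℤ R p).coeff (l : ℤ) * f.coeff (n - l)
    rw [HahnSeries.ofPowerSeries_apply_coeff]
  rw [hm]
  refine Finset.sum_subset (fun ij hij => ?_) fun ij hij hn => ?_
  · obtain ⟨h1, h2, h3⟩ := Finset.mem_antidiagonal.mp hij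
    have h4 : 0 ≤ ij.1 := not_lt.mp fun h => h1 (h0 _ h)
    have h5 : ¬ ij.2 + K ≤ n := fun h => h2 (hf _ h)
    exact Finset.mem_map.mpr ⟨ij.1.toNat, Finset.mem_range.mpr (by omega),
      Prod.ext (Int.toNat_of_nonneg h4) (by
        change n - (ij.1.toNat : ℤ) = ij.2
        omega)⟩
  · obtain ⟨l, _, rfl⟩ := Finset.mem_map.mp hij
    by_contra h
    exact hn (Finset.mem_antidiagonal.mpr ⟨left_ne_zero_of_mul h, right_ne_zero_of_mul h,
      add_sub_cancel _ _⟩)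

end LatticeVA

/-! ### Coefficients of the vertex operators. -/

namespace LatticeVA

open MvPolynomial FormalModes VertexOps

/-- The coefficient of `z^q` in `e^(z∂) e^(φ_(mγ))`. -/
def expoCoeff (m q : ℤ) : LatticeSpace := (taylor (expo m)).coeff q

theorem coeff_ofPowerSeries_of_neg (p : PowerSeries LatticeSpace) {i : ℤ} (hi : i < 0) :
    (HahnSeries.ofPowerSeries ℤ LatticeSpace p).coeff i = 0 := by
  rw [HahnSeries.ofPowerSeries_apply, HahnSeries.embDomain_of_notMem_range]
  rintro ⟨m, hm⟩
  simp at hm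
  omega

theorem coeff_taylor (a : LatticeSpace) (n : ℕ) :
    (taylor a).coeff n = ((n.factorial : ℂ)⁻¹) • (partialD ^ n) a := by
  rw [taylor_apply, HahnSeries.ofPowerSeries_apply_coeff, PowerSeries.coeff_mk]

theorem coeff_taylor_of_neg (a : LatticeSpace) {i : ℤ} (hi : i < 0) : (taylor a).coeff i = 0 :=
  coeff_ofPowerSeries_of_neg _ hi

theorem coeff_taylor_boson (k n : ℕ) :
    (taylor (boson k)).coeff n = ((n.factorial : ℂ)⁻¹) • boson (k + n) := by
  rw [coeff_taylor, partialD_pow_boson]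

theorem coeff_mul_constant (f : LaurentSeries LatticeSpace) (b : LatticeSpace) (n : ℤ) :
    (f * constant b).coeff n = f.coeff n * b :=
  HahnSeries.coeff_mul_single_zero

theorem coeff_constant_mul (f : LaurentSeries LatticeSpace) (b : LatticeSpace) (n : ℤ) :
    (constant b * f).coeff n = b * f.coeff n :=
  HahnSeries.coeff_single_zero_mul

theorem coeff_constant (b : LatticeSpace) (n : ℤ) :
    (constant b).coeff n = if n = 0 then b else 0 := by
  by_cases h : n = 0
  · subst h
    rw [if_pos rfl]
    exact HahnSeries.coeff_single_same 0 b
  · rw [if_neg h]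
    exact HahnSeries.coeff_single_of_ne h

theorem coeff_sum (s : Finset ℕ) (f : ℕ → LaurentSeries LatticeSpace) (n : ℤ) :
    (∑ l ∈ s, f l).coeff n = ∑ l ∈ s, (f l).coeff n :=
  map_sum (HahnSeries.coeff.addMonoidHom n) f s

theorem mode_one (b : LatticeSpace) (n : ℤ) :
    vertexOps.mode 1 n b = if n = -1 then b else 0 := by
  rw [mode_apply, field_one, coeff_constant]
  exact if_congr (by omega) rfl rfl

/-! ## The modes of the bosons -/

/-- The field recursion at `a = 1`. Negative modes multiply by bosons, the mode `k` is a multiple of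
the charge, the mode `k + l + 1` is a multiple of `∂/∂X_l`, and the modes in `[0, k)` vanish. -/
theorem mode_boson (k : ℕ) (b : LatticeSpace) : ∃ M : ℕ, ∀ K, M ≤ K → ∀ n,
    vertexOps.mode (boson k) n b = (taylor (boson k)).coeff (-n - 1) * b +
      (∑ l ∈ Finset.range K, ((-1 : ℂ) ^ k * ((k + l + 1).factorial : ℂ)) •
        (if n = k + l + 1 then pd l b else 0) +
      ((-1 : ℂ) ^ k * (k.factorial : ℂ)) • (if n = k then charge b else 0)) := by
  obtain ⟨M, hM⟩ := field_boson_mul k b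
  refine ⟨M, fun K hK n => ?_⟩
  have h := hM K hK 1
  rw [mul_one] at h
  rw [mode_apply, h, HahnSeries.coeff_add, HahnSeries.coeff_add, coeff_sum, field_one,
    coeff_mul_constant, HahnSeries.coeff_smul, coeff_zpow_mul, field_one, coeff_constant]
  refine congr_arg₂ _ rfl (congr_arg₂ _ (Finset.sum_congr rfl fun l _ => ?_) ?_)
  · rw [HahnSeries.coeff_smul, coeff_zpow_mul, field_one, coeff_constant]
    congr 1
    exact if_congr (by omega) rfl rfl
  · congr 1
    exact if_congr (by omega) rfl rfl

theorem mode_boson_neg (k s : ℕ) (b : LatticeSpace) :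
    vertexOps.mode (boson k) (-1 - s) b = ((s.factorial : ℂ)⁻¹) • (boson (k + s) * b) := by
  obtain ⟨M, hM⟩ := mode_boson k b
  rw [hM M le_rfl, show -(-1 - (s : ℤ)) - 1 = s by ring, coeff_taylor_boson, smul_mul_assoc,
    Finset.sum_eq_zero, if_neg (by omega), smul_zero, add_zero, add_zero]
  intro l _
  rw [if_neg (by omega), smul_zero]

theorem mode_boson_lt (k : ℕ) {n : ℤ} (h0 : 0 ≤ n) (hn : n < k) (b : LatticeSpace) :
    vertexOps.mode (boson k) n b = 0 := by
  obtain ⟨M, hM⟩ := mode_boson k b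
  rw [hM M le_rfl, coeff_taylor_of_neg _ (by omega), zero_mul,
    Finset.sum_eq_zero, if_neg (by omega), smul_zero, add_zero, add_zero]
  intro l _
  rw [if_neg (by omega), smul_zero]

theorem mode_boson_self (k : ℕ) (b : LatticeSpace) :
    vertexOps.mode (boson k) k b = ((-1 : ℂ) ^ k * (k.factorial : ℂ)) • charge b := by
  obtain ⟨M, hM⟩ := mode_boson k b
  rw [hM M le_rfl, coeff_taylor_of_neg _ (by omega), zero_mul,
    Finset.sum_eq_zero, if_pos rfl, zero_add, zero_add]
  intro l _
  rw [if_neg (by omega), smul_zero]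

theorem mode_boson_pos (k l : ℕ) (b : LatticeSpace) : vertexOps.mode (boson k) (k + l + 1) b =
    ((-1 : ℂ) ^ k * ((k + l + 1).factorial : ℂ)) • pd l b := by
  obtain ⟨M, hM⟩ := mode_boson k b
  rw [hM (max M (l + 1)) (le_max_left _ _), coeff_taylor_of_neg _ (by omega), zero_mul, zero_add,
    Finset.sum_eq_single l, if_pos rfl, if_neg (by omega), smul_zero, add_zero]
  · intro l' _ hl'
    rw [if_neg (by omega), smul_zero]
  · intro h
    exact absurd (Finset.mem_range.mpr (lt_of_lt_of_le (Nat.lt_succ_self l) (le_max_right _ _))) h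

/-- The field of `∂^(1+k) φ_γ a` is the normally ordered product of the fields. -/
theorem mode_boson_mul (k : ℕ) (a : LatticeSpace) :
    vertexOps.mode (boson k * a) = normalProd 1 (vertexOps.mode (boson k)) (vertexOps.mode a)
      (vertexOps.isField_mode _) (vertexOps.isField_mode _) 0 := by
  funext j
  refine LinearMap.ext fun b => ?_
  obtain ⟨M, hM⟩ := field_boson_mul k b
  obtain ⟨M', hM'⟩ := pd_eventually_zero b
  obtain ⟨N, hN⟩ := vertexOps.isField_mode a b
  set K := max M M'
  have hb : ∀ n : ℤ, ((k + 1 + K : ℕ) : ℤ) ≤ n → vertexOps.mode (boson k) n b = 0 := by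
    intro n hn
    obtain ⟨l, rfl⟩ : ∃ l : ℕ, n = k + l + 1 := ⟨(n - k - 1).toNat, by omega⟩
    have := le_max_right M M'
    rw [mode_boson_pos, hM' l (by omega), smul_zero]
  rw [normalProd, LinearMap.add_apply, LinearMap.smul_apply, one_smul,
    half_eq_sum _ 0 j b hN (Int.self_le_toNat (N - j)),
    half_eq_sum _ j 0 b hb (K := k + 1 + K) (by rw [sub_zero]), mode_apply,
    hM K (le_max_left _ _), HahnSeries.coeff_add, taylor_apply,
    coeff_ofPowerSeries_mul _ _ _ (N - j).toNat]
  · refine congr_arg₂ _ (Finset.sum_congr rfl fun l _ => ?_) ?_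
    · rw [zero_sub, mode_boson_neg, mode_apply, PowerSeries.coeff_mk, partialD_pow_boson,
        smul_mul_assoc]
      rw [show -j - 1 - (l : ℤ) = -(j + l) - 1 by ring]
    -- The annihilation modes are sorted into the range `[0, k)`, where they vanish, the index `k`,
    -- which gives the charge term, and the indices `k + 1 + l`, which give the partial derivatives.
    · rw [Finset.sum_range_add, Finset.sum_range_succ, HahnSeries.coeff_add, coeff_sum,
        Finset.sum_eq_zero (s := Finset.range k), zero_add, zero_add, mode_boson_self, add_comm]
      · refine congr_arg₂ _ ?_ (Finset.sum_congr rfl fun l _ => ?_)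
        · rw [HahnSeries.coeff_smul, coeff_zpow_mul, map_smul, mode_apply]
          congr 2; ring
        · rw [HahnSeries.coeff_smul, coeff_zpow_mul]
          have e : (0 : ℤ) + ((k + 1 + l : ℕ) : ℤ) = k + l + 1 := by push_cast; ring
          rw [e, mode_boson_pos, map_smul, mode_apply]
          congr 2; push_cast; ring
      · intro l hl
        rw [mode_boson_lt k (by omega) (by have := Finset.mem_range.mp hl; omega), map_zero]
  · intro i hi
    have := hN (-i - 1) (by omega)
    rw [mode_apply, show -(-i - 1) - 1 = i by ring] at this
    exact this

/-- Checked on the explicit modes, since the axioms are not yet available. It reduces every boson to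
the Heisenberg field of `boson 0`. -/
theorem mode_boson_succ (k : ℕ) (n : ℤ) :
    vertexOps.mode (boson (k + 1)) n = -(n : ℂ) • vertexOps.mode (boson k) (n - 1) := by
  refine LinearMap.ext fun b => ?_
  rw [LinearMap.smul_apply]
  rcases lt_or_ge n 0 with hn | hn
  · obtain ⟨s, rfl⟩ : ∃ s : ℕ, n = -1 - s := ⟨(-1 - n).toNat, by omega⟩
    rw [mode_boson_neg, show (-1 : ℤ) - s - 1 = -1 - (s + 1 : ℕ) by push_cast; ring, mode_boson_neg,
      smul_smul, add_right_comm, add_assoc]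
    congr 1
    have h0 : ((s : ℂ) + 1) ≠ 0 := Nat.cast_add_one_ne_zero s
    have h1 : (s.factorial : ℂ) ≠ 0 := Nat.cast_ne_zero.mpr s.factorial_ne_zero
    rw [Nat.factorial_succ]
    push_cast
    field_simp
    ring
  rcases lt_trichotomy n ((k + 1 : ℕ) : ℤ) with h | rfl | h
  · rw [mode_boson_lt _ hn h]
    rcases hn.eq_or_lt with rfl | hn
    · simp
    · rw [mode_boson_lt k (by omega) (by push_cast at h; omega), smul_zero]
  · rw [mode_boson_self, show ((k + 1 : ℕ) : ℤ) - 1 = k by push_cast; ring, mode_boson_self, smul_smul]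
    congr 1
    rw [Nat.factorial_succ]
    push_cast
    ring
  · obtain ⟨l, rfl⟩ : ∃ l : ℕ, n = (k + 1 : ℕ) + l + 1 := ⟨(n - (k + 1 : ℕ) - 1).toNat, by omega⟩
    rw [mode_boson_pos, show ((k + 1 : ℕ) : ℤ) + l + 1 - 1 = k + l + 1 by push_cast; ring,
      mode_boson_pos, smul_smul]
    congr 1
    rw [show k + 1 + l + 1 = (k + l + 1) + 1 by ring, Nat.factorial_succ]
    push_cast
    ring

/-! ## The Heisenberg algebra -/

theorem heis_neg (s : ℕ) (b : LatticeSpace) :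
    vertexOps.mode (boson 0) (-1 - s) b = ((s.factorial : ℂ)⁻¹) • (boson s * b) := by
  rw [mode_boson_neg, zero_add]

theorem heis_zero (b : LatticeSpace) : vertexOps.mode (boson 0) 0 b = charge b := by
  have := mode_boson_self 0 b
  simpa using this

theorem heis_pos (l : ℕ) (b : LatticeSpace) :
    vertexOps.mode (boson 0) (l + 1) b = ((l + 1).factorial : ℂ) • pd l b := by
  have := mode_boson_pos 0 l b
  simpa using this

theorem int_cases (n : ℤ) : (∃ s : ℕ, n = -1 - s) ∨ n = 0 ∨ ∃ l : ℕ, n = l + 1 := by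
  rcases lt_trichotomy n 0 with h | h | h
  · exact Or.inl ⟨(-1 - n).toNat, by omega⟩
  · exact Or.inr (Or.inl h)
  · exact Or.inr (Or.inr ⟨(n - 1).toNat, by omega⟩)

theorem heis_boson_mul (i : ℤ) (k : ℕ) (b : LatticeSpace) :
    vertexOps.mode (boson 0) i (boson k * b) = boson k * vertexOps.mode (boson 0) i b +
      (if i = k + 1 then ((k + 1).factorial : ℂ) else 0) • b := by
  rcases int_cases i with ⟨s, rfl⟩ | rfl | ⟨l, rfl⟩
  · rw [heis_neg, heis_neg, if_neg (by omega), zero_smul, add_zero, mul_smul_comm, mul_left_comm]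
  · rw [heis_zero, heis_zero, if_neg (by omega), zero_smul, add_zero, charge_boson_mul]
  · rw [heis_pos, heis_pos, pd_boson_mul, smul_add, mul_smul_comm, add_comm]
    congr 1
    by_cases h : k = l
    · subst h; simp
    · rw [if_neg h, if_neg (by omega), smul_zero, zero_smul]

theorem heis_expo (i : ℤ) (hi : 0 ≤ i) (m : ℤ) :
    vertexOps.mode (boson 0) i (expo m) = if i = 0 then (m : ℂ) • expo m else 0 := by
  rcases int_cases i with ⟨s, rfl⟩ | rfl | ⟨l, rfl⟩
  · omega
  · rw [heis_zero, charge_expo, if_pos rfl]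
  · rw [heis_pos, pd_expo, smul_zero, if_neg (by omega)]

/-- A negative mode is multiplication by a boson, so if one of the indices is negative the relation
is `heis_boson_mul`; nonnegative modes act by partial derivatives and the charge, which commute. -/
theorem heis_heis (i j : ℤ) (b : LatticeSpace) :
    vertexOps.mode (boson 0) i (vertexOps.mode (boson 0) j b) -
      vertexOps.mode (boson 0) j (vertexOps.mode (boson 0) i b) =
      if i + j = 0 then (i : ℂ) • b else 0 := by
  have hneg : ∀ (i : ℤ) (s : ℕ) (b : LatticeSpace),
      vertexOps.mode (boson 0) i (vertexOps.mode (boson 0) (-1 - s) b) -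
        vertexOps.mode (boson 0) (-1 - s) (vertexOps.mode (boson 0) i b) =
        if i + (-1 - s) = 0 then (i : ℂ) • b else 0 := by
    intro i s b
    rw [heis_neg, heis_neg, map_smul, heis_boson_mul, smul_add, add_sub_cancel_left]
    by_cases h : i = s + 1
    · subst h
      have h1 : (s.factorial : ℂ) ≠ 0 := Nat.cast_ne_zero.mpr s.factorial_ne_zero
      rw [if_pos rfl, if_pos (by ring), smul_smul, Nat.factorial_succ]
      congr 1
      push_cast
      field_simp
    · rw [if_neg h, if_neg (by omega), zero_smul, smul_zero]
  rcases lt_or_ge j 0 with hj | hj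
  · obtain ⟨s, rfl⟩ : ∃ s : ℕ, j = -1 - s := ⟨(-1 - j).toNat, by omega⟩
    exact hneg i s b
  rcases lt_or_ge i 0 with hi | hi
  · obtain ⟨s, rfl⟩ : ∃ s : ℕ, i = -1 - s := ⟨(-1 - i).toNat, by omega⟩
    rw [← neg_sub, hneg]
    by_cases h : j + (-1 - (s : ℤ)) = 0
    · rw [if_pos h, if_pos (by omega), ← neg_smul]
      congr 1
      obtain rfl : j = 1 + s := by omega
      push_cast; ring
    · rw [if_neg h, if_neg (by omega), neg_zero]
  -- For nonnegative indices `i + j = 0` forces `i = 0`, and the coefficient `i` vanishes.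
  · have h0 : (if i + j = 0 then (i : ℂ) • b else 0) = 0 := by
      split_ifs with h
      · obtain rfl : i = 0 := by omega
        simp
      · rfl
    rw [h0, sub_eq_zero]
    refine LinearMap.congr_fun (f := vertexOps.mode (boson 0) i * vertexOps.mode (boson 0) j)
      (g := vertexOps.mode (boson 0) j * vertexOps.mode (boson 0) i)
      (eq_of_boson_mul (fun m => ?_) fun k a ha => ?_) b
    · rw [Module.End.mul_apply, Module.End.mul_apply, heis_expo i hi, heis_expo j hj]
      split_ifs with h1 h2 h2
      · rw [h1, h2]
      · rw [map_zero, map_smul, heis_expo i hi, if_neg h2, smul_zero]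
      · rw [map_zero, map_smul, heis_expo j hj, if_neg h1, smul_zero]
      · rw [map_zero, map_zero]
    · rw [Module.End.mul_apply, Module.End.mul_apply] at ha ⊢
      rw [heis_boson_mul, map_add, map_smul, heis_boson_mul, ha, heis_boson_mul, map_add, map_smul,
        heis_boson_mul]
      abel

end LatticeVA

/-! ### Covariance and locality of the Heisenberg field. -/

namespace LatticeVA

open MvPolynomial FormalModes VertexOps

/-- Negative modes multiply by bosons and obey the Leibniz rule. For the others the identity is
checked on exponentials and propagated through multiplication by bosons. -/
theorem heis_covariant : IsCovariant partialD (vertexOps.mode (boson 0)) := by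
  intro i
  rcases lt_or_ge i 0 with hi | hi
  · obtain ⟨s, rfl⟩ : ∃ s : ℕ, i = -1 - s := ⟨(-1 - i).toNat, by omega⟩
    refine LinearMap.ext fun b => ?_
    rw [LinearMap.sub_apply, Module.End.mul_apply, Module.End.mul_apply, LinearMap.smul_apply,
      heis_neg, heis_neg, map_smul, partialD_boson_mul, smul_add, add_sub_cancel_right,
      show (-1 : ℤ) - s - 1 = -1 - (s + 1 : ℕ) by push_cast; ring, heis_neg, smul_smul]
    congr 1
    have h0 : ((s : ℂ) + 1) ≠ 0 := Nat.cast_add_one_ne_zero s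
    have h1 : (s.factorial : ℂ) ≠ 0 := Nat.cast_ne_zero.mpr s.factorial_ne_zero
    rw [Nat.factorial_succ]
    push_cast
    field_simp
    ring
  · refine eq_of_boson_mul (fun m => ?_) fun k a ha => ?_
    · rw [LinearMap.sub_apply, Module.End.mul_apply, Module.End.mul_apply, LinearMap.smul_apply,
        heis_expo i hi, partialD_expo, map_smul, heis_boson_mul, heis_expo i hi]
      rcases hi.eq_or_lt with rfl | hi
      · simp [partialD_expo]
      · rw [heis_expo (i - 1) (by omega), if_neg hi.ne', map_zero, mul_zero]
        by_cases h : i = 1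
        · subst h; simp
        · rw [if_neg (show ¬ i = ((0 : ℕ) : ℤ) + 1 by simpa using h),
            if_neg (show ¬ i - 1 = 0 by omega)]
          simp
    · rw [LinearMap.sub_apply, Module.End.mul_apply, Module.End.mul_apply, LinearMap.smul_apply]
        at ha ⊢
      have ha' : partialD (vertexOps.mode (boson 0) i a) =
          -(i : ℂ) • vertexOps.mode (boson 0) (i - 1) a +
            vertexOps.mode (boson 0) i (partialD a) := by rw [← ha]; abel
      rw [heis_boson_mul, map_add, partialD_boson_mul, map_smul, partialD_boson_mul, map_add,
        heis_boson_mul, heis_boson_mul, heis_boson_mul, ha', mul_add, mul_smul_comm]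
      by_cases h : i = k + 2
      · subst h
        rw [if_neg (by omega), if_pos (by push_cast; ring), if_pos (by ring),
          Nat.factorial_succ (k + 1)]
        push_cast
        module
      · rw [if_neg (show ¬ i = ((k + 1 : ℕ) : ℤ) + 1 by push_cast; omega),
          if_neg (show ¬ i - 1 = (k : ℤ) + 1 by omega)]
        module

/-- The commutator is supported on one antidiagonal, with coefficient affine in `i`; second
differences kill it. -/
theorem isLocal_heis_heis :
    LocalOrder 1 2 (vertexOps.mode (boson 0)) (vertexOps.mode (boson 0)) := by
  rw [localOrder_iff]
  intro v
  funext i j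
  simp only [one_smul, heis_heis]
  change (dif (dif fun i j : ℤ => if i + j = 0 then (i : ℂ) • v else 0)) i j = 0
  simp only [dif_apply]
  by_cases h : i + j + 2 = 0
  · rw [if_pos (by omega), if_pos (by omega), if_pos (by omega)]
    push_cast
    module
  · rw [if_neg (by omega), if_neg (by omega), if_neg (by omega)]
    simp

/-! ## The modes of the exponentials -/

theorem partialD_expoCoeff (m q : ℤ) :
    partialD (expoCoeff m q) = ((q : ℂ) + 1) • expoCoeff m (q + 1) := by
  rcases lt_or_ge q 0 with hq | hq
  · rw [expoCoeff, coeff_taylor_of_neg _ hq, map_zero]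
    rcases (show q ≤ -1 by omega).eq_or_lt with rfl | hq
    · simp
    · rw [expoCoeff, coeff_taylor_of_neg _ (by omega), smul_zero]
  · lift q to ℕ using hq
    rw [expoCoeff, expoCoeff, coeff_taylor, show (q : ℤ) + 1 = (q + 1 : ℕ) by push_cast; rfl,
      coeff_taylor, map_smul, pow_succ', Module.End.mul_apply, smul_smul]
    congr 1
    have h0 : ((q : ℂ) + 1) ≠ 0 := Nat.cast_add_one_ne_zero q
    have h1 : (q.factorial : ℂ) ≠ 0 := Nat.cast_ne_zero.mpr q.factorial_ne_zero
    rw [Nat.factorial_succ]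
    push_cast
    field_simp

theorem expoCoeff_zero (m : ℤ) : expoCoeff m 0 = expo m := by
  have := coeff_taylor (expo m) 0
  simpa [expoCoeff] using this

theorem expoCoeff_of_neg (m : ℤ) {q : ℤ} (hq : q < 0) : expoCoeff m q = 0 :=
  coeff_taylor_of_neg _ hq

/-- In generating form, `h_i e^(z∂)e^(φ_(mγ)) = m z^i e^(z∂)e^(φ_(mγ))` for `i ≥ 0`. Covariance
carries the claim from each power of `z` to the next. -/
theorem heis_expoCoeff (m : ℤ) {i : ℤ} (hi : 0 ≤ i) (q : ℤ) :
    vertexOps.mode (boson 0) i (expoCoeff m q) = (m : ℂ) • expoCoeff m (q - i) := by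
  rcases lt_or_ge q 0 with hq | hq
  · rw [expoCoeff_of_neg m hq, expoCoeff_of_neg m (by omega), map_zero, smul_zero]
  lift q to ℕ using hq
  induction q generalizing i with
  | zero =>
    rw [Nat.cast_zero, expoCoeff_zero, heis_expo i hi]
    split_ifs with h
    · subst h; rw [sub_zero, expoCoeff_zero]
    · rw [expoCoeff_of_neg m (by omega), smul_zero]
  | succ q ih =>
    have h0 : ((q : ℂ) + 1) ≠ 0 := Nat.cast_add_one_ne_zero q
    refine smul_right_injective _ h0 ?_
    change ((q : ℂ) + 1) • _ = ((q : ℂ) + 1) • _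
    have h1 := partialD_expoCoeff m q
    rw [Int.cast_natCast] at h1
    rw [Nat.cast_succ, ← map_smul, ← h1]
    have h2 := LinearMap.congr_fun (heis_covariant i) (expoCoeff m q)
    rw [LinearMap.sub_apply, Module.End.mul_apply, Module.End.mul_apply, LinearMap.smul_apply,
      sub_eq_iff_eq_add, ← sub_eq_iff_eq_add', ih hi, map_smul, partialD_expoCoeff] at h2
    rw [← h2, show (q : ℤ) + 1 - i = q - i + 1 by ring]
    rcases hi.eq_or_lt with rfl | hi
    · push_cast; module
    · rw [ih (by omega), show (q : ℤ) - (i - 1) = q - i + 1 by ring]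
      push_cast; module

theorem heis_mul_expo {i : ℤ} (hi : 0 ≤ i) (x : LatticeSpace) (r : ℤ) :
    vertexOps.mode (boson 0) i (x * expo r) = vertexOps.mode (boson 0) i x * expo r +
      (if i = 0 then (r : ℂ) else 0) • (x * expo r) := by
  refine LinearMap.congr_fun (f := vertexOps.mode (boson 0) i ∘ₗ LinearMap.mulRight ℂ (expo r))
    (g := LinearMap.mulRight ℂ (expo r) ∘ₗ vertexOps.mode (boson 0) i +
      (if i = 0 then (r : ℂ) else 0) • LinearMap.mulRight ℂ (expo r))
    (eq_of_boson_mul (fun m => ?_) fun k a ha => ?_) x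
  · change vertexOps.mode (boson 0) i (expo m * expo r) =
      vertexOps.mode (boson 0) i (expo m) * expo r + (if i = 0 then (r : ℂ) else 0) •
        (expo m * expo r)
    rw [expo_mul_expo, heis_expo i hi, heis_expo i hi]
    split_ifs
    · rw [smul_mul_assoc, expo_mul_expo, ← add_smul]; push_cast; rfl
    · simp
  · change vertexOps.mode (boson 0) i (a * expo r) =
      vertexOps.mode (boson 0) i a * expo r + (if i = 0 then (r : ℂ) else 0) • (a * expo r) at ha
    change vertexOps.mode (boson 0) i (boson k * a * expo r) =
      vertexOps.mode (boson 0) i (boson k * a) * expo r +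
        (if i = 0 then (r : ℂ) else 0) • (boson k * a * expo r)
    rw [mul_assoc, heis_boson_mul, heis_boson_mul, ha, mul_add, add_mul, mul_assoc, mul_smul_comm,
      smul_mul_assoc]
    abel

theorem series_mul_sub (f g h : LaurentSeries LatticeSpace) : f * (g - h) = f * g - f * h :=
  mul_sub f g h

/-- The substitution rule of `expoPairing_boson_mul` in modes. Together with `mode_expo_mul_expo` it
reduces identities between modes of exponentials to the vacuum vector. -/
theorem mode_expo_boson_mul (m n : ℤ) (k : ℕ) (b : LatticeSpace) :
    vertexOps.mode (expo m) n (boson k * b) = boson k * vertexOps.mode (expo m) n b -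
      ((m : ℂ) * (k.factorial : ℂ)) • vertexOps.mode (expo m) (n - 1 - k) b := by
  rw [mode_apply, mode_apply, mode_apply, field_expo, expoPairing_boson_mul, series_sub_mul,
    series_mul_sub, smul_mul_assoc, mul_smul_comm, series_mul_left_comm, series_mul_left_comm _ (zpow _),
    ← field_expo, HahnSeries.coeff_sub, coeff_constant_mul, HahnSeries.coeff_smul, coeff_zpow_mul]
  congr 3; ring

theorem expoPairing_mul_expo (m r : ℤ) (x : LatticeSpace) :
    expoPairing m (x * expo r) = zpow (m * r) * (expoPairing m x * constant (expo r)) := by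
  suffices h : expoPairing m ∘ₗ LinearMap.mulRight ℂ (expo r) =
      LinearMap.mulLeft ℂ (zpow (m * r)) ∘ₗ LinearMap.mulRight ℂ (constant (expo r)) ∘ₗ
        expoPairing m from LinearMap.congr_fun h x
  refine eq_of_boson_mul (W := LaurentSeries LatticeSpace) (fun n => ?_) fun k a ha => ?_
  · change expoPairing m (expo n * expo r) =
      zpow (m * r) * (expoPairing m (expo n) * constant (expo r))
    rw [expo_mul_expo, expoPairing_expo, expoPairing_expo, ← expo_mul_expo, constant_mul, mul_add,
      ← zpow_mul_zpow]
    ring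
  · change expoPairing m (a * expo r) = zpow (m * r) * (expoPairing m a * constant (expo r)) at ha
    change expoPairing m (boson k * a * expo r) =
      zpow (m * r) * (expoPairing m (boson k * a) * constant (expo r))
    rw [mul_assoc, expoPairing_boson_mul, expoPairing_boson_mul, ha, series_mul_left_comm, mul_assoc]

/-- Multiplication by `e^(φ_(rγ))` enters the pairing only through the factor `z^(mr)`, which shifts
the mode. -/
theorem mode_expo_mul_expo (m n r : ℤ) (x : LatticeSpace) :
    vertexOps.mode (expo m) n (x * expo r) = vertexOps.mode (expo m) (n + m * r) x * expo r := by
  rw [mode_apply, mode_apply, field_expo, expoPairing_mul_expo, series_mul_left_comm,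
    coeff_zpow_mul, ← mul_assoc, coeff_mul_constant, ← field_expo]
  congr 2; ring

theorem mode_expo_one (m n : ℤ) : vertexOps.mode (expo m) n 1 = expoCoeff m (-n - 1) := by
  rw [mode_apply, field_expo, expoPairing_one, mul_one, expoCoeff]

theorem mode_expo_expo (m n r : ℤ) :
    vertexOps.mode (expo m) n (expo r) = expoCoeff m (-(n + m * r) - 1) * expo r := by
  have := mode_expo_mul_expo m n r 1
  rwa [one_mul, mode_expo_one] at this

/-- For `i < 0` this is `mode_expo_boson_mul` rearranged. For `i ≥ 0` it holds on exponentials by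
`heis_expoCoeff` and spreads by the boson recursion, for all `n` at once because that recursion
shifts `n`. -/
theorem heis_mode_expo (i m n : ℤ) (b : LatticeSpace) :
    vertexOps.mode (boson 0) i (vertexOps.mode (expo m) n b) -
      vertexOps.mode (expo m) n (vertexOps.mode (boson 0) i b) =
      (m : ℂ) • vertexOps.mode (expo m) (i + n) b := by
  rcases lt_or_ge i 0 with hi | hi
  · obtain ⟨s, rfl⟩ : ∃ s : ℕ, i = -1 - s := ⟨(-1 - i).toNat, by omega⟩
    have h1 : (s.factorial : ℂ) ≠ 0 := Nat.cast_ne_zero.mpr s.factorial_ne_zero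
    rw [heis_neg, heis_neg, map_smul, mode_expo_boson_mul, ← smul_sub, sub_sub_cancel, smul_smul]
    congr 1
    · field_simp
    · congr 2; ring
  · suffices h : ∀ n, vertexOps.mode (boson 0) i * vertexOps.mode (expo m) n -
        vertexOps.mode (expo m) n * vertexOps.mode (boson 0) i =
        (m : ℂ) • vertexOps.mode (expo m) (i + n) from LinearMap.congr_fun (h n) b
    intro n
    refine LinearMap.ext fun b => ?_
    rw [LinearMap.sub_apply, Module.End.mul_apply, Module.End.mul_apply, LinearMap.smul_apply]
    induction b using boson_induction generalizing n with
    | hadd a b ha hb => simp only [map_add, smul_add, ← ha, ← hb]; abel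
    | hsmul c a ha => simp only [map_smul, smul_comm (m : ℂ) c, ← ha, smul_sub]
    | hexpo r =>
      rw [mode_expo_expo, heis_mul_expo hi, heis_expoCoeff m hi, heis_expo i hi, mode_expo_expo,
        smul_mul_assoc, show -(n + m * r) - 1 - i = -(i + n + m * r) - 1 by ring]
      split_ifs
      · rw [map_smul, mode_expo_expo]; abel
      · simp
    | hboson k a ha =>
      have h1 : ∀ n, vertexOps.mode (boson 0) i (vertexOps.mode (expo m) n a) =
          (m : ℂ) • vertexOps.mode (expo m) (i + n) a +
            vertexOps.mode (expo m) n (vertexOps.mode (boson 0) i a) := fun n => by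
        rw [← ha]; abel
      rw [mode_expo_boson_mul, map_sub, heis_boson_mul, map_smul, h1, h1, heis_boson_mul, map_add,
        map_smul, mode_expo_boson_mul, mode_expo_boson_mul, mul_add, mul_smul_comm,
        show i + (n - 1 - k) = i + n - 1 - k by ring]
      module

/-- The commutator depends on `i + j` only, so one factor `z - w` kills it. -/
theorem isLocal_heis_expo (m : ℤ) :
    LocalOrder 1 1 (vertexOps.mode (boson 0)) (vertexOps.mode (expo m)) := by
  rw [localOrder_iff]
  intro v
  funext i j
  simp only [one_smul, heis_mode_expo, pow_one]
  rw [dif_apply, show i + 1 + j = i + (j + 1) by ring, sub_self]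
  rfl

theorem isLocal_boson {k : ℕ} {ε : ℂ} {c : ℤ → Module.End ℂ LatticeSpace}
    (h : IsLocal ε (vertexOps.mode (boson 0)) c) : IsLocal ε (vertexOps.mode (boson k)) c := by
  induction k with
  | zero => exact h
  | succ k ih => exact ih.deriv (mode_boson_succ k)

end LatticeVA

/-! ### The pairing with an exponential as a Laurent series. -/

namespace LatticeVA

open MvPolynomial FormalModes VertexOps

theorem coeff_expoPairing_expo (m r p : ℤ) :
    (expoPairing m (expo r)).coeff p = if p = m * r then expo r else 0 := by
  rw [expoPairing_expo, coeff_constant_mul, zpow]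
  split_ifs with h
  · rw [h, HahnSeries.coeff_single_same, mul_one]
  · rw [HahnSeries.coeff_single_of_ne h, mul_zero]

theorem coeff_expoPairing_boson_mul (m : ℤ) (k : ℕ) (x : LatticeSpace) (p : ℤ) :
    (expoPairing m (boson k * x)).coeff p = boson k * (expoPairing m x).coeff p -
      ((m : ℂ) * (k.factorial : ℂ)) • (expoPairing m x).coeff (p + 1 + k) := by
  rw [expoPairing_boson_mul, series_sub_mul, HahnSeries.coeff_sub, coeff_constant_mul,
    smul_mul_assoc, HahnSeries.coeff_smul, coeff_zpow_mul]
  congr 3; ring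

/-- Coefficientwise form of `⟨e^(φ_(mγ)), ∂x⟩ = -d/dz ⟨e^(φ_(mγ)), x⟩`: on `∂x` the map `expoPairing
m` equals `∂ - ∂_z` applied to its value on `x`. -/
theorem coeff_expoPairing_partialD (m : ℤ) (x : LatticeSpace) (p : ℤ) :
    (expoPairing m (partialD x)).coeff p = partialD ((expoPairing m x).coeff p) -
      ((p : ℂ) + 1) • (expoPairing m x).coeff (p + 1) := by
  induction x using boson_induction generalizing p with
  | hadd a b ha hb =>
    simp only [map_add, HahnSeries.coeff_add, ha, hb, smul_add]; abel
  | hsmul c a ha =>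
    simp only [map_smul, HahnSeries.coeff_smul, ha, smul_sub]
    rw [smul_comm c]
  | hexpo r =>
    rw [partialD_expo, map_smul, HahnSeries.coeff_smul, coeff_expoPairing_boson_mul,
      coeff_expoPairing_expo, coeff_expoPairing_expo, coeff_expoPairing_expo, Nat.cast_zero, add_zero]
    by_cases h1 : p = m * r
    · rw [if_pos h1, if_neg (by omega), partialD_expo]
      simp
    · rw [if_neg h1]
      by_cases h2 : p + 1 = m * r
      · rw [if_pos h2]
        have h3 : (p : ℂ) + 1 = m * r := by exact_mod_cast congr_arg (fun z : ℤ => (z : ℂ)) h2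
        rw [h3, mul_zero, zero_sub, map_zero, zero_sub, smul_neg, smul_smul]
        simp [mul_comm]
      · rw [if_neg h2]; simp
  | hboson k a ha =>
    rw [partialD_boson_mul, map_add, HahnSeries.coeff_add, coeff_expoPairing_boson_mul,
      coeff_expoPairing_boson_mul, coeff_expoPairing_boson_mul, coeff_expoPairing_boson_mul, ha, ha,
      map_sub, partialD_boson_mul, map_smul, mul_sub, mul_smul_comm, Nat.factorial_succ,
      show p + 1 + ((k + 1 : ℕ) : ℤ) = p + 1 + 1 + k by push_cast; ring,
      show p + 1 + k + 1 = p + 1 + 1 + (k : ℤ) by ring]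
    push_cast
    module

/-! ## A differential equation for two-variable distributions -/

/-- The operator `∂ - ∂_z - ∂_w`. -/
def odeOp : Module.End ℂ (ℤ → ℤ → LatticeSpace) where
  toFun f i j := partialD (f i j) + (i : ℂ) • f (i - 1) j + (j : ℂ) • f i (j - 1)
  map_add' f g := by
    funext i j
    simp only [Pi.add_apply, map_add, smul_add]
    abel
  map_smul' c f := by
    funext i j
    simp only [Pi.smul_apply, map_smul, RingHom.id_apply, smul_add]
    rw [smul_comm c, smul_comm c]

theorem odeOp_apply (f : ℤ → ℤ → LatticeSpace) (i j : ℤ) :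
    odeOp f i j = partialD (f i j) + (i : ℂ) • f (i - 1) j + (j : ℂ) • f i (j - 1) := rfl

theorem commute_odeOp_dif : Commute odeOp dif := by
  refine LinearMap.ext fun f => ?_
  funext i j
  simp only [Module.End.mul_apply, odeOp_apply, dif_apply, map_sub, sub_add_cancel,
    add_sub_cancel_right]
  push_cast
  module

theorem odeOp_dif_pow {f : ℤ → ℤ → LatticeSpace} (hf : odeOp f = 0) (r : ℕ) :
    odeOp ((dif ^ r) f) = 0 := by
  rw [← Module.End.mul_apply, (commute_odeOp_dif.pow_right r).eq, Module.End.mul_apply, hf, map_zero]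

/-- For distributions with no negative powers of `w`, setting `w = 0` turns `(z - w)^r` into `z^r`.
-/
theorem dif_pow_of_bounded {f : ℤ → ℤ → LatticeSpace} (hf : ∀ i j, 0 ≤ j → f i j = 0) (r : ℕ) :
    (∀ i j, 0 ≤ j → (dif ^ r) f i j = 0) ∧ ∀ i, (dif ^ r) f i (-1) = f (i + r) (-1) := by
  induction r with
  | zero => exact ⟨hf, fun i => by simp⟩
  | succ r ih =>
    rw [pow_succ', Module.End.mul_apply]
    refine ⟨fun i j hj => ?_, fun i => ?_⟩
    · rw [dif_apply, ih.1 _ _ hj, ih.1 _ _ (by omega), sub_zero]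
    · rw [dif_apply, ih.1 i (-1 + 1) (by omega), sub_zero, ih.2]
      congr 1; push_cast; ring

/-- The equation expresses `j f i (j - 1)` by coefficients at second index `j`, and `j ≠ 0` for
negative `j`. A solution that is a power series in `w` is thus determined by its value at `w = 0`.
-/
theorem eq_of_odeOp {f g : ℤ → ℤ → LatticeSpace} (hf : odeOp f = 0) (hg : odeOp g = 0)
    (hf0 : ∀ i j, 0 ≤ j → f i j = 0) (hg0 : ∀ i j, 0 ≤ j → g i j = 0)
    (h : ∀ i, f i (-1) = g i (-1)) : f = g := by
  have key : ∀ (s : ℕ) (i : ℤ), f i (-1 - s) = g i (-1 - s) := by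
    intro s
    induction s with
    | zero => simpa using h
    | succ s ih =>
      intro i
      have h1 := congr_fun (congr_fun hf i) (-1 - s)
      have h2 := congr_fun (congr_fun hg i) (-1 - s)
      rw [← h2, odeOp_apply, odeOp_apply, ih, ih, add_right_inj,
        show (-1 : ℤ) - s - 1 = -1 - (s + 1 : ℕ) by push_cast; ring] at h1
      have h0 : ((-1 - (s : ℤ) : ℤ) : ℂ) ≠ 0 := Int.cast_ne_zero.mpr (by omega)
      exact smul_right_injective _ h0 h1
  funext i j
  rcases lt_or_ge j 0 with hj | hj
  · have := key (-1 - j).toNat i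
    rwa [show (-1 : ℤ) - (-1 - j).toNat = j by omega] at this
  · rw [hf0 i j hj, hg0 i j hj]

/-! ## Locality of the exponentials -/

theorem series_smul_sub (c : ℂ) (f g : LaurentSeries LatticeSpace) : c • (f - g) = c • f - c • g :=
  smul_sub c f g

/-- Multiplication by `z - w` on distributions that are Laurent series in `z`. -/
def difSeries : Module.End ℂ (ℤ → LaurentSeries LatticeSpace) where
  toFun Q j := zpow 1 * Q j - Q (j + 1)
  map_add' Q R := by
    funext j
    simp only [Pi.add_apply, mul_add]
    abel
  map_smul' c Q := by
    funext j
    simp only [Pi.smul_apply, mul_smul_comm, RingHom.id_apply, series_smul_sub]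

/-- The coefficients of a distribution that is a Laurent series in `z`. -/
def seriesModes (Q : ℤ → LaurentSeries LatticeSpace) (i j : ℤ) : LatticeSpace := (Q j).coeff (-i - 1)

theorem seriesModes_difSeries_pow (Q : ℤ → LaurentSeries LatticeSpace) (r : ℕ) :
    seriesModes ((difSeries ^ r) Q) = (dif ^ r) (seriesModes Q) := by
  induction r with
  | zero => rfl
  | succ r ih =>
    rw [pow_succ', Module.End.mul_apply, pow_succ', Module.End.mul_apply, ← ih]
    funext i j
    change (zpow 1 * (difSeries ^ r) Q j - (difSeries ^ r) Q (j + 1)).coeff (-i - 1) = _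
    rw [HahnSeries.coeff_sub, coeff_zpow_mul, dif_apply, seriesModes, seriesModes]
    congr 2; ring

theorem seriesModes_injective : Function.Injective seriesModes := by
  intro Q R h
  funext j
  refine HahnSeries.ext (funext fun p => ?_)
  have := congr_fun (congr_fun h (-p - 1)) j
  rwa [seriesModes, seriesModes, show -(-p - 1) - 1 = p by ring] at this

theorem difSeries_pow_mul (E : LaurentSeries LatticeSpace) (Q : ℤ → LaurentSeries LatticeSpace)
    (r : ℕ) : (difSeries ^ r) (fun j => E * Q j) = fun j => E * (difSeries ^ r) Q j := by
  induction r with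
  | zero => rfl
  | succ r ih =>
    rw [pow_succ', Module.End.mul_apply, ih]
    funext j
    change zpow 1 * (E * (difSeries ^ r) Q j) - E * (difSeries ^ r) Q (j + 1) =
      E * (zpow 1 * (difSeries ^ r) Q j - (difSeries ^ r) Q (j + 1))
    rw [series_mul_sub, series_mul_left_comm]

theorem odeOp_expoPairing (m n : ℤ) :
    odeOp (seriesModes fun j => expoPairing m (expoCoeff n (-j - 1))) = 0 := by
  funext i j
  rw [odeOp_apply, seriesModes, seriesModes, seriesModes]
  have h1 := coeff_expoPairing_partialD m (expoCoeff n (-j - 1)) (-i - 1)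
  rw [partialD_expoCoeff, map_smul, HahnSeries.coeff_smul, show -j - 1 + 1 = -(j - 1) - 1 by ring,
    show -i - 1 + 1 = -(i - 1) - 1 by ring] at h1
  change _ = (0 : LatticeSpace)
  rw [eq_add_of_sub_eq h1.symm]
  push_cast
  module

theorem odeOp_constant (n : ℤ) :
    odeOp (seriesModes fun j => constant (expoCoeff n (-j - 1))) = 0 := by
  funext i j
  rw [odeOp_apply, seriesModes, seriesModes, seriesModes, coeff_constant, coeff_constant,
    coeff_constant]
  have h : (i : ℂ) • (if -(i - 1) - 1 = 0 then expoCoeff n (-j - 1) else 0) = 0 := by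
    split_ifs with h
    · obtain rfl : i = 0 := by omega
      simp
    · rw [smul_zero]
  rw [h, add_zero]
  split_ifs
  · rw [partialD_expoCoeff, show -j - 1 + 1 = -(j - 1) - 1 by ring, ← add_smul]
    push_cast
    rw [show (-(j : ℂ) - 1 + 1 + j) = 0 by ring, zero_smul]; rfl
  · simp

theorem seriesModes_bounded {f : LatticeSpace →ₗ[ℂ] LaurentSeries LatticeSpace} (n i j : ℤ)
    (hj : 0 ≤ j) : seriesModes (fun j => f (expoCoeff n (-j - 1))) i j = 0 := by
  rw [seriesModes, expoCoeff_of_neg n (by omega), map_zero]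
  rfl

/-- This is `∑ ⟨e^(φ_(mγ)), b''⟩ b' = (z - w)^(mn) b` for `b = e^(w∂) e^(φ_(nγ))`, with the possibly
negative exponent cleared by `r + mn = t`. Both sides solve the same equation, since `∂ - ∂_z - ∂_w`
commutes with `z - w`, and at `w = 0` both equal `z^t e^(φ_(nγ))`. -/
theorem difSeries_pow_expoPairing {m n : ℤ} {r t : ℕ} (h : (r : ℤ) + m * n = t) :
    (difSeries ^ r) (fun j => expoPairing m (expoCoeff n (-j - 1))) =
      (difSeries ^ t) fun j => constant (expoCoeff n (-j - 1)) := by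
  apply seriesModes_injective
  rw [seriesModes_difSeries_pow, seriesModes_difSeries_pow]
  have h1 := dif_pow_of_bounded (seriesModes_bounded (f := expoPairing m) n) r
  have h2 := dif_pow_of_bounded (seriesModes_bounded (f := constant) n) t
  refine eq_of_odeOp (odeOp_dif_pow (odeOp_expoPairing m n) r) (odeOp_dif_pow (odeOp_constant n) t)
    h1.1 h2.1 fun i => ?_
  rw [h1.2, h2.2, seriesModes, seriesModes, show -(-1 : ℤ) - 1 = 0 by ring, expoCoeff_zero,
    coeff_expoPairing_expo, coeff_constant]
  exact if_congr (by omega) rfl rfl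

/-- Multiplying by `e^(z∂) e^(φ_(mγ))`, a Laurent series in `z` for each power of `w`, preserves the
identity. The right-hand side is symmetric under exchange of the two exponentials and variables, up
to the sign of `(z - w)^t`. -/
theorem dif_pow_mode_expo {m n : ℤ} {r t : ℕ} (h : (r : ℤ) + m * n = t) :
    (dif ^ r) (fun i j => vertexOps.mode (expo m) i (expoCoeff n (-j - 1))) =
      (dif ^ t) fun i j => expoCoeff m (-i - 1) * expoCoeff n (-j - 1) := by
  have e1 : (fun i j => vertexOps.mode (expo m) i (expoCoeff n (-j - 1))) =
      seriesModes fun j => taylor (expo m) * expoPairing m (expoCoeff n (-j - 1)) := by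
    funext i j
    rw [mode_apply, field_expo]; rfl
  have e2 : (fun i j => expoCoeff m (-i - 1) * expoCoeff n (-j - 1)) =
      seriesModes fun j => taylor (expo m) * constant (expoCoeff n (-j - 1)) := by
    funext i j
    rw [seriesModes, coeff_mul_constant]; rfl
  rw [e1, e2, ← seriesModes_difSeries_pow, ← seriesModes_difSeries_pow, difSeries_pow_mul,
    difSeries_pow_mul, difSeries_pow_expoPairing h]

theorem dif_pow_shift {M : Type*} [AddCommGroup M] [Module ℂ M] (f : ℤ → ℤ → M) (s t : ℤ) (N : ℕ) :
    (dif ^ N) (fun i j => f (i + s) (j + t)) = fun i j => (dif ^ N) f (i + s) (j + t) := by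
  induction N with
  | zero => rfl
  | succ N ih =>
    rw [pow_succ', Module.End.mul_apply, ih]
    funext i j
    rw [Module.End.mul_apply, dif_apply, dif_apply, add_right_comm, add_right_comm j]

theorem localOrder_expo_expo {m n : ℤ} {r t : ℕ} (h : (r : ℤ) + m * n = t) :
    LocalOrder ((-1) ^ (r + t)) r (vertexOps.mode (expo m)) (vertexOps.mode (expo n)) := by
  rw [localOrder_iff]
  set ε : ℂ := (-1) ^ (r + t) with hε
  set F : LatticeSpace → ℤ → ℤ → LatticeSpace := fun v i j =>
    vertexOps.mode (expo m) i (vertexOps.mode (expo n) j v) -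
      ε • vertexOps.mode (expo n) j (vertexOps.mode (expo m) i v) with hF
  -- On the vacuum both orders of the product reduce to the same symmetric expression; exchanging
  -- the variables costs `(-1)^r` on one side and `(-1)^t` on the other, which is the sign `ε`.
  have hone : (dif ^ r) (F 1) = 0 := by
    have e : F 1 = (fun i j => vertexOps.mode (expo m) i (expoCoeff n (-j - 1))) -
        ε • fun i j => (fun j i => vertexOps.mode (expo n) j (expoCoeff m (-i - 1))) j i := by
      funext i j
      simp only [hF, mode_expo_one]
      rfl
    have h1 := dif_pow_mode_expo (show (r : ℤ) + n * m = t by rw [mul_comm n, h])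
    have h2 := dif_pow_swap (fun i j => expoCoeff n (-i - 1) * expoCoeff m (-j - 1)) t
    have h3 := dif_pow_swap (fun i j => vertexOps.mode (expo n) i (expoCoeff m (-j - 1))) r
    have h4 : (-1 : ℂ) ^ (r + t) * (-1) ^ r = (-1) ^ t := by
      rw [pow_add, mul_right_comm, ← mul_pow]; norm_num
    rw [e, map_sub, map_smul, dif_pow_mode_expo h, h3, h1]
    funext i j
    have h5 := congr_fun (congr_fun h2 i) j
    simp only [mul_comm (expoCoeff n _)] at h5
    simp only [Pi.sub_apply, Pi.smul_apply, Pi.zero_apply, mul_comm (expoCoeff n _)]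
    rw [h5, smul_smul, hε, h4, sub_self]
  suffices h : ∀ v, (dif ^ r) (F v) = 0 from h
  intro v
  induction v using boson_induction with
  | hadd v w hv hw =>
    have e : F (v + w) = F v + F w := by
      funext i j
      simp only [hF, map_add, smul_add, Pi.add_apply]
      abel
    rw [e, map_add, hv, hw, add_zero]
  | hsmul c v hv =>
    have e : F (c • v) = c • F v := by
      funext i j
      simp only [hF, map_smul, smul_sub, Pi.smul_apply]
      rw [smul_comm ε]
    rw [e, map_smul, hv, smul_zero]
  -- Multiplication by `e^(φ_(kγ))` merely shifts both indices of the vacuum case.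
  | hexpo k =>
    have e : F (expo k) = fun i j => (LinearMap.mulRight ℂ (expo k))
        ((fun i j => F 1 (i + m * k) (j + n * k)) i j) := by
      funext i j
      have hx : ∀ a i, vertexOps.mode (expo a) i (expo k) =
          vertexOps.mode (expo a) (i + a * k) 1 * expo k := fun a i => by
        have := mode_expo_mul_expo a i k 1
        rwa [one_mul] at this
      simp only [hF, LinearMap.mulRight_apply]
      rw [hx, hx, mode_expo_mul_expo, mode_expo_mul_expo, sub_mul, smul_mul_assoc]
    rw [e, dif_pow_map, dif_pow_shift, hone]
    funext i j
    exact zero_mul _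
  -- Each field passes the boson at the cost of a shifted copy of itself. The terms with both
  -- corrections cancel, so shifts and multiples of `F v` remain.
  | hboson k v hv =>
    have e : F (boson k * v) = (fun i j => LinearMap.mulLeft ℂ (boson k) (F v i j)) -
        ((m : ℂ) * (k.factorial : ℂ)) • (fun i j => F v (i + (-1 - k)) (j + 0)) -
        ((n : ℂ) * (k.factorial : ℂ)) • (fun i j => F v (i + 0) (j + (-1 - k))) := by
      funext i j
      simp only [hF, LinearMap.mulLeft_apply, Pi.sub_apply, Pi.smul_apply]
      rw [mode_expo_boson_mul, mode_expo_boson_mul, map_sub, map_sub, map_smul, map_smul,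
        mode_expo_boson_mul, mode_expo_boson_mul, add_zero, add_zero,
        show i + (-1 - (k : ℤ)) = i - 1 - k by ring, show j + (-1 - (k : ℤ)) = j - 1 - k by ring,
        mul_sub, mul_smul_comm]
      module
    rw [e, map_sub, map_sub, map_smul, map_smul, dif_pow_map, dif_pow_shift, dif_pow_shift, hv]
    funext i j
    simp

end LatticeVA

/-! ### Stability of locality, covariance and invariant subspaces. -/

namespace FormalModes

variable {V : Type*} [AddCommGroup V] [Module ℂ V]

theorem IsLocal.zero {ε : ℂ} (c : ℤ → Module.End ℂ V) : IsLocal ε 0 c := by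
  refine ⟨0, ?_⟩
  funext i j
  simp

theorem IsCovariant.smul {D : Module.End ℂ V} {a : ℤ → Module.End ℂ V} (h : IsCovariant D a)
    (c : ℂ) : IsCovariant D (c • a) := by
  intro n
  rw [Pi.smul_apply, Pi.smul_apply, mul_smul_comm, smul_mul_assoc, ← smul_sub, h, smul_comm]

theorem IsCovariant.deriv {D : Module.End ℂ V} {a a' : ℤ → Module.End ℂ V} (h : IsCovariant D a)
    (ha' : ∀ n, a' n = -(n : ℂ) • a (n - 1)) : IsCovariant D a' := by
  intro n
  rw [ha', ha', mul_smul_comm, smul_mul_assoc, ← smul_sub, h]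

theorem half_mem {a b : ℤ → Module.End ℂ V} (hb : IsField b) {U W : Submodule ℂ V} {v : V}
    (hbv : ∀ n, b n v ∈ U) (ha : ∀ n, ∀ x ∈ U, a n x ∈ W) (i j : ℤ) : half a b hb i j v ∈ W := by
  obtain ⟨N, hN⟩ := hb v
  rw [half_eq_sum hb i j v hN (K := (N - j).toNat) (by omega)]
  exact Submodule.sum_mem _ fun l _ => ha _ _ (hbv _)

theorem normalProd_mem {ε : ℂ} {a b : ℤ → Module.End ℂ V} (ha : IsField a) (hb : IsField b)
    {S U U' W : Submodule ℂ V} (hbS : ∀ n, ∀ x ∈ S, b n x ∈ U) (haU : ∀ n, ∀ x ∈ U, a n x ∈ W)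
    (haS : ∀ n, ∀ x ∈ S, a n x ∈ U') (hbU : ∀ n, ∀ x ∈ U', b n x ∈ W) (i j : ℤ) {v : V}
    (hv : v ∈ S) : normalProd ε a b ha hb i j v ∈ W := by
  rw [normalProd, LinearMap.add_apply, LinearMap.smul_apply]
  exact W.add_mem (half_mem hb (fun n => hbS n v hv) haU i j)
    (W.smul_mem _ (half_mem ha (fun n => haS n v hv) hbU j i))

end FormalModes

namespace LatticeVA

open MvPolynomial FormalModes VertexOps

/-! ## Charges -/

/-- The elements `u e^(φ_(mγ))`. -/
def sector (m : ℤ) : Submodule ℂ LatticeSpace :=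
  LinearMap.range (AddMonoidAlgebra.lsingle (R := ℂ) (S := HeisenbergPoly) m)

theorem single_mem_sector (m : ℤ) (u : HeisenbergPoly) : AddMonoidAlgebra.single m u ∈ sector m :=
  ⟨u, rfl⟩

theorem expo_mem_sector (m : ℤ) : expo m ∈ sector m := single_mem_sector m 1

theorem mul_mem_sector {m n : ℤ} {a b : LatticeSpace} (ha : a ∈ sector m) (hb : b ∈ sector n) :
    a * b ∈ sector (m + n) := by
  obtain ⟨u, rfl⟩ := ha
  obtain ⟨v, rfl⟩ := hb
  exact ⟨u * v, (AddMonoidAlgebra.single_mul_single ..).symm⟩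

theorem boson_mul_mem_sector {m : ℤ} {a : LatticeSpace} (k : ℕ) (ha : a ∈ sector m) :
    boson k * a ∈ sector m := by
  have := mul_mem_sector (single_mem_sector 0 (X k)) ha
  rwa [zero_add] at this

theorem partialD_mem_sector {m : ℤ} {a : LatticeSpace} (ha : a ∈ sector m) :
    partialD a ∈ sector m := by
  obtain ⟨u, rfl⟩ := ha
  exact ⟨_, (partialD_single m u).symm⟩

theorem sector_induction {m : ℤ} {P : (a : LatticeSpace) → a ∈ sector m → Prop}
    (hadd : ∀ a b (ha : a ∈ sector m) (hb : b ∈ sector m), P a ha → P b hb →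
      P (a + b) (add_mem ha hb))
    (hsmul : ∀ (c : ℂ) (a) (ha : a ∈ sector m), P a ha → P (c • a) (Submodule.smul_mem _ c ha))
    (hexpo : P (expo m) (expo_mem_sector m))
    (hboson : ∀ k a (ha : a ∈ sector m), P a ha → P (boson k * a) (boson_mul_mem_sector k ha))
    {a : LatticeSpace} (ha : a ∈ sector m) : P a ha := by
  suffices h : ∃ ha, P a ha from h.2
  obtain ⟨u, rfl⟩ := ha
  change ∃ ha, P (AddMonoidAlgebra.single m u) ha
  induction u using MvPolynomial.induction_on with
  | C c =>
    have : AddMonoidAlgebra.single m (C c : HeisenbergPoly) = c • expo m := by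
      rw [expo, AddMonoidAlgebra.smul_single, MvPolynomial.smul_eq_C_mul, mul_one]
    rw [this]
    exact ⟨_, hsmul _ _ _ hexpo⟩
  | add p q hp hq =>
    obtain ⟨_, hp⟩ := hp
    obtain ⟨_, hq⟩ := hq
    rw [AddMonoidAlgebra.single_add]
    exact ⟨_, hadd _ _ _ _ hp hq⟩
  | mul_X p k hp =>
    rw [mul_comm, ← boson_mul_single]
    obtain ⟨_, hp⟩ := hp
    exact ⟨_, hboson _ _ _ hp⟩

theorem intCast_mul_self (m : ℤ) : ((m * m : ℤ) : ZMod 2) = m := by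
  have h : ∀ x : ZMod 2, x * x = x := by decide
  push_cast
  exact h _

theorem mem_parity {i : ZMod 2} {a : LatticeSpace} :
    a ∈ vertexOps.parity i ↔ ∀ m : ℤ, (m : ZMod 2) ≠ i → a.coeff m = 0 := by
  have h : a ∈ vertexOps.parity i ↔
    ∀ m ∉ {m : ℤ | ((m * m : ℤ) : ZMod 2) = i}, a.coeff m = 0 := AddMonoidAlgebra.mem_supported'
  rw [h]
  simp only [Set.mem_ofPred_eq, intCast_mul_self]

theorem sector_le_parity (m : ℤ) : sector m ≤ vertexOps.parity m := by
  rintro _ ⟨u, rfl⟩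
  rw [mem_parity]
  intro n hn
  have : m ≠ n := by rintro rfl; exact hn rfl
  exact Finsupp.single_eq_of_ne' this

/-- Homogeneous elements are sums of elements of a definite charge. -/
theorem parity_induction {i : ZMod 2} {P : (a : LatticeSpace) → a ∈ vertexOps.parity i → Prop}
    (hzero : P 0 (zero_mem _))
    (hadd : ∀ a b ha hb, P a ha → P b hb → P (a + b) (add_mem ha hb))
    (hsector : ∀ (m : ℤ) (hm : (m : ZMod 2) = i), ∀ a (ha : a ∈ sector m),
      P a (hm ▸ sector_le_parity m ha)) {a : LatticeSpace} (ha : a ∈ vertexOps.parity i) :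
    P a ha := by
  suffices h : ∃ ha, P a ha from h.2
  rw [← AddMonoidAlgebra.sum_coeff_single a, Finsupp.sum]
  refine Finset.sum_induction _ (fun a => ∃ ha, P a ha) (fun a b ⟨ha, h⟩ ⟨hb, h'⟩ =>
    ⟨_, hadd a b ha hb h h'⟩) ⟨_, hzero⟩ fun m hm => ⟨_, hsector m ?_ _ (single_mem_sector m _)⟩
  by_contra h
  exact Finsupp.mem_support_iff.mp hm (mem_parity.mp ha m h)

theorem parity_isCompl : IsCompl (vertexOps.parity 0) (vertexOps.parity 1) := by
  refine ⟨?_, ?_⟩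
  · rw [Submodule.disjoint_def]
    intro a h0 h1
    rw [mem_parity] at h0 h1
    refine AddMonoidAlgebra.ext (Finsupp.ext fun m => ?_)
    by_cases h : (m : ZMod 2) = 0
    · exact h1 m (by rw [h]; decide)
    · exact h0 m h
  · rw [codisjoint_iff, eq_top_iff]
    rintro a -
    induction a using AddMonoidAlgebra.induction_linear with
    | zero => exact zero_mem _
    | add a b ha hb => exact add_mem ha hb
    | single m u =>
      have h : ∀ x : ZMod 2, x = 0 ∨ x = 1 := by decide
      have hm := sector_le_parity m (single_mem_sector m u)
      rcases h m with h | h <;> rw [h] at hm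
      · exact Submodule.mem_sup_left hm
      · exact Submodule.mem_sup_right hm

theorem heis_mem_sector (n : ℤ) {r : ℤ} {b : LatticeSpace} (hb : b ∈ sector r) :
    vertexOps.mode (boson 0) n b ∈ sector r := by
  induction hb using sector_induction with
  | hadd a b _ _ ha hb => rw [map_add]; exact add_mem ha hb
  | hsmul c a _ ha => rw [map_smul]; exact Submodule.smul_mem _ _ ha
  | hexpo =>
    rcases int_cases n with ⟨s, rfl⟩ | rfl | ⟨l, rfl⟩
    · rw [heis_neg]
      exact Submodule.smul_mem _ _ (boson_mul_mem_sector s (expo_mem_sector r))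
    · rw [heis_zero, charge_expo]
      exact Submodule.smul_mem _ _ (expo_mem_sector r)
    · rw [heis_pos, pd_expo, smul_zero]
      exact zero_mem _
  | hboson k a h ha =>
    rw [heis_boson_mul]
    exact add_mem (boson_mul_mem_sector k ha) (Submodule.smul_mem _ _ h)

theorem mode_boson_mem_sector (k : ℕ) (n : ℤ) {r : ℤ} {b : LatticeSpace} (hb : b ∈ sector r) :
    vertexOps.mode (boson k) n b ∈ sector r := by
  induction k generalizing n with
  | zero => exact heis_mem_sector n hb
  | succ k ih =>
    rw [mode_boson_succ]
    exact Submodule.smul_mem _ _ (ih _)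

theorem expoCoeff_mem_sector (m q : ℤ) : expoCoeff m q ∈ sector m := by
  rcases lt_or_ge q 0 with hq | hq
  · rw [expoCoeff_of_neg m hq]
    exact zero_mem _
  · lift q to ℕ using hq
    rw [expoCoeff, coeff_taylor]
    refine Submodule.smul_mem _ _ ?_
    induction q with
    | zero => exact expo_mem_sector m
    | succ q ih =>
      rw [pow_succ', Module.End.mul_apply]
      exact partialD_mem_sector ih

theorem mode_expo_mem_sector (m n : ℤ) {r : ℤ} {b : LatticeSpace} (hb : b ∈ sector r) :
    vertexOps.mode (expo m) n b ∈ sector (m + r) := by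
  induction hb using sector_induction generalizing n with
  | hadd a b _ _ ha hb => rw [map_add]; exact add_mem (ha n) (hb n)
  | hsmul c a _ ha => rw [map_smul]; exact Submodule.smul_mem _ _ (ha n)
  | hexpo =>
    rw [mode_expo_expo]
    exact mul_mem_sector (expoCoeff_mem_sector m _) (expo_mem_sector r)
  | hboson k a h ha =>
    rw [mode_expo_boson_mul]
    exact sub_mem (boson_mul_mem_sector k (ha _)) (Submodule.smul_mem _ _ (ha _))

/-- The charge is additive under all products. -/
theorem mode_mem_sector {m r : ℤ} {a b : LatticeSpace} (ha : a ∈ sector m) (n : ℤ)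
    (hb : b ∈ sector r) : vertexOps.mode a n b ∈ sector (m + r) := by
  induction ha using sector_induction generalizing n b with
  | hadd a a' _ _ ha ha' =>
    rw [mode_add]
    exact add_mem (ha n hb) (ha' n hb)
  | hsmul c a _ ha =>
    rw [mode_smul]
    exact Submodule.smul_mem _ _ (ha n hb)
  | hexpo => exact mode_expo_mem_sector m n hb
  | hboson k a h ha =>
    rw [mode_boson_mul]
    exact normalProd_mem _ _ (fun n x hx => ha n hx) (fun n x hx => mode_boson_mem_sector k n hx)
      (fun n x hx => mode_boson_mem_sector k n hx) (fun n x hx => ha n hx) 0 n hb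

theorem mode_mem_parity {i j : ZMod 2} {a b : LatticeSpace} (n : ℤ)
    (ha : a ∈ vertexOps.parity i) (hb : b ∈ vertexOps.parity j) :
    vertexOps.mode a n b ∈ vertexOps.parity (i + j) := by
  induction ha using parity_induction with
  | hzero => rw [mode_zero]; exact zero_mem _
  | hadd a a' _ _ ha ha' => rw [mode_add]; exact add_mem ha ha'
  | hsector m hm a ha =>
    induction hb using parity_induction with
    | hzero => rw [map_zero]; exact zero_mem _
    | hadd b b' _ _ hb hb' => rw [map_add]; exact add_mem hb hb'
    | hsector r hr b hb =>
      have := sector_le_parity _ (mode_mem_sector ha n hb)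
      rwa [Int.cast_add, hm, hr] at this

/-! ## The vacuum and the translation operator -/

theorem mode_boson_vac (k : ℕ) {n : ℤ} (hn : 0 ≤ n) : vertexOps.mode (boson k) n 1 = 0 := by
  induction k generalizing n with
  | zero =>
    rw [← expo_zero, heis_expo n hn]
    simp
  | succ k ih =>
    rw [mode_boson_succ, LinearMap.smul_apply]
    rcases hn.eq_or_lt with rfl | hn
    · simp
    · rw [ih (by omega), smul_zero]

theorem mode_vac (a : LatticeSpace) :
    (∀ n, 0 ≤ n → vertexOps.mode a n 1 = 0) ∧ vertexOps.mode a (-1) 1 = a := by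
  induction a using boson_induction with
  | hadd a b ha hb =>
    rw [mode_add]
    exact ⟨fun n hn => by rw [Pi.add_apply, LinearMap.add_apply, ha.1 n hn, hb.1 n hn, add_zero],
      by rw [Pi.add_apply, LinearMap.add_apply, ha.2, hb.2]⟩
  | hsmul c a ha =>
    rw [mode_smul]
    exact ⟨fun n hn => by rw [Pi.smul_apply, LinearMap.smul_apply, ha.1 n hn, smul_zero],
      by rw [Pi.smul_apply, LinearMap.smul_apply, ha.2]⟩
  | hexpo m =>
    refine ⟨fun n hn => ?_, ?_⟩
    · rw [mode_expo_one, expoCoeff_of_neg m (by omega)]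
    · rw [mode_expo_one]
      exact expoCoeff_zero m
  | hboson k a ha =>
    rw [mode_boson_mul]
    have h := normalProd_vac (ε := 1) (vertexOps.isField_mode (boson k)) (vertexOps.isField_mode a)
      (fun n hn => mode_boson_vac k hn) ha.1
    refine ⟨h.1, ?_⟩
    rw [h.2, ha.2]
    simpa using mode_boson_neg k 0 a

theorem mode_expo_covariant (m : ℤ) : IsCovariant partialD (vertexOps.mode (expo m)) := by
  intro n
  refine LinearMap.ext fun b => ?_
  rw [LinearMap.sub_apply, LinearMap.smul_apply, Module.End.mul_apply, Module.End.mul_apply]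
  induction b using boson_induction generalizing n with
  | hadd a b ha hb =>
    simp only [map_add, smul_add, ← ha, ← hb]
    abel
  | hsmul c a ha =>
    simp only [map_smul]
    rw [← smul_sub, ha, smul_comm]
  | hexpo r =>
    have h1 : vertexOps.mode (expo m) (n - 1) (expo r) =
        expoCoeff m (-(n + m * r) - 1 + 1) * expo r := by
      rw [mode_expo_expo]; congr 2; ring
    rw [partialD_expo, map_smul, mode_expo_boson_mul, mode_expo_expo, Nat.cast_zero, sub_zero, h1,
      partialD_mul, partialD_expoCoeff, partialD_expo, smul_mul_assoc, mul_smul_comm,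
      mul_left_comm _ (boson 0), Nat.factorial_zero]
    push_cast
    module
  | hboson k a ha =>
    have h0 := ha n
    have h1 := ha (n - 1 - k)
    rw [sub_eq_iff_eq_add] at h0 h1
    rw [mode_expo_boson_mul, map_sub, map_smul, partialD_boson_mul, partialD_boson_mul, map_add,
      mode_expo_boson_mul, mode_expo_boson_mul, mode_expo_boson_mul, h0, h1, Nat.factorial_succ,
      mul_add, mul_smul_comm, show n - 1 - ((k + 1 : ℕ) : ℤ) = n - 1 - k - 1 by push_cast; ring,
      show n - 1 - 1 - (k : ℤ) = n - 1 - k - 1 by ring]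
    push_cast
    module

theorem mode_covariant (a : LatticeSpace) : IsCovariant partialD (vertexOps.mode a) := by
  have hb : ∀ k, IsCovariant partialD (vertexOps.mode (boson k)) := by
    intro k
    induction k with
    | zero => exact heis_covariant
    | succ k ih => exact ih.deriv (mode_boson_succ k)
  induction a using boson_induction with
  | hadd a b ha hb =>
    intro n
    rw [mode_add, Pi.add_apply, Pi.add_apply, mul_add, add_mul, smul_add, ← ha, ← hb]
    abel
  | hsmul c a ha =>
    rw [mode_smul]
    exact ha.smul c
  | hexpo m => exact mode_expo_covariant m
  | hboson k a ha =>
    rw [mode_boson_mul]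
    exact normalProd_covariant _ _ (hb k) ha

/-- Covariance at `n = -1` on the vacuum identifies `a_(-2) 1` with `∂ a`. -/
theorem translation_eq (a : LatticeSpace) : vertexOps.translation a = partialD a := by
  have h := LinearMap.congr_fun (mode_covariant a (-1)) 1
  rw [LinearMap.sub_apply, LinearMap.smul_apply, Module.End.mul_apply, Module.End.mul_apply,
    partialD_one, map_zero, (mode_vac a).2, sub_zero] at h
  rw [h]
  change vertexOps.mode a (-2) 1 = _
  simp

/-! ## Locality -/

/-- Induction along the bosons with Dong's lemma, starting from the Heisenberg field itself and the
exponentials. -/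
theorem isLocal_heis_mode (a : LatticeSpace) :
    IsLocal 1 (vertexOps.mode (boson 0)) (vertexOps.mode a) := by
  induction a using boson_induction with
  | hadd a b ha hb =>
    rw [mode_add]
    exact ((ha.symm (mul_one 1)).add (hb.symm (mul_one 1))).symm (mul_one 1)
  | hsmul c a ha =>
    rw [mode_smul]
    exact ((ha.symm (mul_one 1)).smul c).symm (mul_one 1)
  | hexpo m => exact ⟨1, isLocal_heis_expo m⟩
  | hboson k a ha =>
    rw [mode_boson_mul]
    have := IsLocal.normalProd (vertexOps.isField_mode (boson k)) (vertexOps.isField_mode a)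
      (isLocal_boson ha) (isLocal_boson ⟨2, isLocal_heis_heis⟩) (ha.symm (mul_one 1)) 0
    rw [mul_one] at this
    exact this.symm (mul_one 1)

theorem isLocal_boson_mode (k : ℕ) (a : LatticeSpace) :
    IsLocal 1 (vertexOps.mode (boson k)) (vertexOps.mode a) := isLocal_boson (isLocal_heis_mode a)

/-- Modulo two, `r + t = t - r = mn`, which is the product of the parities. -/
theorem sgn_intCast {m n : ℤ} {r t : ℕ} (h : (r : ℤ) + m * n = t) :
    sgn m n = (-1) ^ (r + t) := by
  have h0 : ((r + t : ℕ) : ZMod 2) = m * n := by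
    have h1 := congr_arg (Int.cast : ℤ → ZMod 2) h
    push_cast at h1 ⊢
    rw [← h1]
    have : ∀ x y : ZMod 2, x + (x + y) = y := by decide
    exact this _ _
  have h1 : ∀ (s : ℕ), (-1 : ℂ) ^ s = (-1) ^ (s : ZMod 2).val := by
    intro s
    rw [ZMod.val_natCast, ← neg_one_pow_eq_pow_mod_two]
  have h2 : ∀ x y : ZMod 2, x.val * y.val = (x * y).val := by decide
  rw [sgn, h1 (r + t), h0, h2]

theorem isLocal_expo_expo (m n : ℤ) :
    IsLocal (sgn m n) (vertexOps.mode (expo m)) (vertexOps.mode (expo n)) := by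
  -- The negative and positive parts of `mn`: the order `r` is the order of the pole of `z^(mn)`.
  have h : (((-(m * n)).toNat : ℕ) : ℤ) + m * n = ((m * n).toNat : ℕ) := by omega
  rw [sgn_intCast h]
  exact ⟨_, localOrder_expo_expo h⟩

theorem isLocal_of_expo {m : ℤ} {ε : ℂ} {c : LatticeSpace} {a : LatticeSpace} (ha : a ∈ sector m)
    (h : IsLocal ε (vertexOps.mode (expo m)) (vertexOps.mode c)) :
    IsLocal ε (vertexOps.mode a) (vertexOps.mode c) := by
  induction ha using sector_induction with
  | hadd a b _ _ ha hb => rw [mode_add]; exact ha.add hb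
  | hsmul c a _ ha => rw [mode_smul]; exact ha.smul c
  | hexpo => exact h
  | hboson k a _ ha =>
    rw [mode_boson_mul, ← one_mul ε]
    exact IsLocal.normalProd _ _ (isLocal_boson_mode k a) (isLocal_boson_mode k c) ha 0

/-- Dong's lemma extends one argument from an exponential to its sector; the symmetry of locality
allows this for each argument in turn. -/
theorem isLocal_sector {m n : ℤ} {a b : LatticeSpace} (ha : a ∈ sector m) (hb : b ∈ sector n) :
    IsLocal (sgn m n) (vertexOps.mode a) (vertexOps.mode b) := by
  refine isLocal_of_expo ha (IsLocal.symm (sgn_mul_self _ _) (isLocal_of_expo hb ?_))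
  exact (isLocal_expo_expo m n).symm (sgn_mul_self _ _)

theorem isLocal_parity {i j : ZMod 2} {a b : LatticeSpace} (ha : a ∈ vertexOps.parity i)
    (hb : b ∈ vertexOps.parity j) : IsLocal (sgn i j) (vertexOps.mode a) (vertexOps.mode b) := by
  induction ha using parity_induction with
  | hzero => rw [mode_zero]; exact IsLocal.zero _
  | hadd a a' _ _ ha ha' => rw [mode_add]; exact ha.add ha'
  | hsector m hm a ha =>
    refine IsLocal.symm (sgn_mul_self _ _) ?_
    induction hb using parity_induction with
    | hzero => rw [mode_zero]; exact IsLocal.zero _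
    | hadd b b' _ _ hb hb' => rw [mode_add]; exact hb.add hb'
    | hsector r hr b hb =>
      rw [← hm, ← hr]
      exact (isLocal_sector ha hb).symm (sgn_mul_self _ _)

theorem isVertexSuperalgebra : vertexOps.IsVertexSuperalgebra where
  parity_isCompl := parity_isCompl
  vac_even := by
    have := sector_le_parity 0 (expo_mem_sector 0)
    rwa [Int.cast_zero] at this
  mode_parity _ _ _ _ n ha hb := mode_mem_parity n ha hb
  vacuum n b := mode_one b n
  creation a := (mode_vac a).2
  regular a := (mode_vac a).1
  translation_covariance a b n := by
    rw [translation_eq, translation_eq]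
    exact LinearMap.congr_fun (mode_covariant a n) b
  locality i j a b ha hb := by
    obtain ⟨N, hN⟩ := isLocal_parity ha hb
    exact ⟨N, localOrder_iff_sum.mp hN⟩

end LatticeVA

/-! ### Sub-superalgebras and kernels of zero modes. -/

namespace VertexOps

open FormalModes

variable {V : Type*} [AddCommGroup V] [Module ℂ V] {A : VertexOps V}

namespace IsVertexSuperalgebra

theorem eq_zero_of_add_eq_zero (hA : A.IsVertexSuperalgebra) {i : ZMod 2} {x y : V}
    (hx : x ∈ A.parity i) (hy : y ∈ A.parity (i + 1)) (h : x + y = 0) : x = 0 ∧ y = 0 := by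
  have hi : ∀ i : ZMod 2, i = 0 ∨ i = 1 := by decide
  have hd := Submodule.disjoint_def.mp hA.parity_isCompl.disjoint
  have h2 : (1 + 1 : ZMod 2) = 0 := by decide
  have hxy : x = -y := eq_neg_of_add_eq_zero_left h
  have hx0 : x = 0 := by
    rcases hi i with rfl | rfl
    · exact hd x hx (by rw [hxy]; simpa using neg_mem hy)
    · exact hd x (by rw [hxy]; simpa [h2] using neg_mem hy) hx
  exact ⟨hx0, by rw [hx0, zero_add] at h; exact h⟩

theorem isVertexSuperalgebra_restrict (hA : A.IsVertexSuperalgebra) {U : Submodule ℂ V}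
    (hU : A.IsSubalgebra U) : (A.restrict U hU).IsVertexSuperalgebra where
  parity_isCompl := by
    refine ⟨?_, ?_⟩
    · rw [Submodule.disjoint_def]
      intro x h0 h1
      exact Subtype.ext (Submodule.disjoint_def.mp hA.parity_isCompl.disjoint x h0 h1)
    · rw [codisjoint_iff, eq_top_iff]
      rintro ⟨x, hx⟩ -
      have hx' := hx
      rw [hU.graded] at hx'
      obtain ⟨y, hy, z, hz, rfl⟩ := Submodule.mem_sup.mp hx'
      exact Submodule.mem_sup.mpr ⟨⟨y, hy.1⟩, hy.2, ⟨z, hz.1⟩, hz.2, rfl⟩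
  vac_even := hA.vac_even
  mode_parity i j a b n ha hb := by
    change ((A.restrict U hU).mode a n b : V) ∈ A.parity (i + j)
    rw [restrict_mode]
    exact hA.mode_parity i j a b n ha hb
  vacuum n b := by
    refine Subtype.ext ?_
    rw [restrict_mode]
    refine (hA.vacuum n b).trans ?_
    split_ifs <;> rfl
  creation a := by
    refine Subtype.ext ?_
    rw [restrict_mode]
    exact hA.creation a
  regular a n hn := by
    refine Subtype.ext ?_
    rw [restrict_mode]
    exact hA.regular a n hn
  translation_covariance a b n := by
    refine Subtype.ext ?_
    simp only [translation, Submodule.coe_sub, Submodule.coe_smul, restrict_mode]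
    exact hA.translation_covariance a b n
  locality i j a b ha hb := by
    obtain ⟨N, hN⟩ := hA.locality i j a b ha hb
    refine ⟨N, fun m n c => Subtype.ext ?_⟩
    simp only [Submodule.coe_sum, Submodule.coe_sub, Submodule.coe_smul, restrict_mode]
    exact hN m n c

theorem isVertexAlgebra_restrict (hA : A.IsVertexSuperalgebra) {U : Submodule ℂ V}
    (hU : A.IsSubalgebra U) (h : U ≤ A.parity 0) : (A.restrict U hU).IsVertexAlgebra where
  toIsVertexSuperalgebra := hA.isVertexSuperalgebra_restrict hU
  no_odd := by
    rw [eq_bot_iff]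
    intro x hx
    exact Subtype.ext (Submodule.disjoint_def.mp hA.parity_isCompl.disjoint x (h x.2) hx)

theorem isSubalgebra_even_inf (hA : A.IsVertexSuperalgebra) {U : Submodule ℂ V}
    (hU : A.IsSubalgebra U) : A.IsSubalgebra (A.parity 0 ⊓ U) where
  vac_mem := ⟨hA.vac_even, hU.vac_mem⟩
  mode_mem a b n ha hb := ⟨by simpa using hA.mode_parity 0 0 a b n ha.1 hb.1,
    hU.mode_mem a b n ha.2 hb.2⟩
  graded := le_antisymm (le_sup_of_le_left (le_inf le_rfl inf_le_left))
    (sup_le inf_le_left inf_le_left)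

theorem isSubalgebra_top (hA : A.IsVertexSuperalgebra) : A.IsSubalgebra ⊤ where
  vac_mem := Submodule.mem_top
  mode_mem _ _ _ _ _ := Submodule.mem_top
  graded := by rw [top_inf_eq, top_inf_eq, hA.parity_isCompl.sup_eq_top]

theorem isSubalgebra_even (hA : A.IsVertexSuperalgebra) : A.IsSubalgebra (A.parity 0) := by
  have := hA.isSubalgebra_even_inf hA.isSubalgebra_top
  rwa [inf_top_eq] at this

/-- The kernel of the zero mode of a homogeneous state is a vertex sub-superalgebra. -/
theorem isSubalgebra_ker (hA : A.IsVertexSuperalgebra) {i : ZMod 2} {a : V}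
    (ha : a ∈ A.parity i) : A.IsSubalgebra (LinearMap.ker (A.mode a 0)) := by
  -- A homogeneous operator sends the even and odd components to opposite parities, so both images
  -- vanish if their sum does.
  have hg : LinearMap.ker (A.mode a 0) = (LinearMap.ker (A.mode a 0) ⊓ A.parity 0) ⊔
      (LinearMap.ker (A.mode a 0) ⊓ A.parity 1) := by
    refine le_antisymm (fun v hv => ?_) (sup_le inf_le_left inf_le_left)
    obtain ⟨x, hx, y, hy, rfl⟩ := hA.exists_decomp v
    rw [LinearMap.mem_ker, map_add] at hv
    have h := hA.eq_zero_of_add_eq_zero (hA.mode_parity i 0 a x 0 ha hx)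
      (by rw [add_zero]; exact hA.mode_parity i 1 a y 0 ha hy) hv
    exact Submodule.add_mem_sup ⟨h.1, hx⟩ ⟨h.2, hy⟩
  refine ⟨hA.regular a 0 le_rfl, fun b c n hb hc => ?_, hg⟩
  -- The zero mode is a superderivation of the products: if `a_0 b = 0`, then `a_0` commutes with
  -- `b_n` up to sign.
  have key : ∀ j, ∀ b ∈ LinearMap.ker (A.mode a 0) ⊓ A.parity j,
      A.mode b n c ∈ LinearMap.ker (A.mode a 0) := by
    intro j b hb
    have h := LinearMap.congr_fun (hA.mode_mode_zero ha hb.2 n) c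
    rw [LinearMap.mem_ker.mp hb.1, mode_zero, LinearMap.sub_apply, LinearMap.smul_apply,
      Module.End.mul_apply, Module.End.mul_apply, LinearMap.mem_ker.mp hc, map_zero, smul_zero,
      sub_zero] at h
    exact h.symm
  rw [hg] at hb
  obtain ⟨x, hx, y, hy, rfl⟩ := Submodule.mem_sup.mp hb
  rw [mode_add]
  exact add_mem (key 0 x hx) (key 1 y hy)

end IsVertexSuperalgebra

end VertexOps

/-! ## The lattices -/

namespace A1Datum

/-- In these coordinates `γ = 1`, so the short lattice is `ℤ` in the line. -/
theorem latticeVector_eq (m : ℤ) : latticeVector m = m := by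
  rw [latticeVector, root, div_self (by positivity), zsmul_eq_mul, mul_one]

theorem mem_shortLattice (x : ℝ) : x ∈ shortLattice 2 ↔ ∃ m : ℤ, x = latticeVector m := by
  have h : (√((2 : ℕ) : ℝ))⁻¹ * √2 = 1 := by
    rw [Nat.cast_ofNat]
    exact inv_mul_cancel₀ (by positivity)
  simp only [shortLattice, Submodule.mem_map, Submodule.mem_span_singleton, latticeVector_eq]
  constructor
  · rintro ⟨_, ⟨m, rfl⟩, rfl⟩
    exact ⟨m, by rw [LinearMap.mulLeft_apply, mul_smul_comm, root, h, zsmul_eq_mul, mul_one]⟩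
  · rintro ⟨m, rfl⟩
    exact ⟨_, ⟨m, rfl⟩, by
      rw [LinearMap.mulLeft_apply, mul_smul_comm, root, h, zsmul_eq_mul, mul_one]⟩

theorem inner_latticeVector (m n : ℤ) :
    inner ℝ (latticeVector m) (latticeVector n) = ((m * n : ℤ) : ℝ) := by
  rw [latticeVector_eq, latticeVector_eq, RCLike.inner_apply, RCLike.conj_to_real]
  push_cast
  ring

theorem latticeVector_neg_one : latticeVector (-1) = shortMomentum 2 := by
  rw [latticeVector, shortMomentum]
  simp

theorem isOddIntegralLattice_shortLattice : IsOddIntegralLattice (shortLattice 2) where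
  discrete := by
    have h : shortLattice 2 = (Submodule.span ℤ {(1 : ℝ)}) := by
      ext x
      rw [mem_shortLattice, Submodule.mem_span_singleton]
      simp only [latticeVector_eq, zsmul_eq_mul, mul_one, eq_comm]
    rw [h]
    have h2 : ((Submodule.span ℤ {(1 : ℝ)} : Submodule ℤ ℝ) : Set ℝ) =
        Set.range ((↑) : ℤ → ℝ) := by
      ext x
      rw [SetLike.mem_coe, Submodule.mem_span_singleton]
      simp
    have h3 : DiscreteTopology (Set.range ((↑) : ℤ → ℝ)) :=
      Int.isClosedEmbedding_coe_real.isEmbedding.toHomeomorph.symm.isEmbedding.discreteTopology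
    rw [← h2] at h3
    exact h3
  spanning := by
    rw [eq_top_iff]
    rintro x -
    have h : (1 : ℝ) ∈ shortLattice 2 := (mem_shortLattice 1).mpr ⟨1, by rw [latticeVector_eq]; simp⟩
    have := Submodule.smul_mem _ x (Submodule.subset_span (R := ℝ) h)
    simpa using this
  integral x hx y hy := by
    obtain ⟨m, rfl⟩ := (mem_shortLattice x).mp hx
    obtain ⟨n, rfl⟩ := (mem_shortLattice y).mp hy
    exact ⟨m * n, inner_latticeVector m n⟩
  odd := ⟨latticeVector 1, (mem_shortLattice _).mpr ⟨1, rfl⟩, 1, odd_one, by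
    rw [inner_latticeVector, mul_one]⟩

/-- The generator `√2` times the coroot is the number `2`, so the long lattice is `2ℤ`. -/
theorem latticeVector_mem_longLattice (m : ℤ) : latticeVector m ∈ longLattice 2 ↔ (m : ZMod 2) = 0 := by
  have h : √((2 : ℕ) : ℝ) * coroot = 2 := by
    have h2 : √(2 : ℝ) * √2 = 2 := Real.mul_self_sqrt (by norm_num)
    rw [coroot, root, RCLike.inner_apply, RCLike.conj_to_real, h2, div_self two_ne_zero, one_smul,
      Nat.cast_ofNat, h2]
  rw [ZMod.intCast_zmod_eq_zero_iff_dvd m 2, latticeVector_eq]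
  simp only [longLattice, Submodule.mem_map, Submodule.mem_span_singleton]
  constructor
  · rintro ⟨_, ⟨k, rfl⟩, hk⟩
    rw [LinearMap.mulLeft_apply, mul_smul_comm, h, zsmul_eq_mul] at hk
    exact ⟨k, by exact_mod_cast hk.symm.trans (mul_comm _ _)⟩
  · rintro ⟨k, rfl⟩
    refine ⟨_, ⟨k, rfl⟩, ?_⟩
    rw [LinearMap.mulLeft_apply, mul_smul_comm, h, zsmul_eq_mul]
    push_cast
    ring

end A1Datum

/-! ### The screening kernels as sub-superalgebras. -/

namespace LatticeVA

open VertexOps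

/-- As `m² ≡ m` modulo two, charges in the long lattice are exactly the even ones. The `W`-algebra
is thus the even part of the full screening kernel. -/
theorem longSpace_eq : longSpace = vertexOps.parity 0 := by
  have h : {m : ℤ | A1Datum.latticeVector m ∈ A1Datum.longLattice 2} =
      {m : ℤ | ((m * m : ℤ) : ZMod 2) = 0} := by
    ext m
    rw [Set.mem_ofPred_eq, Set.mem_ofPred_eq, A1Datum.latticeVector_mem_longLattice, intCast_mul_self]
  exact congr_arg (AddMonoidAlgebra.supported ℂ HeisenbergPoly) h

theorem screeningKernel_eq : screeningKernel = LinearMap.ker (vertexOps.mode (expo (-1)) 0) := rfl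

theorem expo_mem_parity_one : expo (-1) ∈ vertexOps.parity 1 := by
  have := sector_le_parity _ (expo_mem_sector (-1))
  rwa [show ((-1 : ℤ) : ZMod 2) = 1 by decide] at this

theorem isSubalgebra_screeningKernel : vertexOps.IsSubalgebra screeningKernel :=
  isVertexSuperalgebra.isSubalgebra_ker expo_mem_parity_one

theorem screeningKernelLong_eq : screeningKernelLong = vertexOps.parity 0 ⊓ screeningKernel := by
  rw [screeningKernelLong, longSpace_eq]

theorem isSubalgebra_screeningKernelLong : vertexOps.IsSubalgebra screeningKernelLong := by
  rw [screeningKernelLong_eq]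
  exact isVertexSuperalgebra.isSubalgebra_even_inf isSubalgebra_screeningKernel

end LatticeVA

/-! ### Anticommutation relations from locality. -/

namespace FormalModes

variable {V : Type*} [AddCommGroup V] [Module ℂ V]

theorem sub_neg_one_smul (x y : Module.End ℂ V) : x - (-1 : ℂ) • y = x + y := by
  rw [neg_one_smul, sub_neg_eq_add]

theorem LocalOrder.anticomm {a b : ℤ → Module.End ℂ V} (h : LocalOrder (-1) 0 a b) (i j : ℤ) :
    a i * b j + b j * a i = 0 := by
  rw [← sub_neg_one_smul]
  exact congr_fun (congr_fun h i) j

/-- Locality of order one makes the anticommutator constant along antidiagonals. -/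
theorem LocalOrder.anticomm_shift {a b : ℤ → Module.End ℂ V} (h : LocalOrder (-1) 1 a b)
    (i j : ℤ) : a (i + 1) * b j + b j * a (i + 1) = a i * b (j + 1) + b (j + 1) * a i := by
  rw [← sub_neg_one_smul, ← sub_neg_one_smul, ← sub_eq_zero]
  have := congr_fun (congr_fun h i) j
  rwa [pow_one, dif_apply] at this

theorem anticomm_smul {x y : Module.End ℂ V} (h : x * y + y * x = 0) (r s : ℂ) :
    (r • x) * (s • y) + (s • y) * (r • x) = 0 := by
  rw [smul_mul_smul_comm, smul_mul_smul_comm, mul_comm s r, ← smul_add, h, smul_zero]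

end FormalModes

namespace LatticeVA

open MvPolynomial FormalModes VertexOps

/-! ## The odd generators -/

theorem expo_odd {m : ℤ} (hm : (m : ZMod 2) = 1) : expo m ∈ vertexOps.parity 1 :=
  hm ▸ sector_le_parity m (expo_mem_sector m)

/-- Here `mn = m² = 1`, so there is no pole: the fields are local of order zero. -/
theorem anticomm_self {m : ℤ} (hm : m * m = 1) (i j : ℤ) :
    vertexOps.mode (expo m) i * vertexOps.mode (expo m) j +
      vertexOps.mode (expo m) j * vertexOps.mode (expo m) i = 0 := by
  have h := localOrder_expo_expo (m := m) (n := m) (r := 0) (t := 1) (by rw [hm]; simp)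
  rw [zero_add, pow_one] at h
  exact h.anticomm i j

/-- The modes of `e^(φ_(-γ))` and `e^(φ_γ)` are a pair of `bc`-fermions. -/
theorem anticomm_expo (i j : ℤ) :
    vertexOps.mode (expo (-1)) i * vertexOps.mode (expo 1) j +
      vertexOps.mode (expo 1) j * vertexOps.mode (expo (-1)) i = if i + j = -1 then 1 else 0 := by
  -- The superderivation formula: the zero mode of `e^(φ_(-γ))` sends `e^(φ_γ)` to the vacuum, whose
  -- field is the identity.
  have h0 : ∀ j, vertexOps.mode (expo (-1)) 0 * vertexOps.mode (expo 1) j +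
      vertexOps.mode (expo 1) j * vertexOps.mode (expo (-1)) 0 = if j = -1 then 1 else 0 := by
    intro j
    have h := isVertexSuperalgebra.mode_mode_zero (expo_odd (m := -1) (by decide))
      (expo_odd (m := 1) (by decide)) j
    rw [mode_expo_expo, show -(0 + -1 * 1) - 1 = (0 : ℤ) by ring, expoCoeff_zero, expo_mul_expo,
      neg_add_cancel, expo_zero] at h
    have hs : sgn 1 1 = -1 := by simp [sgn, ZMod.val_one]
    rw [hs, sub_neg_one_smul] at h
    rw [← h]
    refine LinearMap.ext fun b => ?_
    rw [mode_one]
    split_ifs <;> rfl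
  -- The pole is simple, so the case `i = 0` propagates along antidiagonals to all indices.
  have hl := localOrder_expo_expo (m := -1) (n := 1) (r := 1) (t := 0) (by norm_num)
  rw [add_zero, pow_one] at hl
  have hstep := hl.anticomm_shift
  induction i using Int.induction_on generalizing j with
  | zero => rw [h0, zero_add]
  | succ i ih => rw [hstep, ih, add_right_comm, add_assoc]
  | pred i ih =>
    have h1 := hstep (-i - 1) (j - 1)
    rw [sub_add_cancel, sub_add_cancel, ih] at h1
    rw [← h1]
    congr 2; ring

theorem mode_partialD (a : LatticeSpace) (n : ℤ) :
    vertexOps.mode (partialD a) n = -(n : ℂ) • vertexOps.mode a (n - 1) := by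
  rw [← translation_eq]
  exact isVertexSuperalgebra.mode_translation a n

theorem anticomm_partialD_self (i j : ℤ) :
    vertexOps.mode (partialD (expo 1)) i * vertexOps.mode (partialD (expo 1)) j +
      vertexOps.mode (partialD (expo 1)) j * vertexOps.mode (partialD (expo 1)) i = 0 := by
  rw [mode_partialD, mode_partialD]
  exact anticomm_smul (anticomm_self (by norm_num) _ _) _ _

/-- The derivative contributes `-j` and shifts the support to `i + j = 0`, where `-j = i`: the
relation of the symplectic fermions. -/
theorem anticomm_expo_partialD (i j : ℤ) :
    vertexOps.mode (expo (-1)) i * vertexOps.mode (partialD (expo 1)) j +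
      vertexOps.mode (partialD (expo 1)) j * vertexOps.mode (expo (-1)) i =
      if i + j = 0 then (i : ℂ) • 1 else 0 := by
  simp only [mode_partialD, smul_mul_assoc, mul_smul_comm]
  rw [← smul_add, anticomm_expo]
  by_cases h : i + j = 0
  · rw [if_pos h, if_pos (by omega)]
    obtain rfl : i = -j := by omega
    push_cast; rfl
  · rw [if_neg h, if_neg (by omega), smul_zero]

end LatticeVA

/-! ### The free field realization. -/

namespace SymplecticFermions

open CliffordAlgebra FormalModes VertexOps
open LatticeVA (expo partialD anticomm_self anticomm_expo anticomm_expo_partialD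
  anticomm_partialD_self mode_partialD expo_odd)

/-- The state of the lattice vertex superalgebra that corresponds to a creation mode. -/
def creatorState : FermionModes →ₗ[ℂ] LatticeSpace :=
  Finsupp.linearCombination ℂ (Sum.elim
    (fun k : ℕ => LatticeVA.vertexOps.mode (expo (-1)) (-1 - k) 1)
    (fun k : ℕ => LatticeVA.vertexOps.mode (partialD (expo 1)) (-1 - k) 1))

/-- The operator on the lattice vertex superalgebra that corresponds to a creation mode. -/
def creatorImage (w : FermionModes) : Module.End ℂ LatticeSpace :=
  LatticeVA.vertexOps.mode (creatorState w) (-1)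

theorem mode_creatorState_inl (k : ℕ) (n : ℤ) :
    LatticeVA.vertexOps.mode (creatorState (Finsupp.single (Sum.inl k) 1)) n =
      (((-1) ^ k * Ring.choose n k : ℤ) : ℂ) • LatticeVA.vertexOps.mode (expo (-1)) (n - k) := by
  rw [creatorState, Finsupp.linearCombination_single, one_smul]
  exact LatticeVA.isVertexSuperalgebra.mode_mode_vac _ k n

theorem mode_creatorState_inr (k : ℕ) (n : ℤ) :
    LatticeVA.vertexOps.mode (creatorState (Finsupp.single (Sum.inr k) 1)) n =
      (((-1) ^ k * Ring.choose n k : ℤ) : ℂ) •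
        LatticeVA.vertexOps.mode (partialD (expo 1)) (n - k) := by
  rw [creatorState, Finsupp.linearCombination_single, one_smul]
  exact LatticeVA.isVertexSuperalgebra.mode_mode_vac _ k n

/-- Makes the `(-1)`-mode of the `k`-th divided derivative of a state equal to its `(-1-k)`-mode,
without a scalar. -/
theorem choose_neg_one (k : ℕ) : (((-1) ^ k * Ring.choose (-1 : ℤ) k : ℤ) : ℂ) = 1 := by
  have h : ((-1) ^ k * Ring.choose (-1 : ℤ) k : ℤ) = 1 := by
    induction k with
    | zero => simp
    | succ k ih =>
      have h1 := Ring.choose_succ_succ (-1 : ℤ) k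
      rw [neg_add_cancel, Ring.choose_zero_succ] at h1
      rw [pow_succ, show Ring.choose (-1 : ℤ) (k + 1) = -Ring.choose (-1) k by linarith]
      linarith
  rw [h, Int.cast_one]

theorem creatorImage_inl (k : ℕ) : creatorImage (Finsupp.single (Sum.inl k) 1) =
    LatticeVA.vertexOps.mode (expo (-1)) (-1 - k) := by
  rw [creatorImage, mode_creatorState_inl, choose_neg_one, one_smul]

theorem creatorImage_inr (k : ℕ) : creatorImage (Finsupp.single (Sum.inr k) 1) =
    LatticeVA.vertexOps.mode (partialD (expo 1)) (-1 - k) := by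
  rw [creatorImage, mode_creatorState_inr, choose_neg_one, one_smul]

/-- `creatorImage` as a linear map. -/
def creatorImageHom : FermionModes →ₗ[ℂ] Module.End ℂ LatticeSpace where
  toFun := creatorImage
  map_add' w w' := by rw [creatorImage, map_add, mode_add]; rfl
  map_smul' c w := by rw [creatorImage, map_smul, mode_smul]; rfl

/-- Linear identities for anticommutators with creation modes may be checked on generators. -/
theorem creatorImage_anticomm (T : Module.End ℂ LatticeSpace) (d : Module.Dual ℂ FermionModes)
    (h : ∀ i, T * creatorImage (Finsupp.single i 1) + creatorImage (Finsupp.single i 1) * T =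
      d (Finsupp.single i 1) • 1) (w : FermionModes) :
    T * creatorImage w + creatorImage w * T = d w • 1 := by
  have e : LinearMap.mulLeft ℂ T ∘ₗ creatorImageHom + LinearMap.mulRight ℂ T ∘ₗ creatorImageHom =
      (LinearMap.toSpanSingleton ℂ (Module.End ℂ LatticeSpace) 1) ∘ₗ d :=
    Finsupp.lhom_ext' fun i => LinearMap.ext_ring (h i)
  exact LinearMap.congr_fun e w

/-- Creation modes have negative indices, whose sum is never `0`, so the central term is absent and
the universal property of the exterior algebra applies. -/
theorem creatorImage_creatorImage (w w' : FermionModes) :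
    creatorImage w * creatorImage w' + creatorImage w' * creatorImage w = 0 := by
  have h : ∀ i i' : ℕ ⊕ ℕ,
      creatorImage (Finsupp.single i 1) * creatorImage (Finsupp.single i' 1) +
      creatorImage (Finsupp.single i' 1) * creatorImage (Finsupp.single i 1) = 0 := by
    rintro (k | k) (l | l)
    · rw [creatorImage_inl, creatorImage_inl, anticomm_self (by norm_num)]
    · rw [creatorImage_inl, creatorImage_inr, anticomm_expo_partialD, if_neg (by omega)]
    · rw [creatorImage_inl, creatorImage_inr, add_comm, anticomm_expo_partialD, if_neg (by omega)]
    · rw [creatorImage_inr, creatorImage_inr, anticomm_partialD_self]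
  have h1 : ∀ i w, creatorImage (Finsupp.single i 1) * creatorImage w +
      creatorImage w * creatorImage (Finsupp.single i 1) = 0 := fun i w => by
    have := creatorImage_anticomm (creatorImage (Finsupp.single i 1)) 0
      (fun i' => by rw [h]; simp) w
    simpa using this
  have := creatorImage_anticomm (creatorImage w) 0 (fun i => by rw [add_comm, h1]; simp) w'
  simpa using this

theorem creatorImage_mul_self (w : FermionModes) : creatorImage w * creatorImage w = 0 := by
  have h : (2 : ℂ) • (creatorImage w * creatorImage w) = 0 := by
    rw [two_smul, creatorImage_creatorImage]
  exact (smul_eq_zero.mp h).resolve_left two_ne_zero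

/-- The action of creation modes on the lattice vertex superalgebra. -/
def operatorRealization : FermionSpace →ₐ[ℂ] Module.End ℂ LatticeSpace :=
  ExteriorAlgebra.lift ℂ ⟨creatorImageHom, creatorImage_mul_self⟩

/-- The free field realization of the symplectic fermions in the lattice vertex superalgebra. -/
def realization : FermionSpace →ₗ[ℂ] LatticeSpace :=
  LinearMap.applyₗ (1 : LatticeSpace) ∘ₗ operatorRealization.toLinearMap

theorem operatorRealization_ι (w : FermionModes) :
    operatorRealization (ExteriorAlgebra.ι ℂ w) = creatorImage w :=
  ExteriorAlgebra.lift_ι_apply ℂ creatorImageHom creatorImage_mul_self w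

theorem realization_algebraMap (r : ℂ) : realization (algebraMap ℂ FermionSpace r) = r • 1 := by
  change operatorRealization (algebraMap ℂ FermionSpace r) 1 = _
  rw [AlgHom.commutes, Module.algebraMap_end_apply]

theorem realization_one : realization 1 = 1 := by
  have := realization_algebraMap 1
  rwa [map_one, one_smul] at this

theorem realization_ι_mul (w : FermionModes) (x : FermionSpace) :
    realization (CliffordAlgebra.ι 0 w * x) = creatorImage w (realization x) := by
  change operatorRealization (ExteriorAlgebra.ι ℂ w * x) 1 = _
  rw [map_mul, operatorRealization_ι]
  rfl

theorem realization_ι (w : FermionModes) : realization (CliffordAlgebra.ι 0 w) = creatorState w := by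
  rw [← mul_one (CliffordAlgebra.ι 0 w), realization_ι_mul, realization_one]
  exact LatticeVA.isVertexSuperalgebra.creation _

/-- An operator that kills the vacuum and has scalar anticommutators with the creation modes obeys
the recursion that defines the contraction. -/
theorem realization_contractLeft {T : Module.End ℂ LatticeSpace} {d : Module.Dual ℂ FermionModes}
    (hT : T 1 = 0)
    (h : ∀ i, T * creatorImage (Finsupp.single i 1) + creatorImage (Finsupp.single i 1) * T =
      d (Finsupp.single i 1) • 1) (x : FermionSpace) :
    realization (contractLeft (Q := (0 : QuadraticForm ℂ FermionModes)) d x) =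
      T (realization x) := by
  induction x using CliffordAlgebra.left_induction with
  | algebraMap r =>
    rw [contractLeft_algebraMap, map_zero, realization_algebraMap, map_smul, hT, smul_zero]
  | add x y hx hy => rw [map_add, map_add, hx, hy, map_add, map_add]
  | ι_mul x w hx =>
    have h1 := LinearMap.congr_fun (creatorImage_anticomm T d h w) (realization x)
    rw [LinearMap.add_apply, LinearMap.smul_apply, Module.End.mul_apply, Module.End.mul_apply,
      Module.End.one_apply] at h1
    rw [contractLeft_ι_mul, map_sub, map_smul, realization_ι_mul, hx, realization_ι_mul, ← h1,
      add_sub_cancel_right]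

theorem realization_psi (n : ℤ) (x : FermionSpace) :
    realization (psi n x) = LatticeVA.vertexOps.mode (expo (-1)) n (realization x) := by
  match n with
  | Int.negSucc k =>
    change realization (CliffordAlgebra.ι 0 _ * x) = _
    rw [realization_ι_mul, creatorImage_inl, Int.negSucc_eq]
    congr 2; ring
  | Int.ofNat n =>
    refine Eq.trans ?_ (realization_contractLeft (d := (n : ℂ) • Finsupp.lapply (Sum.inr (n - 1)))
      (LatticeVA.isVertexSuperalgebra.regular _ _ (Int.natCast_nonneg n)) ?_ x)
    · rw [map_smul]; rfl
    · rintro (k | k)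
      · rw [creatorImage_inl, anticomm_self (by norm_num)]
        simp
      · rw [creatorImage_inr, anticomm_expo_partialD]
        -- For `n = 0` the truncated index `n - 1` is harmless: the functional has the factor `n =
        -- 0`.
        rcases n with - | n
        · rw [if_neg (by simp; omega)]
          simp
        · by_cases h : k = n
          · subst h
            rw [if_pos (by simp; ring)]
            simp
          · rw [if_neg (by simp; omega)]
            simp [h]

theorem realization_psiStar (n : ℤ) (x : FermionSpace) :
    realization (psiStar n x) =
      LatticeVA.vertexOps.mode (partialD (expo 1)) n (realization x) := by
  match n with
  | Int.negSucc k =>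
    change realization (CliffordAlgebra.ι 0 _ * x) = _
    rw [realization_ι_mul, creatorImage_inr, Int.negSucc_eq]
    congr 2; ring
  | Int.ofNat n =>
    refine Eq.trans ?_ (realization_contractLeft (d := (-n : ℂ) • Finsupp.lapply (Sum.inl (n - 1)))
      (LatticeVA.isVertexSuperalgebra.regular _ _ (Int.natCast_nonneg n)) ?_ x)
    · rw [map_smul]; rfl
    · rintro (k | k)
      · rw [creatorImage_inl, add_comm, anticomm_expo_partialD]
        rcases n with - | n
        · rw [if_neg (by simp; omega)]
          simp
        · by_cases h : k = n
          · subst h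
            rw [if_pos (by simp; ring)]
            simp
            ring_nf
          · rw [if_neg (by simp; omega)]
            simp [h]
      · rw [creatorImage_inr, anticomm_partialD_self]
        simp

theorem realization_fieldMode (n : ℤ) (w : FermionModes) (x : FermionSpace) :
    realization (fieldMode n w x) =
      LatticeVA.vertexOps.mode (creatorState w) n (realization x) := by
  induction w using Finsupp.induction_linear with
  | zero => simp [mode_zero]
  | add w w' hw hw' =>
    rw [map_add, LinearMap.add_apply, map_add, hw, hw', map_add, mode_add]; rfl
  | single i c =>
    rw [← mul_one c, ← smul_eq_mul, ← Finsupp.smul_single, map_smul, map_smul, mode_smul,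
      LinearMap.smul_apply, map_smul, Pi.smul_apply, LinearMap.smul_apply, fieldMode,
      Finsupp.linearCombination_single, one_smul]
    congr 1
    rcases i with k | k
    · rw [genMode, LinearMap.smul_apply, map_smul, realization_psi, mode_creatorState_inl]; rfl
    · rw [genMode, LinearMap.smul_apply, map_smul, realization_psiStar, mode_creatorState_inr]; rfl

end SymplecticFermions

namespace SymplecticFermions

open CliffordAlgebra FormalModes VertexOps

/-! ## Injectivity of the realization -/

theorem annihilator_ι_mul (i : ℕ ⊕ ℕ) (w : FermionModes) (x : FermionSpace) :
    annihilator i (CliffordAlgebra.ι 0 w * x) =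
      w i • x - CliffordAlgebra.ι 0 w * annihilator i x :=
  contractLeft_ι_mul ..

theorem creator_mul_self (i : ℕ ⊕ ℕ) : creator i * creator i = 0 :=
  ExteriorAlgebra.ι_sq_zero _

/-- The product of the operators `1 - e_i ∂_i` along a list of indices. -/
def project : List (ℕ ⊕ ℕ) → FermionSpace → FermionSpace
  | [], x => x
  | i :: l, x => project l (x - creator i * annihilator i x)

theorem project_add (l : List (ℕ ⊕ ℕ)) (x y : FermionSpace) :
    project l (x + y) = project l x + project l y := by
  induction l generalizing x y with
  | nil => rfl
  | cons i l ih =>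
    rw [project, project, project, ← ih, map_add, mul_add]
    congr 1; abel

theorem project_smul (l : List (ℕ ⊕ ℕ)) (c : ℂ) (x : FermionSpace) :
    project l (c • x) = c • project l x := by
  induction l generalizing x with
  | nil => rfl
  | cons i l ih =>
    rw [project, project, ← ih, map_smul, mul_smul_comm, smul_sub]

theorem project_eq_self {x : FermionSpace} (h : ∀ i, annihilator i x = 0) (l : List (ℕ ⊕ ℕ)) :
    project l x = x := by
  induction l with
  | nil => rfl
  | cons i l ih => rw [project, h, mul_zero, sub_zero, ih]

theorem project_zero (l : List (ℕ ⊕ ℕ)) : project l 0 = 0 :=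
  project_eq_self (fun _ => map_zero _) l

/-- The factor `1 - e_i ∂_i` kills everything of the form `e_i x` and commutes with left
multiplication by `e_j` for `j ≠ i`, so `e_j` moves through the list until it meets its own factor.
-/
theorem project_creator_mul {j : ℕ ⊕ ℕ} {l : List (ℕ ⊕ ℕ)} (hj : j ∈ l) (x : FermionSpace) :
    project l (creator j * x) = 0 := by
  induction l generalizing x with
  | nil => cases hj
  | cons i l ih =>
    have h : annihilator i (creator j * x) =
        (Finsupp.single j 1 : FermionModes) i • x - creator j * annihilator i x :=
      annihilator_ι_mul i _ x
    rw [project, h]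
    by_cases hij : i = j
    · subst hij
      rw [Finsupp.single_eq_same, one_smul, mul_sub, ← mul_assoc (creator i) (creator i),
        creator_mul_self, zero_mul, sub_zero, sub_self, project_zero]
    · have hs : creator i * creator j = -(creator j * creator i) :=
        eq_neg_of_add_eq_zero_left (ExteriorAlgebra.ι_add_mul_swap _ _)
      rw [Finsupp.single_eq_of_ne hij, zero_smul, zero_sub, mul_neg, sub_neg_eq_add, ← mul_assoc, hs,
        neg_mul, ← sub_eq_add_neg, mul_assoc, ← mul_sub]
      exact ih ((List.mem_cons.mp hj).resolve_left fun h => hij h.symm) _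

theorem ι_eq_sum (w : FermionModes) :
    (CliffordAlgebra.ι (0 : QuadraticForm ℂ FermionModes) w : FermionSpace) =
      w.sum fun j c => c • creator j := by
  conv_lhs => rw [← Finsupp.sum_single w]
  rw [map_finsuppSum]
  refine Finsupp.sum_congr fun j _ => ?_
  rw [creator, ← map_smul, Finsupp.smul_single, smul_eq_mul, mul_one]

/-- A long enough list retains only the scalar term. Quantifying over all lists that contain `S`
lets the finite sets for two summands be merged. -/
theorem exists_project_eq (x : FermionSpace) : ∃ (r : ℂ) (S : Finset (ℕ ⊕ ℕ)),
    ∀ l : List (ℕ ⊕ ℕ), (∀ i ∈ S, i ∈ l) → project l x = algebraMap ℂ FermionSpace r := by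
  induction x using CliffordAlgebra.left_induction with
  | algebraMap r => exact ⟨r, ∅, fun l _ => project_eq_self (fun i => contractLeft_algebraMap ..) l⟩
  | add x y hx hy =>
    obtain ⟨r, S, hS⟩ := hx
    obtain ⟨r', S', hS'⟩ := hy
    classical
    exact ⟨r + r', S ∪ S', fun l hl => by
      rw [project_add, map_add, hS l fun i hi => hl i (Finset.mem_union_left _ hi),
        hS' l fun i hi => hl i (Finset.mem_union_right _ hi)]⟩
  | ι_mul x w _ =>
    refine ⟨0, w.support, fun l hl => ?_⟩
    rw [ι_eq_sum, Finsupp.sum, Finset.sum_mul, map_zero]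
    refine Finset.sum_induction _ (fun y => project l y = 0) (fun y z hy hz => ?_) (project_zero l)
      fun j hj => ?_
    · rw [project_add, hy, hz, add_zero]
    · rw [smul_mul_assoc, project_smul, project_creator_mul (hl j hj), smul_zero]

/-- Such an element is fixed by every projection, and a suitable projection makes it scalar. -/
theorem eq_algebraMap_of_annihilator {x : FermionSpace} (h : ∀ i, annihilator i x = 0) :
    ∃ r, x = algebraMap ℂ FermionSpace r := by
  obtain ⟨r, S, hS⟩ := exists_project_eq x
  exact ⟨r, by rw [← hS S.toList fun i hi => Finset.mem_toList.mpr hi, project_eq_self h]⟩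

theorem exists_annihilator_eq_zero (x : FermionSpace) :
    ∃ S : Finset (ℕ ⊕ ℕ), ∀ i ∉ S, annihilator i x = 0 := by
  classical
  induction x using CliffordAlgebra.left_induction with
  | algebraMap r => exact ⟨∅, fun i _ => contractLeft_algebraMap ..⟩
  | add x y hx hy =>
    obtain ⟨S, hS⟩ := hx
    obtain ⟨S', hS'⟩ := hy
    exact ⟨S ∪ S', fun i hi => by
      rw [Finset.notMem_union] at hi
      rw [map_add, hS i hi.1, hS' i hi.2, add_zero]⟩
  | ι_mul x w hx =>
    obtain ⟨S, hS⟩ := hx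
    exact ⟨S ∪ w.support, fun i hi => by
      rw [Finset.notMem_union] at hi
      rw [annihilator_ι_mul, hS i hi.1, Finsupp.notMem_support_iff.mp hi.2, zero_smul, mul_zero,
        sub_zero]⟩

/-- A subspace that is stable under all odd derivatives and contains no scalars vanishes. -/
theorem eq_zero_of_stable {K : Submodule ℂ FermionSpace}
    (hK : ∀ i, ∀ x ∈ K, annihilator i x ∈ K)
    (h1 : ∀ r, algebraMap ℂ FermionSpace r ∈ K → r = 0) {x : FermionSpace} (hx : x ∈ K) : x = 0 := by
  classical
  obtain ⟨S, hS⟩ := exists_annihilator_eq_zero x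
  have h0 : ∀ x ∈ K, (∀ i, annihilator i x = 0) → x = 0 := by
    intro x hx h
    obtain ⟨r, rfl⟩ := eq_algebraMap_of_annihilator h
    rw [h1 r hx, map_zero]
  -- Induction on a finite set containing all indices with nonzero derivative. Since `∂_s² = 0` and
  -- distinct derivatives anticommute, `∂_s x` needs only the smaller set, so it vanishes; then so
  -- does `x`.
  induction S using Finset.induction_on generalizing x with
  | empty => exact h0 x hx fun i => hS i (Finset.notMem_empty i)
  | insert s S _ ih =>
    refine ih hx fun i hi => ?_
    by_cases his : i = s
    · subst his
      refine ih (hK i x hx) fun j hj => ?_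
      by_cases hji : j = i
      · subst hji
        exact contractLeft_contractLeft ..
      · have : annihilator j (annihilator i x) = -annihilator i (annihilator j x) :=
          contractLeft_comm ..
        rw [this, hS j (by simp [hji, hj]), map_zero, neg_zero]
    · exact hS i (by simp [his, hi])

/-- The kernel is stable under the odd derivatives because these are nonzero multiples of the
positive modes `ψ*_(k+1)` and `ψ_(k+1)`, which the realization intertwines. It contains no nonzero
scalar because the vacuum is mapped to the vacuum. -/
theorem realization_injective : Function.Injective realization := by
  rw [← LinearMap.ker_eq_bot, eq_bot_iff]
  intro x hx
  refine eq_zero_of_stable (K := LinearMap.ker realization) (fun i x hx => ?_) (fun r hr => ?_) hx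
  · rw [LinearMap.mem_ker] at hx ⊢
    rcases i with k | k
    · have h := realization_psiStar (k + 1 : ℕ) x
      change realization ((-(k + 1 : ℕ) : ℂ) • annihilator (Sum.inl k) x) = _ at h
      rw [hx, map_zero, map_smul] at h
      refine (smul_eq_zero.mp h).resolve_left (neg_ne_zero.mpr (Nat.cast_ne_zero.mpr (Nat.succ_ne_zero k)))
    · have h := realization_psi (k + 1 : ℕ) x
      change realization (((k + 1 : ℕ) : ℂ) • annihilator (Sum.inr k) x) = _ at h
      rw [hx, map_zero, map_smul] at h
      refine (smul_eq_zero.mp h).resolve_left (Nat.cast_ne_zero.mpr (Nat.succ_ne_zero k))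
  · rw [LinearMap.mem_ker, realization_algebraMap] at hr
    refine (smul_eq_zero.mp hr).resolve_right ?_
    rw [← LatticeVA.expo_zero, LatticeVA.expo]
    exact fun h => one_ne_zero (AddMonoidAlgebra.single_eq_zero.mp h)

/-! ## Parity -/

theorem creatorState_odd (w : FermionModes) : creatorState w ∈ LatticeVA.vertexOps.parity 1 := by
  have hc : LatticeVA.vertexOps.vac ∈ LatticeVA.vertexOps.parity 0 :=
    LatticeVA.isVertexSuperalgebra.vac_even
  have hm : ∀ {a : LatticeSpace} (n : ℤ), a ∈ LatticeVA.vertexOps.parity 1 →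
      LatticeVA.vertexOps.mode a n 1 ∈ LatticeVA.vertexOps.parity 1 := by
    intro a n ha
    have := LatticeVA.mode_mem_parity n ha hc
    rwa [add_zero] at this
  rw [creatorState, Finsupp.linearCombination_apply]
  refine Submodule.sum_mem _ fun i _ => Submodule.smul_mem _ _ ?_
  rcases i with k | k
  · exact hm _ (LatticeVA.expo_odd (by decide))
  · refine hm _ ?_
    rw [← LatticeVA.translation_eq]
    exact LatticeVA.isVertexSuperalgebra.translation_mem (LatticeVA.expo_odd (by decide))

theorem realization_ι_mul_mem {w : FermionModes} {x : FermionSpace} {i : ZMod 2}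
    (hx : realization x ∈ LatticeVA.vertexOps.parity i) :
    realization (CliffordAlgebra.ι 0 w * x) ∈ LatticeVA.vertexOps.parity (1 + i) := by
  rw [realization_ι_mul]
  exact LatticeVA.mode_mem_parity (-1) (creatorState_odd w) hx

theorem two_eq_zero : (1 + 1 : ZMod 2) = 0 := by decide

theorem realization_mem {i : ZMod 2} {x : FermionSpace} (hx : x ∈ vertexOps.parity i) :
    realization x ∈ LatticeVA.vertexOps.parity i := by
  have h : ∀ i : ZMod 2, i = 0 ∨ i = 1 := by decide
  have hstep : ∀ {i : ZMod 2} {w w' : FermionModes} {x : FermionSpace},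
      realization x ∈ LatticeVA.vertexOps.parity i →
      realization (CliffordAlgebra.ι 0 w * CliffordAlgebra.ι 0 w' * x) ∈
        LatticeVA.vertexOps.parity i := by
    intro i w w' x hx
    rw [mul_assoc]
    have := realization_ι_mul_mem (w := w) (realization_ι_mul_mem (w := w') hx)
    rwa [← add_assoc, two_eq_zero, zero_add] at this
  rcases h i with rfl | rfl
  · change x ∈ evenOdd _ 0 at hx
    induction x, hx using CliffordAlgebra.even_induction with
    | algebraMap r =>
      rw [realization_algebraMap]
      exact Submodule.smul_mem _ _ LatticeVA.isVertexSuperalgebra.vac_even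
    | add x y _ _ hx hy => rw [map_add]; exact add_mem hx hy
    | ι_mul_ι_mul w w' x _ hx => exact hstep hx
  · change x ∈ evenOdd _ 1 at hx
    induction x, hx using CliffordAlgebra.odd_induction with
    | ι w => rw [realization_ι]; exact creatorState_odd w
    | add x y _ _ hx hy => rw [map_add]; exact add_mem hx hy
    | ι_mul_ι_mul w w' x _ hx => exact hstep hx

theorem parity_isCompl : IsCompl (vertexOps.parity 0) (vertexOps.parity 1) :=
  evenOdd_isCompl _

theorem realization_mem_iff {i : ZMod 2} {x : FermionSpace} :
    realization x ∈ LatticeVA.vertexOps.parity i ↔ x ∈ vertexOps.parity i := by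
  refine ⟨fun hx => ?_, realization_mem⟩
  obtain ⟨y, hy, z, hz, rfl⟩ : ∃ y ∈ vertexOps.parity i, ∃ z ∈ vertexOps.parity (i + 1), y + z = x := by
    have h : ∀ i : ZMod 2, i = 0 ∨ i = 1 := by decide
    have hx : x ∈ vertexOps.parity 0 ⊔ vertexOps.parity 1 := by
      rw [parity_isCompl.sup_eq_top]; trivial
    rcases h i with rfl | rfl
    · exact Submodule.mem_sup.mp (by rwa [zero_add])
    · exact Submodule.mem_sup.mp (by rwa [two_eq_zero, sup_comm])
  rw [map_add] at hx
  -- The image of the component `z` of the wrong parity is homogeneous of both parities, hence zero,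
  -- and injectivity gives `z = 0`.
  have h1 := sub_mem hx (realization_mem hy)
  rw [add_sub_cancel_left] at h1
  have h2 := (LatticeVA.isVertexSuperalgebra.eq_zero_of_add_eq_zero h1
    (neg_mem (realization_mem hz)) (add_neg_cancel _)).1
  have h3 : z = 0 := realization_injective (h2.trans (map_zero _).symm)
  rw [h3, add_zero]
  exact hy

end SymplecticFermions

namespace SymplecticFermions

open CliffordAlgebra FormalModes VertexOps

/-! ## Compatibility of the realization with the products -/

theorem mode_apply (a b : FermionSpace) (n : ℤ) :
    vertexOps.mode a n b = (field a b).coeff (-n - 1) := rfl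

theorem field_ι_mul (w : FermionModes) (u : FermionSpace) :
    field (CliffordAlgebra.ι 0 w * u) = normalOrder w (field u) := by
  rw [field, foldr_mul, foldr_ι]

theorem field_algebraMap (r : ℂ) (b : FermionSpace) :
    field (algebraMap ℂ FermionSpace r) b = r • HahnSeries.single 0 b := by
  rw [field, foldr_algebraMap]
  rfl

theorem parityInv_of_mem {i : ZMod 2} {x : FermionSpace} (hx : x ∈ vertexOps.parity i) :
    parityInv x = sgn 1 i • x := by
  have h : ∀ i : ZMod 2, i = 0 ∨ i = 1 := by decide
  rcases h i with rfl | rfl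
  · rw [show sgn 1 0 = 1 by simp [sgn], one_smul]
    exact involute_eq_of_mem_even hx
  · rw [show sgn 1 1 = -1 by simp [sgn, ZMod.val_one], neg_one_smul]
    exact involute_eq_of_mem_odd hx

/-- The realization intertwines all products with the state `u`. -/
def Intertwines (u : FermionSpace) : Prop := ∀ (n : ℤ) (b : FermionSpace),
  realization (vertexOps.mode u n b) =
    LatticeVA.vertexOps.mode (realization u) n (realization b)

theorem parityInv_mode_parityInv {j : ZMod 2} {u : FermionSpace} (hu : u ∈ vertexOps.parity j)
    (h : Intertwines u) (n : ℤ) (x : FermionSpace) :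
    parityInv (vertexOps.mode u n (parityInv x)) = sgn 1 j • vertexOps.mode u n x := by
  have key : ∀ i, ∀ x ∈ vertexOps.parity i,
      parityInv (vertexOps.mode u n (parityInv x)) = sgn 1 j • vertexOps.mode u n x := by
    intro i x hx
    -- The parity of the product is imported from the lattice side, since the axioms for the
    -- fermions are not yet known.
    have h1 : vertexOps.mode u n x ∈ vertexOps.parity (j + i) := by
      rw [← realization_mem_iff, h]
      exact LatticeVA.mode_mem_parity n (realization_mem hu) (realization_mem hx)
    rw [parityInv_of_mem hx, map_smul, map_smul, parityInv_of_mem h1, smul_smul, sgn_comm 1 (j + i),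
      sgn_add_left, sgn_comm j, sgn_comm i, mul_left_comm, sgn_mul_self, mul_one]
  have hx : x ∈ vertexOps.parity 0 ⊔ vertexOps.parity 1 := by
    rw [parity_isCompl.sup_eq_top]; trivial
  obtain ⟨y, hy, z, hz, rfl⟩ := Submodule.mem_sup.mp hx
  simp only [map_add, key 0 y hy, key 1 z hz, smul_add]

theorem realization_fieldMode_neg_mul (l : ℕ) (w : FermionModes) (y : FermionSpace) :
    realization (fieldMode (-1 - l) w 1 * y) =
      LatticeVA.vertexOps.mode (creatorState w) (-1 - l) (realization y) := by
  obtain ⟨u, hu⟩ := exists_creator l w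
  rw [← realization_fieldMode, hu, LinearMap.mulLeft_apply, LinearMap.mulLeft_apply, mul_one]

/-- Conjugation by the parity involution in `annihilationTerm` supplies the sign of the normally
ordered product. -/
theorem coeff_annihilationTerm {j : ZMod 2} {u : FermionSpace} (hu : u ∈ vertexOps.parity j)
    (h : Intertwines u) (w : FermionModes) (l : ℕ) (n : ℤ) (b : FermionSpace) :
    realization ((annihilationTerm w (field u) l b).coeff (-n - 1)) =
      sgn 1 j • LatticeVA.vertexOps.mode (realization u) (n - 1 - l)
        (LatticeVA.vertexOps.mode (creatorState w) (0 + l) (realization b)) := by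
  have e : (annihilationTerm w (field u) l b).coeff (-n - 1) =
      parityInv (vertexOps.mode u (n - 1 - l) (parityInv (fieldMode l w b))) := by
    rw [annihilationTerm, monomial, HahnSeries.coeff_single_mul, one_mul, mode_apply]
    change parityInv (HahnSeries.coeff _ _) = _
    congr 2; ring
  rw [e, parityInv_mode_parityInv hu h, map_smul, h, realization_fieldMode, zero_add]

theorem coeff_finset_sum (s : Finset ℕ) (f : ℕ → FermionSeries) (p : ℤ) :
    (∑ l ∈ s, f l).coeff p = ∑ l ∈ s, (f l).coeff p :=
  map_sum (HahnSeries.coeff.addMonoidHom p) f s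

/-- The field of `w ∧ u` is a normally ordered product by construction for the fermions and by
`mode_normalProd` for the lattice. The creation and annihilation halves are compared term by term;
`u` must be homogeneous for the sign to make sense. -/
theorem intertwines_ι_mul {j : ZMod 2} {u : FermionSpace} (hu : u ∈ vertexOps.parity j)
    (h : Intertwines u) (w : FermionModes) : Intertwines (CliffordAlgebra.ι 0 w * u) := by
  intro n b
  rw [realization_ι_mul, creatorImage, LatticeVA.isVertexSuperalgebra.mode_normalProd
    (creatorState_odd w) (realization_mem hu), normalProd, LinearMap.add_apply, LinearMap.smul_apply]
  obtain ⟨N, hN⟩ := vertexOps.isField_mode u b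
  obtain ⟨M, hM⟩ := exists_bound w b
  -- The truncation bounds are carried over from the fermions, so that both sides are finite sums
  -- over the same ranges.
  have hN' : ∀ m, N ≤ m → LatticeVA.vertexOps.mode (realization u) m (realization b) = 0 := by
    intro m hm
    rw [← h, hN m hm, map_zero]
  have hM' : ∀ m : ℤ, (M : ℤ) ≤ m →
      LatticeVA.vertexOps.mode (creatorState w) m (realization b) = 0 := by
    intro m hm
    lift m to ℕ using by omega
    rw [← realization_fieldMode, hM m (by exact_mod_cast hm), map_zero]
  rw [half_eq_sum _ 0 n _ hN' (K := (N - n).toNat) (by omega),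
    half_eq_sum _ n 0 _ hM' (K := M) (by omega), mode_apply, field_ι_mul]
  have e : normalOrder w (field u) b = creationPart w * field u b +
      ∑ l ∈ Finset.range M, annihilationTerm w (field u) l b := by
    change creationPart w * field u b + ∑ᶠ l : ℕ, annihilationTerm w (field u) l b = _
    congr 1
    refine finsum_eq_sum_of_support_subset _ fun l hl => ?_
    by_contra hlt
    exact hl (annihilationTerm_eq_zero w _ l b (hM l (by simpa using hlt)))
  rw [e, HahnSeries.coeff_add, map_add, coeff_finset_sum, map_sum, Finset.smul_sum]
  congr 1
  · rw [creationPart, LatticeVA.coeff_ofPowerSeries_mul _ _ _ (N - n).toNat, map_sum]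
    · refine Finset.sum_congr rfl fun l _ => ?_
      rw [PowerSeries.coeff_mk, realization_fieldMode_neg_mul, ← h, mode_apply,
        show -(n + (l : ℤ)) - 1 = -n - 1 - l by ring, zero_sub]
    · intro i hi
      have := hN (-i - 1) (by omega)
      rwa [mode_apply, show -(-i - 1) - 1 = i by ring] at this
  · exact Finset.sum_congr rfl fun l _ => coeff_annihilationTerm hu h w l n b

theorem Intertwines.add {u v : FermionSpace} (hu : Intertwines u) (hv : Intertwines v) :
    Intertwines (u + v) := fun n b => by
  rw [mode_add, Pi.add_apply, LinearMap.add_apply, map_add, hu, hv, map_add, mode_add]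
  rfl

theorem intertwines_algebraMap (r : ℂ) : Intertwines (algebraMap ℂ FermionSpace r) := by
  intro n b
  have h := LatticeVA.isVertexSuperalgebra.vacuum n (realization b)
  change LatticeVA.vertexOps.mode 1 n (realization b) = _ at h
  rw [realization_algebraMap, mode_smul, Pi.smul_apply, LinearMap.smul_apply, h, mode_apply,
    field_algebraMap, HahnSeries.coeff_smul, map_smul]
  congr 1
  by_cases hn : n = -1
  · rw [if_pos hn, hn]
    exact congr_arg _ (HahnSeries.coeff_single_same 0 b)
  · rw [if_neg hn, HahnSeries.coeff_single_of_ne (by omega), map_zero]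

theorem intertwines (u : FermionSpace) : Intertwines u := by
  have hstep : ∀ {i : ZMod 2} {w w' : FermionModes} {x : FermionSpace},
      x ∈ vertexOps.parity i → Intertwines x →
      Intertwines (CliffordAlgebra.ι 0 w * CliffordAlgebra.ι 0 w' * x) := by
    intro i w w' x hx h
    rw [mul_assoc]
    refine intertwines_ι_mul (j := 1 + i) ?_ (intertwines_ι_mul hx h w') w
    rw [← realization_mem_iff]
    exact realization_ι_mul_mem (realization_mem hx)
  have h0 : ∀ x ∈ vertexOps.parity 0, Intertwines x := by
    intro x hx
    change x ∈ evenOdd _ 0 at hx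
    induction x, hx using CliffordAlgebra.even_induction with
    | algebraMap r => exact intertwines_algebraMap r
    | add x y _ _ hx hy => exact hx.add hy
    | ι_mul_ι_mul w w' x hx h => exact hstep (i := 0) hx h
  have h1 : ∀ x ∈ vertexOps.parity 1, Intertwines x := by
    intro x hx
    change x ∈ evenOdd _ 1 at hx
    induction x, hx using CliffordAlgebra.odd_induction with
    | ι w =>
      rw [← mul_one (CliffordAlgebra.ι 0 w), ← map_one (algebraMap ℂ FermionSpace)]
      refine intertwines_ι_mul (j := 0) ?_ (intertwines_algebraMap 1) w
      rw [map_one]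
      exact one_le_evenOdd_zero _ (Submodule.one_le.mp le_rfl)
    | add x y _ _ hx hy => exact hx.add hy
    | ι_mul_ι_mul w w' x hx h => exact hstep (i := 1) hx h
  have hu : u ∈ vertexOps.parity 0 ⊔ vertexOps.parity 1 := by
    rw [parity_isCompl.sup_eq_top]; trivial
  obtain ⟨y, hy, z, hz, rfl⟩ := Submodule.mem_sup.mp hu
  exact (h0 y hy).add (h1 z hz)

/-! ## The image of the realization -/

/-- The sum of the image of the realization and of its translate by the mode of `e^(φ_γ)` that creates
this state. -/
def extendedImage : Submodule ℂ LatticeSpace :=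
  LinearMap.range realization ⊔
    (LinearMap.range realization).map (LatticeVA.vertexOps.mode (LatticeVA.expo 1) (-1))

theorem mem_extendedImage {v : LatticeSpace} : v ∈ extendedImage ↔ ∃ x y : FermionSpace,
    v = realization x + LatticeVA.vertexOps.mode (LatticeVA.expo 1) (-1) (realization y) := by
  rw [extendedImage, Submodule.mem_sup]
  constructor
  · rintro ⟨_, ⟨x, rfl⟩, _, ⟨_, ⟨y, rfl⟩, rfl⟩, rfl⟩
    exact ⟨x, y, rfl⟩
  · rintro ⟨x, y, rfl⟩
    exact ⟨_, ⟨x, rfl⟩, _, ⟨_, ⟨y, rfl⟩, rfl⟩, rfl⟩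

/-- The modes of `e^(φ_(-γ))` are the `ψ_n`. Moving one past the extra mode of `e^(φ_γ)` costs at
most the identity, for `n = 0`. -/
theorem mode_expo_neg_one_mem (n : ℤ) {v : LatticeSpace} (hv : v ∈ extendedImage) :
    LatticeVA.vertexOps.mode (LatticeVA.expo (-1)) n v ∈ extendedImage := by
  obtain ⟨x, y, rfl⟩ := mem_extendedImage.mp hv
  have h := LinearMap.congr_fun (LatticeVA.anticomm_expo n (-1)) (realization y)
  rw [LinearMap.add_apply, Module.End.mul_apply, Module.End.mul_apply, ← realization_psi] at h
  rw [map_add, ← realization_psi, eq_sub_of_add_eq h, mem_extendedImage]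
  by_cases hn : n = 0
  · rw [if_pos (by omega), Module.End.one_apply]
    exact ⟨psi n x + y, -psi n y, by rw [map_add, map_neg, map_neg]; abel⟩
  · rw [if_neg (by omega), LinearMap.zero_apply]
    exact ⟨psi n x, -psi n y, by rw [map_neg, map_neg]; abel⟩

theorem mode_expo_one_mem (n : ℤ) {v : LatticeSpace} (hv : v ∈ extendedImage) :
    LatticeVA.vertexOps.mode (LatticeVA.expo 1) n v ∈ extendedImage := by
  obtain ⟨x, y, rfl⟩ := mem_extendedImage.mp hv
  have h := LinearMap.congr_fun (LatticeVA.anticomm_self (m := 1) (by norm_num) n (-1)) (realization y)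
  rw [LinearMap.add_apply, Module.End.mul_apply, Module.End.mul_apply, LinearMap.zero_apply] at h
  rw [map_add, eq_neg_of_add_eq_zero_left h, mem_extendedImage]
  -- The mode `-1` is the one not obtained from `ψ*`; it takes the image to its translate and
  -- squares to zero.
  by_cases hn : n = -1
  · subst hn
    refine ⟨0, x, ?_⟩
    have h2 : LatticeVA.vertexOps.mode (LatticeVA.expo 1) (-1)
        (LatticeVA.vertexOps.mode (LatticeVA.expo 1) (-1) (realization y)) = 0 :=
      eq_zero_of_eq_neg (eq_neg_of_add_eq_zero_left h)
    rw [h2, neg_zero, add_zero, map_zero, zero_add]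
  -- For `n ≠ -1` the mode of `e^(φ_γ)` is recovered from its derivative: it is `-(n+1)⁻¹ ψ*_(n+1)`.
  · have h0 : (-((n + 1 : ℤ) : ℂ)) ≠ 0 := neg_ne_zero.mpr (Int.cast_ne_zero.mpr (by omega))
    have key : ∀ z, LatticeVA.vertexOps.mode (LatticeVA.expo 1) n (realization z) =
        realization ((-((n + 1 : ℤ) : ℂ))⁻¹ • psiStar (n + 1) z) := by
      intro z
      rw [map_smul, realization_psiStar, LatticeVA.mode_partialD, LinearMap.smul_apply, smul_smul,
        inv_mul_cancel₀ h0, one_smul, add_sub_cancel_right]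
    rw [key, key]
    exact ⟨(-((n + 1 : ℤ) : ℂ))⁻¹ • psiStar (n + 1) x, -((-((n + 1 : ℤ) : ℂ))⁻¹ • psiStar (n + 1) y),
      by rw [map_neg, map_neg]⟩

/-- Neighbouring exponentials are obtained as leading coefficients: the pairing contributes `z^m` or
`z^(-m)`, whence the mode `-1 - m` in each direction. -/
theorem expo_mem_extendedImage (m : ℤ) : LatticeVA.expo m ∈ extendedImage := by
  induction m using Int.induction_on with
  | zero => exact mem_extendedImage.mpr ⟨1, 0, by
      rw [realization_one, map_zero, map_zero, add_zero]; rfl⟩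
  | succ m ih =>
    have := mode_expo_one_mem (-1 - m) ih
    rwa [LatticeVA.mode_expo_expo, show -(-1 - (m : ℤ) + 1 * m) - 1 = 0 by ring,
      LatticeVA.expoCoeff_zero, LatticeVA.expo_mul_expo, add_comm] at this
  | pred m ih =>
    have := mode_expo_neg_one_mem (-1 - m) ih
    rwa [LatticeVA.mode_expo_expo, show -(-1 - (m : ℤ) + -1 * -m) - 1 = 0 by ring,
      LatticeVA.expoCoeff_zero, LatticeVA.expo_mul_expo,
      show -1 + -(m : ℤ) = -m - 1 by ring] at this

/-- Bosonization: the Heisenberg field is the normally ordered product of the exponentials. -/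
theorem boson_zero_eq : LatticeVA.boson 0 =
    -LatticeVA.vertexOps.mode (LatticeVA.expo (-1)) (-1) (LatticeVA.expo 1) := by
  have h := LatticeVA.partialD_expoCoeff (-1) 0
  rw [LatticeVA.expoCoeff_zero, LatticeVA.partialD_expo, Int.cast_zero, zero_add, one_smul] at h
  rw [LatticeVA.mode_expo_expo, show -(-1 + -1 * 1) - 1 = (0 : ℤ) + 1 by ring, ← h, smul_mul_assoc,
    mul_assoc, LatticeVA.expo_mul_expo, neg_add_cancel, LatticeVA.expo_zero, mul_one]
  push_cast
  rw [neg_one_smul, neg_neg]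

/-- Bosonization writes the Heisenberg modes in terms of the two exponentials, whose modes preserve
the subspace; the higher bosons are derivatives. -/
theorem mode_boson_mem (k : ℕ) (n : ℤ) {v : LatticeSpace} (hv : v ∈ extendedImage) :
    LatticeVA.vertexOps.mode (LatticeVA.boson k) n v ∈ extendedImage := by
  induction k generalizing n with
  | zero =>
    rw [boson_zero_eq, ← neg_one_smul ℂ, mode_smul, LatticeVA.isVertexSuperalgebra.mode_normalProd
      (LatticeVA.expo_odd (m := -1) (by decide)) (LatticeVA.expo_odd (m := 1) (by decide))]
    exact Submodule.smul_mem _ _ (normalProd_mem _ _ (fun n x hx => mode_expo_one_mem n hx)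
      (fun n x hx => mode_expo_neg_one_mem n hx) (fun n x hx => mode_expo_neg_one_mem n hx)
      (fun n x hx => mode_expo_one_mem n hx) 0 n hv)
  | succ k ih =>
    rw [LatticeVA.mode_boson_succ]
    exact Submodule.smul_mem _ _ (ih _)

theorem mem_extendedImage_of_top (v : LatticeSpace) : v ∈ extendedImage := by
  induction v using LatticeVA.boson_induction with
  | hadd a b ha hb => exact add_mem ha hb
  | hsmul c a ha => exact Submodule.smul_mem _ _ ha
  | hexpo m => exact expo_mem_extendedImage m
  | hboson k a ha =>
    have h := LatticeVA.mode_boson_neg k 0 a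
    have h2 := mode_boson_mem k (-1 - (0 : ℕ)) ha
    rw [h] at h2
    simpa using h2

theorem range_realization : LinearMap.range realization = LatticeVA.screeningKernel := by
  -- The screening operator is the image of `ψ_0`, which is zero on the vacuum module because its
  -- defining coefficient is `n = 0`.
  have h0 : ∀ x, LatticeVA.vertexOps.mode (LatticeVA.expo (-1)) 0 (realization x) = 0 := by
    intro x
    rw [← realization_psi]
    change realization (((0 : ℕ) : ℂ) • _) = 0
    rw [Nat.cast_zero, zero_smul, map_zero]
  rw [LatticeVA.screeningKernel_eq]
  refine le_antisymm ?_ fun v hv => ?_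
  · rintro _ ⟨x, rfl⟩
    exact h0 x
  -- On `x + c_(-1) y`, with `c` the field of `e^(φ_γ)`, the screening operator returns `y`, because
  -- it anticommutes with `c_(-1)` to the identity and kills the image. In the kernel only `x` is
  -- left.
  · obtain ⟨x, y, rfl⟩ := mem_extendedImage.mp (mem_extendedImage_of_top v)
    have h := LinearMap.congr_fun (LatticeVA.anticomm_expo 0 (-1)) (realization y)
    rw [LinearMap.add_apply, Module.End.mul_apply, Module.End.mul_apply, h0, map_zero, add_zero,
      if_pos (by norm_num), Module.End.one_apply] at h
    rw [LinearMap.mem_ker, map_add, h0, zero_add, h] at hv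
    exact ⟨x, by rw [hv, map_zero, add_zero]⟩

end SymplecticFermions

/-! ### Transfer of the axioms and the isomorphisms. -/

namespace VertexOps

variable {V V' : Type*} [AddCommGroup V] [Module ℂ V] [AddCommGroup V'] [Module ℂ V']

/-- The axioms of a vertex superalgebra are inherited along injective homomorphisms. -/
theorem IsVertexSuperalgebra.of_injective {A : VertexOps V} {B : VertexOps V'}
    (hB : B.IsVertexSuperalgebra) {f : V →ₗ[ℂ] V'} (hf : Function.Injective f)
    (hA : IsCompl (A.parity 0) (A.parity 1)) (hpar : ∀ i a, f a ∈ B.parity i ↔ a ∈ A.parity i)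
    (hvac : f A.vac = B.vac) (hmode : ∀ a b n, f (A.mode a n b) = B.mode (f a) n (f b)) :
    A.IsVertexSuperalgebra where
  parity_isCompl := hA
  vac_even := by rw [← hpar, hvac]; exact hB.vac_even
  mode_parity i j a b n ha hb := by
    rw [← hpar, hmode]
    exact hB.mode_parity i j _ _ n ((hpar i a).mpr ha) ((hpar j b).mpr hb)
  vacuum n b := hf <| by
    rw [hmode, hvac, hB.vacuum, apply_ite f, map_zero]
  creation a := hf <| by rw [hmode, hvac, hB.creation]
  regular a n hn := hf <| by rw [hmode, hvac, hB.regular _ n hn, map_zero]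
  translation_covariance a b n := hf <| by
    have h := hB.translation_covariance (f a) (f b) n
    simp only [translation, ← hvac, ← hmode] at h
    simpa only [translation, map_sub, map_smul] using h
  locality i j a b ha hb := by
    obtain ⟨N, hN⟩ := hB.locality i j _ _ ((hpar i a).mpr ha) ((hpar j b).mpr hb)
    refine ⟨N, fun m n c => hf ?_⟩
    simp only [map_sum, map_smul, map_sub, hmode, map_zero]
    exact hN m n (f c)

end VertexOps

namespace SymplecticFermions

open VertexOps

/-- All axioms are identities or parity conditions that can be tested in the lattice vertex
superalgebra, because the realization is injective and respects parity and products. -/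
theorem isVertexSuperalgebra : vertexOps.IsVertexSuperalgebra :=
  LatticeVA.isVertexSuperalgebra.of_injective realization_injective parity_isCompl
    (fun _ _ => realization_mem_iff) realization_one fun a b n => intertwines a n b

theorem realization_mem_screeningKernel (x : FermionSpace) :
    realization x ∈ LatticeVA.screeningKernel := by
  rw [← range_realization]
  exact ⟨x, rfl⟩

theorem realization_psiState : realization psiState = LatticeVA.expo (-1) := by
  rw [psiState, realization_psi, realization_one]
  exact LatticeVA.isVertexSuperalgebra.creation _

theorem realization_psiStarState : realization psiStarState = LatticeVA.partialD (LatticeVA.expo 1) := by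
  rw [psiStarState, realization_psiStar, realization_one]
  exact LatticeVA.isVertexSuperalgebra.creation _

/-- The isomorphism of the symplectic fermions with the kernel of the short screening operator. -/
def kernelEquiv : FermionSpace ≃ₗ[ℂ] LatticeVA.screeningKernel :=
  LinearEquiv.ofBijective (realization.codRestrict _ realization_mem_screeningKernel)
    ⟨fun _ _ h => realization_injective (congr_arg Subtype.val h), fun v => by
      obtain ⟨x, hx⟩ := range_realization.ge v.2
      exact ⟨x, Subtype.ext hx⟩⟩

/-- `kernelEquiv` as an isomorphism of vertex superalgebras. -/
def kernelIso (hK : LatticeVA.vertexOps.IsSubalgebra LatticeVA.screeningKernel) :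
    vertexOps.Iso (LatticeVA.vertexOps.restrict _ hK) where
  toLinearEquiv := kernelEquiv
  map_parity _ _ := realization_mem_iff.symm
  map_vac := Subtype.ext realization_one
  map_mode a b n := Subtype.ext <| by
    refine Eq.trans ?_ (restrict_mode ..).symm
    exact intertwines a n b

theorem realization_mem_screeningKernelLong_iff (x : FermionSpace) :
    realization x ∈ LatticeVA.screeningKernelLong ↔ x ∈ evenSpace := by
  rw [LatticeVA.screeningKernelLong_eq]
  exact ⟨fun h => realization_mem_iff.mp h.1,
    fun h => ⟨realization_mem h, realization_mem_screeningKernel x⟩⟩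

/-- The isomorphism of the even part with the kernel in the lattice vertex algebra of the long
screening lattice. -/
def evenKernelEquiv : evenSpace ≃ₗ[ℂ] LatticeVA.screeningKernelLong :=
  LinearEquiv.ofBijective
    ((realization ∘ₗ evenSpace.subtype).codRestrict _ fun x =>
      (realization_mem_screeningKernelLong_iff x).mpr x.2)
    ⟨fun _ _ h => Subtype.ext (realization_injective (congr_arg Subtype.val h)), fun v => by
      obtain ⟨x, hx⟩ := range_realization.ge v.2.2
      exact ⟨⟨x, (realization_mem_screeningKernelLong_iff x).mp (hx ▸ v.2)⟩, Subtype.ext hx⟩⟩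

/-- `evenKernelEquiv` as an isomorphism of vertex algebras. -/
def evenKernelIso (hW : LatticeVA.vertexOps.IsSubalgebra LatticeVA.screeningKernelLong)
    (hE : vertexOps.IsSubalgebra evenSpace) :
    (vertexOps.restrict _ hE).Iso (LatticeVA.vertexOps.restrict _ hW) where
  toLinearEquiv := evenKernelEquiv
  map_parity _ _ := realization_mem_iff.symm
  map_vac := Subtype.ext realization_one
  map_mode a b n := Subtype.ext <| by
    refine Eq.trans ?_ (restrict_mode ..).symm
    change realization ((vertexOps.restrict _ hE).mode a n b : FermionSpace) = _
    rw [restrict_mode]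
    exact intertwines a n b

end SymplecticFermions

theorem mainTheorem2 :
    IsOddIntegralLattice (A1Datum.shortLattice 2) ∧
    (∀ x : ℝ, x ∈ A1Datum.shortLattice 2 ↔ ∃ m : ℤ, x = A1Datum.latticeVector m) ∧
    (∀ m n : ℤ, inner ℝ (A1Datum.latticeVector m) (A1Datum.latticeVector n) = ((m * n : ℤ) : ℝ)) ∧
    A1Datum.latticeVector (-1) = A1Datum.shortMomentum 2 ∧
    LatticeVA.vertexOps.IsVertexSuperalgebra ∧
    SymplecticFermions.vertexOps.IsVertexSuperalgebra ∧
    ∃ (hK : LatticeVA.vertexOps.IsSubalgebra LatticeVA.screeningKernel)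
      (hW : LatticeVA.vertexOps.IsSubalgebra LatticeVA.screeningKernelLong)
      (hE : SymplecticFermions.vertexOps.IsSubalgebra SymplecticFermions.evenSpace),
      (LatticeVA.vertexOps.restrict _ hK).IsVertexSuperalgebra ∧
      (LatticeVA.vertexOps.restrict _ hW).IsVertexAlgebra ∧
      (SymplecticFermions.vertexOps.restrict _ hE).IsVertexAlgebra ∧
      ∃ (F : SymplecticFermions.vertexOps.Iso (LatticeVA.vertexOps.restrict _ hK))
        (G : (SymplecticFermions.vertexOps.restrict _ hE).Iso
          (LatticeVA.vertexOps.restrict _ hW)),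
        (F.toLinearEquiv SymplecticFermions.psiState : LatticeSpace) = LatticeVA.expo (-1) ∧
        (F.toLinearEquiv SymplecticFermions.psiStarState : LatticeSpace) =
          LatticeVA.partialD (LatticeVA.expo 1) ∧
        ∀ a : SymplecticFermions.evenSpace,
          (G.toLinearEquiv a : LatticeSpace) =
            (F.toLinearEquiv (a : FermionSpace) : LatticeSpace) := by
  have hL : LatticeVA.screeningKernelLong ≤ LatticeVA.vertexOps.parity 0 := by
    rw [LatticeVA.screeningKernelLong_eq]
    exact inf_le_left
  exact ⟨A1Datum.isOddIntegralLattice_shortLattice, A1Datum.mem_shortLattice,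
    A1Datum.inner_latticeVector, A1Datum.latticeVector_neg_one, LatticeVA.isVertexSuperalgebra,
    SymplecticFermions.isVertexSuperalgebra, LatticeVA.isSubalgebra_screeningKernel,
    LatticeVA.isSubalgebra_screeningKernelLong,
    SymplecticFermions.isVertexSuperalgebra.isSubalgebra_even,
    LatticeVA.isVertexSuperalgebra.isVertexSuperalgebra_restrict _,
    LatticeVA.isVertexSuperalgebra.isVertexAlgebra_restrict _ hL,
    SymplecticFermions.isVertexSuperalgebra.isVertexAlgebra_restrict _ le_rfl,
    SymplecticFermions.kernelIso _, SymplecticFermions.evenKernelIso _ _,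
    SymplecticFermions.realization_psiState, SymplecticFermions.realization_psiStarState,
    fun _ => rfl⟩

end
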